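/- Let $k$ be an algebraically closed field. A finite category over $k$ is a $k$-linear abelian category with finite dimensional morphism spaces, in which every object has finite length, there are finitely many isomorphism classes of simple objects, and every simple object has a projective cover. A finite multi-tensor category over $k$ is a finite category $\mathcal C$ over $k$ with a monoidal structure whose tensor product is $k$-bilinear on morphisms, such that every object has a left and a right dual, the unit object is a finite direct sum of simple objects, ${\bf 1}=\bigoplus_{i\in I}{\bf 1}_i$, and $\mathcal C$ is indecomposable, i.e. ${\bf 1}_i\otimes\mathcal C\otimes{\bf 1}_j\neq 0$ for all $i,j\in I$; it is a finite tensor category if moreover ${\bf 1}$ is simple. A module category over $\mathcal C$ is a $k$-linear abelian category $\mathcal M$ with finite dimensional morphism spaces, objects of finite length and finitely many isomorphism classes of simple objects, with an action $\otimes:\mathcal C\times\mathcal M\to\mathcal M$ that is $k$-bilinear on morphisms and exact in each variable, and with the usual coherent associativity and unit isomorphisms. It is exact if $P\otimes X$ is projective for every projective $P\in\mathcal C$ and every $X\in\mathcal M$, and it is indecomposable if it is nonzero and is not the direct sum of two nonzero module subcategories. Let $\mathcal C^*_{\mathcal M}=\mathrm{Fun}_{\mathcal C}(\mathcal M,\mathcal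 M)$ be the category of additive $\mathcal C$-module functors $\mathcal M\to\mathcal M$ and $\mathcal C$-module natural transformations, with the tensor product given by composition, $(F\otimes G)(X)=F(G(X))$; it acts on $\mathcal M$ by $F\otimes X=F(X)$. Theorem. Let $\mathcal C$ be a finite multi-tensor category over $k$ and let $\mathcal M$ be a nonzero exact module category over $\mathcal C$. Then: 1. The canonical tensor functor $can:\mathcal C\to(\mathcal C^*_{\mathcal M})^*_{\mathcal M}$, which sends $X$ to the functor $X\otimes -$ with the $\mathcal C^*_{\mathcal M}$-module structure given by the isomorphisms $F(X\otimes Y)\cong X\otimes F(Y)$ for $F\in\mathcal C^*_{\mathcal M}$, $Y\in\mathcal M$, is an equivalence of categories. 2. $\mathcal C^*_{\mathcal M}$ is a finite multi-tensor category over $k$, and it is a finite tensor category if $\mathcal M$ is indecomposable. 3. $\mathcal M$ is an exact module category over $\mathcal C^*_{\mathcal M}$. -/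

import Mathlib

open CategoryTheory CategoryTheory.Limits CategoryTheory.MonoidalCategory

set_option linter.unusedSectionVars false

namespace FinTens

open scoped CategoryTheory.MonoidalCategory.MonoidalLeftAction
open CategoryTheory.Functor.LaxLeftLinear CategoryTheory.Functor.OplaxLeftLinear
open CategoryTheory.Functor.LeftLinear

universe w v₁ u₁ v₂ u₂ v u

/-! ### Finite abelian categories over a field -/

section Finite

variable (C : Type u) [Category.{v} C] [Preadditive C]

/-- The preadditive category `C` is abelian (as a property of its preadditive structure). -/
structure IsAbelian : Prop where
  hasFiniteProducts : HasFiniteProducts C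
  hasKernels : HasKernels C
  hasCokernels : HasCokernels C
  normalMono : IsNormalMonoCategory C
  normalEpi : IsNormalEpiCategory C

/-- A `k`-linear abelian category with finite dimensional morphism spaces, in which every
object has finite length (i.e. is Artinian and Noetherian). -/
structure IsLocallyFinite (k : Type w) [Field k] [Linear k C] : Prop where
  isAbelian : IsAbelian C
  finiteDimensional_hom : ∀ X Y : C, Module.Finite k (X ⟶ Y)
  finiteLength : ∀ X : C, IsArtinianObject X ∧ IsNoetherianObject X

/-- There are only finitely many isomorphism classes of simple objects. -/
def HasFinitelyManySimples : Prop :=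
  ∃ (n : ℕ) (S : Fin n → C), ∀ X : C, Simple X → ∃ i, Nonempty (X ≅ S i)

variable {C} in
/-- `p : P ⟶ X` is a projective cover: `P` is projective and `p` is an essential epimorphism. -/
structure IsProjectiveCover {P X : C} (p : P ⟶ X) : Prop where
  projective : Projective P
  epi : Epi p
  essential : ∀ {Q : C} (g : Q ⟶ P), Epi (g ≫ p) → Epi g

/-- A finite `k`-linear abelian category: morphism spaces are finite dimensional, objects have
finite length, there are finitely many simple objects, and each of them has a projective cover. -/
structure IsFiniteCategory (k : Type w) [Field k] [Linear k C] : Prop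
    extends IsLocallyFinite C k where
  finitelyManySimples : HasFinitelyManySimples C
  projectiveCover : ∀ X : C, Simple X → ∃ (P : C) (p : P ⟶ X), IsProjectiveCover p

/-- `𝟙 = ⨁ᵢ eᵢ` for finitely many simple objects `eᵢ`, and all the components
`eᵢ ⊗ C ⊗ eⱼ` are nonzero. -/
def HasIndecomposableSemisimpleUnit [MonoidalCategory C] : Prop :=
  ∃ (n : ℕ) (e : Fin n → C) (b : Bicone e), Nonempty b.IsBilimit ∧ Nonempty (b.pt ≅ 𝟙_ C) ∧
    (∀ i, Simple (e i)) ∧ ∀ i j, ∃ X : C, ¬ IsZero (e i ⊗ X ⊗ e j)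

/-- A finite (indecomposable) multi-tensor category over `k`: a finite `k`-linear abelian
category with a `k`-bilinear tensor product, in which every object has a left and a right dual,
whose unit object is a direct sum of simple objects, and which is indecomposable. -/
structure IsFiniteMultiTensorCategory (k : Type w) [Field k] [Linear k C]
    [MonoidalCategory C] : Prop extends IsFiniteCategory C k where
  monoidalPreadditive : MonoidalPreadditive C
  monoidalLinear : MonoidalLinear k C
  hasLeftDual : ∀ X : C, Nonempty (HasLeftDual X)
  hasRightDual : ∀ X : C, Nonempty (HasRightDual X)
  unit : HasIndecomposableSemisimpleUnit C

/-- A finite tensor category over `k`: a finite multi-tensor category with simple unit. -/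
structure IsFiniteTensorCategory (k : Type w) [Field k] [Linear k C]
    [MonoidalCategory C] : Prop extends IsFiniteMultiTensorCategory C k where
  simple_unit : Simple (𝟙_ C)

end Finite

/-! ### Module categories -/

section ModuleCategories

variable (C : Type u₁) [Category.{v₁} C] [Preadditive C] [MonoidalCategory C]
  (M : Type u₂) [Category.{v₂} M] [Preadditive M] [MonoidalLeftAction C M]

/-- The action `C × M ⥤ M` is biadditive on morphisms. -/
class PreadditiveAction : Prop where
  add_actionHomLeft : ∀ {c c' : C} (f g : c ⟶ c') (m : M),
    (f + g) ⊵ₗ m = f ⊵ₗ m + g ⊵ₗ m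
  actionHomRight_add : ∀ (c : C) {m m' : M} (f g : m ⟶ m'),
    c ⊴ₗ (f + g) = c ⊴ₗ f + c ⊴ₗ g

/-- The action `C × M ⥤ M` is `k`-bilinear on morphisms. -/
class LinearAction (k : Type w) [Field k] [Linear k C] [Linear k M] : Prop where
  smul_actionHomLeft : ∀ (r : k) {c c' : C} (f : c ⟶ c') (m : M),
    (r • f) ⊵ₗ m = r • (f ⊵ₗ m)
  actionHomRight_smul : ∀ (c : C) (r : k) {m m' : M} (f : m ⟶ m'),
    c ⊴ₗ (r • f) = r • (c ⊴ₗ f)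

/-- An exact functor: it preserves finite limits and finite colimits. -/
def IsExactFunctor {A : Type u₁} [Category.{v₁} A] {B : Type u₂} [Category.{v₂} B]
    (F : A ⥤ B) : Prop :=
  PreservesFiniteLimits F ∧ PreservesFiniteColimits F

/-- `M` is a module category over `C` (over the ground field `k`): a `k`-linear abelian category
with finite dimensional morphism spaces, objects of finite length and finitely many simple
objects, with a coherent action of `C` that is `k`-bilinear on morphisms and exact in each
variable. -/
structure IsModuleCategory (k : Type w) [Field k] [Linear k C] [Linear k M]
    [PreadditiveAction C M] [LinearAction C M k] : Prop extends IsLocallyFinite M k where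
  finitelyManySimples : HasFinitelyManySimples M
  exact_left : ∀ c : C, IsExactFunctor (MonoidalLeftAction.actionLeft M c)
  exact_right : ∀ m : M, IsExactFunctor (MonoidalLeftAction.actionRight C m)

/-- `M` is an exact module category over `C`: `P ⊙ₗ X` is projective for every projective
`P : C` and every `X : M`. -/
structure IsExactModuleCategory (k : Type w) [Field k] [Linear k C] [Linear k M]
    [PreadditiveAction C M] [LinearAction C M k] : Prop extends IsModuleCategory C M k where
  projective_action : ∀ (P : C) (X : M), Projective P → Projective (P ⊙ₗ X)

/-- `M` is an indecomposable module category: it is nonzero and is not the direct sum of two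
nonzero module subcategories. -/
def IsIndecomposableModule : Prop :=
  (∃ X : M, ¬ IsZero X) ∧
  ∀ P Q : ObjectProperty M, P.IsClosedUnderIsomorphisms → Q.IsClosedUnderIsomorphisms →
    (∀ (c : C) (X : M), P X → P (c ⊙ₗ X)) → (∀ (c : C) (Y : M), Q Y → Q (c ⊙ₗ Y)) →
    (∀ X Y : M, P X → Q Y → (∀ f : X ⟶ Y, f = 0) ∧ (∀ g : Y ⟶ X, g = 0)) →
    (∀ Z : M, ∃ (X Y : M) (b : BinaryBicone X Y), P X ∧ Q Y ∧ Nonempty b.IsBilimit ∧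
      Nonempty (b.pt ≅ Z)) →
    (∀ X, P X → IsZero X) ∨ (∀ Y, Q Y → IsZero Y)

end ModuleCategories

/-! ### The dual category -/

section Dual

/-- The dual category `C*_M = Fun_C(M, M)`: objects are additive `C`-module endofunctors of `M`. -/
structure Dual (C : Type u₁) [Category.{v₁} C] [MonoidalCategory C]
    (M : Type u₂) [Category.{v₂} M] [Preadditive M] [MonoidalLeftAction C M] where
  /-- The underlying functor. -/
  functor : M ⥤ M
  additive : functor.Additive
  /-- The module functor structure `c ⊙ₗ F m ≅ F (c ⊙ₗ m)`. -/
  linear : functor.LeftLinear C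

namespace Dual

variable {C : Type u₁} [Category.{v₁} C] [MonoidalCategory C]
    {M : Type u₂} [Category.{v₂} M] [Preadditive M] [MonoidalLeftAction C M]

instance (F : Dual C M) : F.functor.Additive := F.additive

instance (F : Dual C M) : F.functor.LeftLinear C := F.linear

/-- Morphisms of module functors: natural transformations compatible with the module
structures. -/
@[ext]
structure Hom (F G : Dual C M) where
  /-- The underlying natural transformation. -/
  nat : F.functor ⟶ G.functor
  comm : ∀ (c : C) (m : M),
    μₗ F.functor c m ≫ nat.app (c ⊙ₗ m) = c ⊴ₗ nat.app m ≫ μₗ G.functor c m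

@[simps]
instance : Category (Dual C M) where
  Hom F G := Hom F G
  id F := ⟨𝟙 _, by simp⟩
  comp α β := ⟨α.nat ≫ β.nat, fun c m => by
    rw [NatTrans.comp_app, ← Category.assoc, α.comm, Category.assoc, β.comm]
    simp⟩

@[ext]
theorem hom_ext {F G : Dual C M} {α β : F ⟶ G} (h : ∀ m, α.nat.app m = β.nat.app m) : α = β :=
  Hom.ext (by ext m; exact h m)

theorem comm_δ {F G : Dual C M} (α : F ⟶ G) (c : C) (m : M) :
    α.nat.app (c ⊙ₗ m) ≫ δₗ G.functor c m = δₗ F.functor c m ≫ c ⊴ₗ α.nat.app m := by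
  rw [← cancel_epi (μₗ F.functor c m), ← Category.assoc, α.comm]
  simp

/-- An isomorphism in the dual category from an isomorphism of functors. -/
@[simps]
def mkIso {F G : Dual C M} (e : F.functor ≅ G.functor)
    (h : ∀ (c : C) (m : M),
      μₗ F.functor c m ≫ e.hom.app (c ⊙ₗ m) = c ⊴ₗ e.hom.app m ≫ μₗ G.functor c m) :
    F ≅ G where
  hom := ⟨e.hom, h⟩
  inv := ⟨e.inv, fun c m => by
    have h1 : c ⊴ₗ e.inv.app m ≫ c ⊴ₗ e.hom.app m = 𝟙 _ := by
      rw [← MonoidalLeftAction.actionHomRight_comp]; simp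
    rw [← cancel_mono (e.hom.app (c ⊙ₗ m)), Category.assoc, Category.assoc, h,
      reassoc_of% h1]
    simp⟩

section Monoidal

/-- The module structure on the identity functor. -/
instance idLinear : (𝟭 M).LeftLinear C where
  μₗ c m := 𝟙 _
  δₗ c m := 𝟙 _
  μₗ_comp_δₗ c m := by simp
  δₗ_comp_μₗ c m := by simp

/-- The module structure `c ⊙ₗ F (G m) ≅ F (c ⊙ₗ G m) ≅ F (G (c ⊙ₗ m))` on a composition. -/
instance compLinear (G F : M ⥤ M) [G.LeftLinear C] [F.LeftLinear C] :
    (G ⋙ F).LeftLinear C where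
  μₗ c m := μₗ F c (G.obj m) ≫ F.map (μₗ G c m)
  δₗ c m := F.map (δₗ G c m) ≫ δₗ F c (G.obj m)
  μₗ_naturality_left f m := by
    simp only [Functor.comp_obj, Functor.comp_map, Category.assoc]
    rw [μₗ_naturality_left_assoc, ← F.map_comp, ← F.map_comp, μₗ_naturality_left]
  μₗ_naturality_right c m m' f := by
    simp only [Functor.comp_obj, Functor.comp_map, Category.assoc]
    rw [μₗ_naturality_right_assoc, ← F.map_comp, ← F.map_comp, μₗ_naturality_right]
  μₗ_associativity c c' m := by
    simp only [Functor.comp_obj, Functor.comp_map, Category.assoc]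
    rw [← F.map_comp, μₗ_associativity, F.map_comp, F.map_comp, μₗ_associativity_assoc,
      MonoidalLeftAction.actionHomRight_comp, Category.assoc, μₗ_naturality_right_assoc]
  μₗ_unitality m := by
    simp only [Functor.comp_obj, Functor.comp_map, Category.assoc]
    rw [← F.map_comp, ← μₗ_unitality, ← μₗ_unitality]
  δₗ_naturality_left f m := by
    simp only [Functor.comp_obj, Functor.comp_map, Category.assoc]
    rw [← F.map_comp_assoc, δₗ_naturality_left, F.map_comp_assoc, δₗ_naturality_left]
  δₗ_naturality_right c m m' f := by
    simp only [Functor.comp_obj, Functor.comp_map, Category.assoc]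
    rw [← F.map_comp_assoc, δₗ_naturality_right, F.map_comp_assoc, δₗ_naturality_right]
  δₗ_associativity c c' m := by
    simp only [Functor.comp_obj, Functor.comp_map, Category.assoc]
    rw [δₗ_associativity, ← F.map_comp_assoc, δₗ_associativity, F.map_comp_assoc,
      F.map_comp_assoc, MonoidalLeftAction.actionHomRight_comp, δₗ_naturality_right_assoc]
  δₗ_unitality_inv m := by
    simp only [Functor.comp_obj, Functor.comp_map]
    rw [← F.map_comp_assoc, ← δₗ_unitality_inv, ← δₗ_unitality_inv]
  μₗ_comp_δₗ c m := by
    simp [← F.map_comp_assoc]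
  δₗ_comp_μₗ c m := by
    simp [← F.map_comp]

@[simp]
theorem μₗ_id (c : C) (m : M) : μₗ (𝟭 M) c m = 𝟙 _ := rfl

@[simp]
theorem μₗ_comp (G F : M ⥤ M) [G.LeftLinear C] [F.LeftLinear C] (c : C) (m : M) :
    μₗ (G ⋙ F) c m = μₗ F c (G.obj m) ≫ F.map (μₗ G c m) := rfl

@[simp]
theorem δₗ_id (c : C) (m : M) : δₗ (𝟭 M) c m = 𝟙 _ := rfl

@[simp]
theorem δₗ_comp (G F : M ⥤ M) [G.LeftLinear C] [F.LeftLinear C] (c : C) (m : M) :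
    δₗ (G ⋙ F) c m = F.map (δₗ G c m) ≫ δₗ F c (G.obj m) := rfl

/-- The tensor product on the dual category is the composition of functors,
`(F ⊗ G) m = F (G m)`. -/
@[simps]
instance : MonoidalCategoryStruct (Dual C M) where
  tensorObj F G := ⟨G.functor ⋙ F.functor, inferInstance, inferInstance⟩
  tensorUnit := ⟨𝟭 M, inferInstance, inferInstance⟩
  whiskerLeft F _ _ α := ⟨Functor.whiskerRight α.nat F.functor, fun c m => by
    simp only [μₗ_comp, Functor.whiskerRight_app, Functor.comp_obj, Category.assoc]
    rw [← F.functor.map_comp, α.comm, F.functor.map_comp, μₗ_naturality_right_assoc]⟩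
  whiskerRight α G := ⟨Functor.whiskerLeft G.functor α.nat, fun c m => by
    simp only [μₗ_comp, Functor.whiskerLeft_app, Functor.comp_obj, Category.assoc]
    rw [α.nat.naturality, ← Category.assoc, α.comm, Category.assoc]⟩
  associator F G H := mkIso (Functor.associator _ _ _).symm (fun c m => by simp)
  leftUnitor F := mkIso (Functor.rightUnitor _) (fun c m => by simp)
  rightUnitor F := mkIso (Functor.leftUnitor _) (fun c m => by simp)

instance : MonoidalCategory (Dual C M) :=
  MonoidalCategory.ofTensorHom

end Monoidal

section Action

/-- `M` is a module category over its dual category by evaluation, `F ⊙ₗ m = F m`. -/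
@[simps]
instance : MonoidalLeftActionStruct (Dual C M) M where
  actionObj F m := F.functor.obj m
  actionHomLeft α m := α.nat.app m
  actionHomRight F _ _ f := F.functor.map f
  actionAssocIso _ _ _ := Iso.refl _
  actionUnitIso _ := Iso.refl _

instance : MonoidalLeftAction (Dual C M) M where
  actionHom_def _ _ := rfl

end Action

end Dual

/-! ### Linear structure of the dual category -/

namespace Dual

variable {C : Type u₁} [Category.{v₁} C] [Preadditive C] [MonoidalCategory C]
    {M : Type u₂} [Category.{v₂} M] [Preadditive M] [MonoidalLeftAction C M]
    [PreadditiveAction C M]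

section Preadditive

theorem actionHomRight_zero (c : C) (m m' : M) : c ⊴ₗ (0 : m ⟶ m') = 0 := by
  have h := PreadditiveAction.actionHomRight_add c (0 : m ⟶ m') 0
  simpa using h

theorem actionHomRight_neg (c : C) {m m' : M} (f : m ⟶ m') : c ⊴ₗ (-f) = -(c ⊴ₗ f) := by
  rw [eq_neg_iff_add_eq_zero, ← PreadditiveAction.actionHomRight_add, neg_add_cancel,
    actionHomRight_zero]

/-- Morphisms of module functors form a subgroup of all natural transformations. -/
def homSubgroup (F G : Dual C M) : AddSubgroup (F.functor ⟶ G.functor) where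
  carrier := {α | ∀ (c : C) (m : M),
    μₗ F.functor c m ≫ α.app (c ⊙ₗ m) = c ⊴ₗ α.app m ≫ μₗ G.functor c m}
  zero_mem' c m := by simp [actionHomRight_zero]
  add_mem' {α β} hα hβ c m := by
    simp [PreadditiveAction.actionHomRight_add, hα c m, hβ c m]
  neg_mem' {α} hα c m := by simp [actionHomRight_neg, hα c m]

/-- The identification of morphisms of module functors with a subgroup. -/
def homEquiv (F G : Dual C M) : (F ⟶ G) ≃ homSubgroup F G where
  toFun α := ⟨α.nat, α.comm⟩
  invFun α := ⟨α.1, α.2⟩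

instance (F G : Dual C M) : AddCommGroup (F ⟶ G) := (homEquiv F G).addCommGroup

theorem add_nat {F G : Dual C M} (α β : F ⟶ G) : (α + β).nat = α.nat + β.nat := rfl

/-- Morphisms are added pointwise. -/
@[simp]
theorem add_nat_app {F G : Dual C M} (α β : F ⟶ G) (m : M) :
    (α + β).nat.app m = α.nat.app m + β.nat.app m := rfl

instance : Preadditive (Dual C M) where
  add_comp _ _ _ _ _ _ := by ext; simp
  comp_add _ _ _ _ _ _ := by ext; simp

instance : PreadditiveAction (Dual C M) M where
  add_actionHomLeft _ _ _ := rfl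
  actionHomRight_add F _ _ _ _ := F.functor.map_add

end Preadditive

section Linear

variable {k : Type w} [Field k] [Linear k C] [Linear k M] [LinearAction C M k]

/-- An additive module functor is automatically `k`-linear. -/
theorem map_smul (F : M ⥤ M) [F.LeftLinear C] (r : k) {m m' : M} (f : m ⟶ m') :
    F.map (r • f) = r • F.map f := by
  have key : ∀ m : M, F.map (r • 𝟙 m) = r • 𝟙 (F.obj m) := by
    intro m
    have h1 : ∀ m : M, r • 𝟙 m = (λₗ[C] m).inv ≫ (r • 𝟙 (𝟙_ C)) ⊵ₗ m ≫ (λₗ[C] m).hom := by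
      intro m
      rw [LinearAction.smul_actionHomLeft]
      simp
    rw [h1 m, h1 (F.obj m), F.map_comp, F.map_comp, ← μₗ_unitality_inv (F := F) (C := C),
      μₗ_unitality (F := F) (C := C), Category.assoc, μₗ_naturality_left_assoc]
  have h : r • f = (r • 𝟙 m) ≫ f := by simp
  rw [h, F.map_comp, key]
  simp

instance (F G : Dual C M) : SMul k (F ⟶ G) where
  smul r α := ⟨r • α.nat, fun c m => by
    simp [LinearAction.actionHomRight_smul, α.comm c m]⟩

/-- Scalars act pointwise on morphisms. -/
@[simp]
theorem smul_nat_app {F G : Dual C M} (r : k) (α : F ⟶ G) (m : M) :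
    (r • α).nat.app m = r • α.nat.app m := rfl

/-- The underlying natural transformation, as an additive map. -/
def natHom (F G : Dual C M) : (F ⟶ G) →+ (F.functor ⟶ G.functor) where
  toFun α := α.nat
  map_zero' := rfl
  map_add' _ _ := rfl

instance (F G : Dual C M) : Module k (F ⟶ G) :=
  Function.Injective.module k (natHom F G) (fun _ _ h => Hom.ext h) (fun _ _ => rfl)

instance : Linear k (Dual C M) where
  smul_comp _ _ _ _ _ _ := by ext; simp
  comp_smul _ _ _ _ _ _ := by ext; simp

instance : LinearAction (Dual C M) M k where
  smul_actionHomLeft _ _ _ _ _ := rfl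
  actionHomRight_smul F r _ _ f := map_smul (C := C) F.functor r f

end Linear

end Dual

/-! ### The canonical functor to the double dual -/

section Can

variable (C : Type u₁) [Category.{v₁} C] [Preadditive C] [MonoidalCategory C]
    (M : Type u₂) [Category.{v₂} M] [Preadditive M] [MonoidalLeftAction C M]
    [PreadditiveAction C M]

variable {C} in
/-- The functor `X ⊙ₗ - : M ⥤ M` is a `C*_M`-module functor, through the inverses
`F (X ⊙ₗ m) ≅ X ⊙ₗ F m` of the module structures of the functors `F` in `C*_M`. -/
instance actionLeftLinear (X : C) :
    (MonoidalLeftAction.actionLeft M X).LeftLinear (Dual C M) where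
  μₗ F m := δₗ F.functor X m
  δₗ F m := μₗ F.functor X m
  μₗ_naturality_left α m := Dual.comm_δ α X m
  μₗ_naturality_right F m m' f := δₗ_naturality_right F.functor X f
  μₗ_associativity F G m := by
    change (F.functor.map (δₗ G.functor X m) ≫ δₗ F.functor X _) ≫ X ⊴ₗ 𝟙 _ =
      𝟙 _ ≫ F.functor.map (δₗ G.functor X m) ≫ δₗ F.functor X _
    simp
  μₗ_unitality m := by
    change 𝟙 _ = 𝟙 _ ≫ X ⊴ₗ 𝟙 m
    simp
  δₗ_naturality_left α m := (α.comm X m).symm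
  δₗ_naturality_right F m m' f := μₗ_naturality_right F.functor X f
  δₗ_associativity F G m := by
    change (μₗ F.functor X _ ≫ F.functor.map (μₗ G.functor X m)) ≫ 𝟙 _ =
      X ⊴ₗ 𝟙 _ ≫ μₗ F.functor X _ ≫ F.functor.map (μₗ G.functor X m)
    simp
  δₗ_unitality_inv m := by
    change 𝟙 _ = X ⊴ₗ 𝟙 m ≫ 𝟙 _
    simp
  μₗ_comp_δₗ F m := δₗ_comp_μₗ F.functor X m
  δₗ_comp_μₗ F m := μₗ_comp_δₗ F.functor X m

@[simp]
theorem μₗ_actionLeft (X : C) (F : Dual C M) (m : M) :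
    μₗ (MonoidalLeftAction.actionLeft M X) F m = δₗ F.functor X m := rfl

/-- The canonical functor `C ⥤ (C*_M)*_M`, sending `X` to `X ⊙ₗ -`. -/
@[simps]
def can : C ⥤ Dual (Dual C M) M where
  obj X := ⟨MonoidalLeftAction.actionLeft M X,
    ⟨fun {_ _ f g} => PreadditiveAction.actionHomRight_add X f g⟩, inferInstance⟩
  map f := ⟨(MonoidalLeftAction.curriedAction C M).map f,
    fun F m => (δₗ_naturality_left F.functor f m).symm⟩
  map_id X := by ext m; simp
  map_comp f g := by ext m; simp

/-- The unit constraint `𝟭 M ≅ 𝟙 ⊙ₗ -` of the canonical functor. -/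
def canε : 𝟙_ (Dual (Dual C M) M) ≅ (can C M).obj (𝟙_ C) :=
  Dual.mkIso (MonoidalLeftAction.actionUnitNatIso C M).symm (fun F m => by
    change 𝟙 _ ≫ (λₗ[C] (F.functor.obj m)).inv =
      F.functor.map (λₗ[C] m).inv ≫ δₗ F.functor (𝟙_ C) m
    rw [Category.id_comp, δₗ_unitality_inv])

/-- The tensor constraint `X ⊙ₗ Y ⊙ₗ m ≅ (X ⊗ Y) ⊙ₗ m` of the canonical functor. -/
def canμ (X Y : C) : (can C M).obj X ⊗ (can C M).obj Y ≅ (can C M).obj (X ⊗ Y) :=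
  Dual.mkIso (NatIso.ofComponents (fun m => (αₗ X Y m).symm) (by
    intro m m' f
    change X ⊴ₗ Y ⊴ₗ f ≫ (αₗ X Y m').inv = (αₗ X Y m).inv ≫ (X ⊗ Y) ⊴ₗ f
    simp)) (fun F m => by
    change (δₗ F.functor X _ ≫ X ⊴ₗ δₗ F.functor Y m) ≫ (αₗ X Y (F.functor.obj m)).inv =
      F.functor.map (αₗ X Y m).inv ≫ δₗ F.functor (X ⊗ Y) m
    rw [Category.assoc, δₗ_associativity_inv])

theorem canε_app (m : M) : (canε C M).hom.nat.app m = (λₗ[C] m).inv := rfl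

theorem canμ_app (X Y : C) (m : M) : (canμ C M X Y).hom.nat.app m = (αₗ X Y m).inv := rfl

/-- The canonical functor is a tensor functor. -/
def canCoreMonoidal : (can C M).CoreMonoidal where
  εIso := canε C M
  μIso := canμ C M
  μIso_hom_natural_left {X X'} f Y := by
    ext m
    change f ⊵ₗ (Y ⊙ₗ m) ≫ (αₗ X' Y m).inv = (αₗ X Y m).inv ≫ (f ▷ Y) ⊵ₗ m
    simp
  μIso_hom_natural_right {Y Y'} X f := by
    ext m
    change X ⊴ₗ f ⊵ₗ m ≫ (αₗ X Y' m).inv = (αₗ X Y m).inv ≫ (X ◁ f) ⊵ₗ m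
    simp
  associativity X Y Z := by
    ext m
    change (αₗ X Y (Z ⊙ₗ m)).inv ≫ (αₗ (X ⊗ Y) Z m).inv ≫ (α_ X Y Z).hom ⊵ₗ m =
      𝟙 _ ≫ X ⊴ₗ (αₗ Y Z m).inv ≫ (αₗ X (Y ⊗ Z) m).inv
    rw [← cancel_mono (αₗ X (Y ⊗ Z) m).hom, ← cancel_mono (X ⊴ₗ (αₗ Y Z m).hom)]
    simp
  left_unitality X := by
    ext m
    change 𝟙 _ = (λₗ[C] (X ⊙ₗ m)).inv ≫ (αₗ (𝟙_ C) X m).inv ≫ (λ_ X).hom ⊵ₗ m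
    simp
  right_unitality X := by
    ext m
    change 𝟙 _ = X ⊴ₗ (λₗ[C] m).inv ≫ (αₗ X (𝟙_ C) m).inv ≫ (ρ_ X).hom ⊵ₗ m
    simp

instance : (can C M).Monoidal := (canCoreMonoidal C M).toMonoidal

instance : (can C M).Additive where
  map_add {_ _ f g} := by
    ext m; exact PreadditiveAction.add_actionHomLeft f g m

instance (k : Type w) [Field k] [Linear k C] [Linear k M] [LinearAction C M k] :
    (can C M).Linear k where
  map_smul {_ _} f r := by
    ext m; exact LinearAction.smul_actionHomLeft r f m

end Can

end Dual

end FinTens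

/-! The hypotheses on `C` acting on `M` are packaged (`IsFiniteExactAction`) so that they pass to
the dual category acting on `M` (`isFiniteExactAction_dual`). Whatever is proved for one action can
then be used for the other, and the double dual is reached by applying the construction twice.

Let `P` be projective with an epimorphism onto the unit. By exactness of the module category, `P ⊙ₗ
-` turns short exact sequences into split ones, and it is faithful. An additive module functor
commutes with `P ⊙ₗ -`, hence is exact (`shortExact_map_of_linear`). Limits and colimits of module
functors are pointwise because the action is exact, so the dual category is abelian. With `[y, -]`
the internal Hom, the functors `[y, -] ⊙ₗ z` are free: morphisms from them to `G` are morphisms `z ⟶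
G y`. If `Q` is a projective separator of `M`, then `[Q, -] ⊙ₗ Q` is a projective separator of the
dual category, and evaluation at `Q` is faithful. This gives the finiteness statements, and also
that projective module functors take projective values, since `[Q, X] ⊙ₗ Q` is projective. Adjoints
of module functors exist by a dimension count (`isLeftAdjoint_of_isSeparator`), inherit module
structures because `C` has duals, and are the duals in the dual category.

In a rigid abelian category every subobject of the unit splits off
(`exists_retraction_of_mono_unit`), so an Artinian unit is a sum of simples. A nontrivial splitting
of the unit of the dual category decomposes `M`. The components of the dual category are nonzero
because `C` acts faithfully in a strong sense (`exists_action_ne_zero`).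

For `can`, let `x` be a left dual of `[y, m]`. Then `Hom(x, X) ≅ Hom(y, X ⊙ₗ m)`, and compatibility
with the free module functors gives `Hom(can x, G) ≅ Hom(y, G m)` for every `G` in the double dual.
So `can` is full on morphisms out of such `x`. When `m` is a separator, every `X` is a quotient of
some such `x` and every `G` a quotient of some `can x`. As `can` is faithful and right exact,
presentations by these objects make it an equivalence (`isEquivalence_of_covers`). -/

namespace FinTens

open scoped ZeroObject
open scoped CategoryTheory.MonoidalCategory.MonoidalLeftAction
open CategoryTheory.Functor.LaxLeftLinear CategoryTheory.Functor.OplaxLeftLinear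
open CategoryTheory.Functor.LeftLinear
open MonoidalLeftAction (actionLeft actionRight actionHomRight_comp actionHomRight_comp_assoc
  action_exchange action_exchange_assoc)

universe w v₁ u₁ v₂ u₂ v u

/-! ### Abelian categories with finite dimensional morphism spaces -/

/-- The abelian structure on a preadditive category that has the property of being abelian. -/
noncomputable abbrev IsAbelian.toAbelian {A : Type u} [Category.{v} A] [Preadditive A]
    (h : IsAbelian A) : Abelian A :=
  letI := h.hasFiniteProducts
  letI := h.hasKernels
  letI := h.hasCokernels
  letI := h.normalMono
  letI := h.normalEpi
  { (inferInstance : Preadditive A) with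
    has_kernels := h.hasKernels
    has_cokernels := h.hasCokernels
    has_finite_products := h.hasFiniteProducts
    normalMonoOfMono := h.normalMono.normalMonoOfMono
    normalEpiOfEpi := h.normalEpi.normalEpiOfEpi }

theorem isAbelian_of_abelian (A : Type u) [Category.{v} A] [Abelian A] : IsAbelian A where
  hasFiniteProducts := inferInstance
  hasKernels := inferInstance
  hasCokernels := inferInstance
  normalMono := inferInstance
  normalEpi := inferInstance

/-! ### Simple quotients, projective covers, separators and coseparators. -/

section Abelian

variable {A : Type u} [Category.{v} A] [Abelian A]

/-- The cokernel of a maximal proper subobject is simple: the kernel of a nonzero morphism out of it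
pulls back to a proper subobject containing the maximal one. -/
theorem exists_simple_quotient {X : A} [IsNoetherianObject X] (hX : ¬ IsZero X) :
    ∃ (S : A) (p : X ⟶ S), Simple S ∧ Epi p := by
  have hne : ({K : Subobject X | K ≠ ⊤}).Nonempty := by
    have := Subobject.nontrivial_of_not_isZero hX
    exact ⟨⊥, bot_ne_top⟩
  obtain ⟨K, hK, hmax⟩ := (wellFounded_gt (α := Subobject X)).has_min _ hne
  refine ⟨cokernel K.arrow, cokernel.π K.arrow, simple_of_cosimple _ fun {Z} f _ => ⟨?_, ?_⟩,
    inferInstance⟩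
  · rintro _ rfl
    apply hK
    have hz : cokernel.π K.arrow = 0 := by
      rw [← cancel_mono (0 : cokernel K.arrow ⟶ Z)]; simp
    have : Epi K.arrow := Preadditive.epi_of_cokernel_zero hz
    have : IsIso K.arrow := isIso_of_mono_of_epi _
    exact Subobject.eq_top_of_isIso_arrow K
  · intro hf
    have hle : K ≤ kernelSubobject (cokernel.π K.arrow ≫ f) :=
      le_kernelSubobject _ _ (by simp)
    have hnt : kernelSubobject (cokernel.π K.arrow ≫ f) ≠ ⊤ := by
      intro h
      apply hf
      rw [← cancel_epi (cokernel.π K.arrow), comp_zero]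
      have h2 := kernelSubobject_arrow_comp (cokernel.π K.arrow ≫ f)
      have : IsIso (kernelSubobject (cokernel.π K.arrow ≫ f)).arrow := by
        rw [h]; infer_instance
      rwa [← cancel_epi (kernelSubobject (cokernel.π K.arrow ≫ f)).arrow, comp_zero]
    have hle' : kernelSubobject (cokernel.π K.arrow ≫ f) ≤ K := by
      by_contra hc
      exact hmax _ hnt (lt_of_le_not_ge hle hc)
    have hz : kernel.ι (cokernel.π K.arrow ≫ f) ≫ cokernel.π K.arrow = 0 := by
      have hK0 : K.arrow ≫ cokernel.π K.arrow = 0 := cokernel.condition _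
      rw [← kernelSubobject_arrow', ← Subobject.ofLE_arrow hle', Category.assoc, Category.assoc,
        hK0, comp_zero, comp_zero]
    have : IsSplitMono f := ⟨⟨Abelian.epiDesc (cokernel.π K.arrow ≫ f) _ hz, by
      rw [← cancel_epi (cokernel.π K.arrow), ← Category.assoc, Abelian.comp_epiDesc]
      simp⟩⟩
    exact isIso_of_epi_of_isSplitMono f

/-- An Artinian object has finitely many simple quotients up to isomorphism. -/
theorem exists_list_simple_quotients (Q : A) [IsArtinianObject Q] :
    ∃ L : List A, ∀ (S : A) (p : Q ⟶ S), Simple S → Epi p → ∃ T ∈ L, Nonempty (S ≅ T) := by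
  suffices H : ∀ U : Subobject Q, ∃ L : List A, ∀ (S : A) (p : (U : A) ⟶ S), Simple S → Epi p →
      ∃ T ∈ L, Nonempty (S ≅ T) by
    obtain ⟨L, hL⟩ := H ⊤
    exact ⟨L, fun S p _ _ => hL S ((⊤ : Subobject Q).arrow ≫ p) inferInstance inferInstance⟩
  intro U
  induction U using (wellFounded_lt (α := Subobject Q)).induction with
  | _ U ih =>
  by_cases hU : ∃ (S : A) (p : (U : A) ⟶ S), Simple S ∧ Epi p
  · obtain ⟨S, p, hS, hp⟩ := hU
    -- Induct on the kernel `V` of one simple quotient `S`: a simple quotient of `U` either kills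
    -- `V`, and is then isomorphic to `S`, or restricts to a simple quotient of `V`.
    let V : Subobject Q := Subobject.mk (kernel.ι p ≫ U.arrow)
    have hle : V ≤ U := Subobject.mk_le_of_comm (kernel.ι p) rfl
    have hlt : V < U := by
      refine lt_of_le_not_ge hle fun h => ?_
      have h1 : Subobject.ofLE U V h ≫ (Subobject.underlyingIso _).hom ≫ kernel.ι p = 𝟙 _ := by
        rw [← cancel_mono U.arrow]
        simp only [Category.assoc, Subobject.underlyingIso_hom_comp_eq_mk, Category.id_comp]
        exact Subobject.ofLE_arrow h
      have h2 : p = 0 := by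
        rw [← Category.id_comp p, ← h1]; simp
      rw [h2] at hp
      exact (Simple.not_isZero S) (IsZero.of_epi_zero (U : A) S)
    obtain ⟨L, hL⟩ := ih V hlt
    refine ⟨S :: L, fun T q hT hq => ?_⟩
    by_cases h0 : kernel.ι p ≫ q = 0
    · refine ⟨S, by simp, ⟨?_⟩⟩
      have hne : Abelian.epiDesc p q h0 ≠ 0 := by
        intro h
        have := Abelian.comp_epiDesc p q h0
        rw [h, comp_zero] at this
        rw [← this] at hq
        exact (Simple.not_isZero T) (IsZero.of_epi_zero (U : A) T)
      have : IsIso (Abelian.epiDesc p q h0) := isIso_of_hom_simple hne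
      exact (asIso (Abelian.epiDesc p q h0)).symm
    · have := epi_of_nonzero_to_simple h0
      obtain ⟨T', hT', e⟩ := hL T ((Subobject.underlyingIso (kernel.ι p ≫ U.arrow)).hom ≫
        kernel.ι p ≫ q) hT inferInstance
      exact ⟨T', by simp [hT'], e⟩
  · exact ⟨[], fun S p hS hp => (hU ⟨S, p, hS, hp⟩).elim⟩

/-- A simple object receives a nonzero, hence epic, morphism from the separator, and an Artinian
object has few simple quotients. -/
theorem hasFinitelyManySimples_of_isSeparator {Q : A} [IsArtinianObject Q] (hQ : IsSeparator Q) :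
    HasFinitelyManySimples A := by
  obtain ⟨L, hL⟩ := exists_list_simple_quotients Q
  refine ⟨L.length, L.get, fun S hS => ?_⟩
  obtain ⟨p, hp⟩ : ∃ p : Q ⟶ S, p ≠ 0 := by
    by_contra! h
    exact id_nonzero S ((Preadditive.isSeparator_iff Q).1 hQ _ fun p => by simpa using h p)
  obtain ⟨T, hT, ⟨e⟩⟩ := hL S p hS (epi_of_nonzero_to_simple hp)
  obtain ⟨i, rfl⟩ := List.get_of_mem hT
  exact ⟨i, ⟨e⟩⟩

/-- The cover is a minimal subobject `K` of `Q` still mapping onto `X`; minimality makes the map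
essential, and finite dimensionality of `End K` makes `K` a retract of `Q`. -/
theorem exists_isProjectiveCover (k : Type w) [Field k] [Linear k A]
    [∀ X Y : A, Module.Finite k (X ⟶ Y)] {Q X : A} [IsArtinianObject Q] [Projective Q]
    (p : Q ⟶ X) [Epi p] : ∃ (P : A) (q : P ⟶ X), IsProjectiveCover q := by
  obtain ⟨K, hK, hmin⟩ := (wellFounded_lt (α := Subobject Q)).has_min
    {K : Subobject Q | Epi (K.arrow ≫ p)} ⟨⊤, by dsimp; infer_instance⟩
  have hK' : Epi (K.arrow ≫ p) := hK
  have ess : ∀ {R : A} (g : R ⟶ (K : A)), Epi (g ≫ K.arrow ≫ p) → Epi g := by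
    intro R g hg
    let V : Subobject Q := Subobject.mk (image.ι g ≫ K.arrow)
    have hle : V ≤ K := Subobject.mk_le_of_comm (image.ι g) rfl
    have hV : Epi (V.arrow ≫ p) := by
      have : factorThruImage g ≫ (Subobject.underlyingIso (image.ι g ≫ K.arrow)).inv ≫
          V.arrow ≫ p = g ≫ K.arrow ≫ p := by
        simp [V]
      rw [← this, ← Category.assoc] at hg
      exact @epi_of_epi _ _ _ _ _ _ (V.arrow ≫ p) hg
    have h : K ≤ V := by
      by_contra hc
      exact hmin V hV (lt_of_le_not_ge hle hc)
    have h1 : Subobject.ofLE K V h ≫ (Subobject.underlyingIso _).hom ≫ image.ι g = 𝟙 _ := by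
      rw [← cancel_mono K.arrow]
      simp only [Category.assoc, Subobject.underlyingIso_hom_comp_eq_mk, Category.id_comp]
      exact Subobject.ofLE_arrow h
    rw [← Category.assoc] at h1
    have : IsSplitEpi (image.ι g) := ⟨⟨_, h1⟩⟩
    rw [← image.fac g]
    infer_instance
  let f : Q ⟶ (K : A) := Projective.factorThru p (K.arrow ≫ p)
  have hf : f ≫ K.arrow ≫ p = p := Projective.factorThru_comp _ _
  have he : Epi (K.arrow ≫ f) := ess _ (by rwa [Category.assoc, hf])
  -- Precomposition with the epimorphism `K ⟶ Q ⟶ K` is injective on a finite dimensional space,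
  -- hence surjective; a preimage of the identity gives the retraction.
  let φ : ((K : A) ⟶ (K : A)) →ₗ[k] ((K : A) ⟶ (K : A)) := Linear.leftComp k _ (K.arrow ≫ f)
  have hφ : Function.Injective φ := fun a b h => (cancel_epi (K.arrow ≫ f)).1 h
  obtain ⟨s, hs⟩ := LinearMap.surjective_of_injective hφ (𝟙 _)
  have hs' : K.arrow ≫ f ≫ s = 𝟙 _ := by rw [← Category.assoc]; exact hs
  have hP : Projective (K : A) := Retract.projective ⟨K.arrow, f ≫ s, hs'⟩
  exact ⟨K, K.arrow ≫ p, hP, hK', ess⟩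

theorem projective_biproduct [HasFiniteBiproducts A] {n : ℕ} (P : Fin n → A)
    [∀ i, Projective (P i)] : Projective (⨁ P) where
  factors f e _ := ⟨biproduct.desc fun i => Projective.factorThru (biproduct.ι P i ≫ f) e, by
    ext i; simp⟩

theorem injective_biproduct [HasFiniteBiproducts A] {n : ℕ} (J : Fin n → A)
    [∀ i, Injective (J i)] : Injective (⨁ J) where
  factors f e _ := ⟨biproduct.lift fun i => Injective.factorThru (f ≫ biproduct.π J i) e, by
    ext i; simp⟩

/-- The sum of projectives covering the simples detects a nonzero `f`: the image of `f` has a simple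
quotient, and the projective over that quotient lifts to the source of `f`. -/
theorem exists_projective_separator (h : HasFinitelyManySimples A)
    (hN : ∀ X : A, IsNoetherianObject X)
    (hP : ∀ S : A, Simple S → ∃ (P : A) (p : P ⟶ S), Projective P ∧ Epi p) :
    ∃ Q : A, Projective Q ∧ IsSeparator Q := by
  have := Abelian.hasFiniteBiproducts (C := A)
  obtain ⟨n, S, hS⟩ := h
  have H : ∀ i, ∃ P : A, Projective P ∧ (Simple (S i) → ∃ p : P ⟶ S i, Epi p) := by
    intro i
    by_cases hi : Simple (S i)
    · obtain ⟨P, p, hP, hp⟩ := hP _ hi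
      exact ⟨P, hP, fun _ => ⟨p, hp⟩⟩
    -- The list of representatives may contain objects that are not simple; these contribute the
    -- zero object.
    · exact ⟨0, inferInstance, fun h => (hi h).elim⟩
  choose P hP hp using H
  refine ⟨⨁ P, projective_biproduct P, (Preadditive.isSeparator_iff _).2 fun X Y f hf => ?_⟩
  by_contra hne
  have hI : ¬ IsZero (image f) := fun h => hne (by
    rw [← image.fac f, h.eq_of_tgt (factorThruImage f) 0, zero_comp])
  have := hN (image f)
  obtain ⟨T, p, hT, hp'⟩ := exists_simple_quotient hI
  obtain ⟨i, ⟨e⟩⟩ := hS T hT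
  obtain ⟨q, hq⟩ := hp i (Simple.of_iso e.symm)
  have hPi := hP i
  let g : P i ⟶ X := Projective.factorThru (q ≫ e.inv) (factorThruImage f ≫ p)
  have hg : g ≫ factorThruImage f ≫ p = q ≫ e.inv := Projective.factorThru_comp _ _
  have h0 : g ≫ f = 0 := by
    have := hf (biproduct.π P i ≫ g)
    rw [← cancel_epi (biproduct.π P i), comp_zero, ← Category.assoc, this]
  have h1 : g ≫ factorThruImage f = 0 := by
    rw [← cancel_mono (image.ι f), Category.assoc, image.fac, h0, zero_comp]
  have h2 : q ≫ e.inv = 0 := by rw [← hg, ← Category.assoc, h1, zero_comp]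
  have h3 : Epi (q ≫ e.inv) := inferInstance
  rw [h2] at h3
  exact Simple.not_isZero T (IsZero.of_epi_zero (P i) T)

/-- Dual to the projective case, with a simple subobject of the image in place of a simple quotient.
-/
theorem exists_injective_coseparator (h : HasFinitelyManySimples A)
    (hA : ∀ X : A, IsArtinianObject X)
    (hJ : ∀ S : A, Simple S → ∃ (J : A) (j : S ⟶ J), Injective J ∧ Mono j) :
    ∃ W : A, Injective W ∧ IsCoseparator W := by
  have := Abelian.hasFiniteBiproducts (C := A)
  obtain ⟨n, S, hS⟩ := h
  have H : ∀ i, ∃ J : A, Injective J ∧ (Simple (S i) → ∃ j : S i ⟶ J, Mono j) := by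
    intro i
    by_cases hi : Simple (S i)
    · obtain ⟨J, j, hJ, hj⟩ := hJ _ hi
      exact ⟨J, hJ, fun _ => ⟨j, hj⟩⟩
    · exact ⟨0, inferInstance, fun h => (hi h).elim⟩
  choose J hJ hj using H
  refine ⟨⨁ J, injective_biproduct J, (Preadditive.isCoseparator_iff _).2 fun X Y f hf => ?_⟩
  by_contra hne
  have hI : ¬ IsZero (image f) := fun h => hne (by
    rw [← image.fac f, h.eq_of_tgt (factorThruImage f) 0, zero_comp])
  have := hA (image f)
  obtain ⟨i, ⟨e⟩⟩ := hS (simpleSubobject hI) inferInstance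
  obtain ⟨q, hq⟩ := hj i (Simple.of_iso e.symm)
  have hJi := hJ i
  let g : Y ⟶ J i := Injective.factorThru (e.hom ≫ q) (simpleSubobjectArrow hI ≫ image.ι f)
  have hg : (simpleSubobjectArrow hI ≫ image.ι f) ≫ g = e.hom ≫ q :=
    Injective.comp_factorThru _ _
  have h0 : f ≫ g = 0 := by
    have := hf (g ≫ biproduct.ι J i)
    rw [← cancel_mono (biproduct.ι J i), zero_comp, Category.assoc, this]
  have h1 : image.ι f ≫ g = 0 := by
    rw [← cancel_epi (factorThruImage f), ← Category.assoc, image.fac, h0, comp_zero]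
  have h2 : e.hom ≫ q = 0 := by rw [← hg, Category.assoc, h1, comp_zero]
  have h3 : Mono (e.hom ≫ q) := inferInstance
  rw [h2] at h3
  exact Simple.not_isZero (simpleSubobject hI) (IsZero.of_mono_zero _ (J i))

end Abelian

/-! ### Adjoints of linear functors by a dimension count. -/

section Linear

variable (k : Type w) [Field k] {A : Type u₁} [Category.{v₁} A] [Abelian A] [Linear k A]
  [∀ X Y : A, Module.Finite k (X ⟶ Y)]

/-- A finite family of morphisms out of `Q` spanning a given subspace, as one morphism out of a
finite power of `Q`. -/
theorem exists_biproduct_desc [HasFiniteBiproducts A] {Q X : A} (W : Submodule k (Q ⟶ X)) :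
    ∃ (n : ℕ) (f : Fin n → (Q ⟶ X)), (∀ i, f i ∈ W) ∧
      ∀ g ∈ W, ∃ h : Q ⟶ ⨁ (fun _ : Fin n => Q), h ≫ biproduct.desc f = g := by
  obtain ⟨n, f, hf⟩ := Submodule.fg_iff_exists_fin_generating_family.1
    (IsNoetherian.noetherian W)
  refine ⟨n, f, fun i => hf ▸ Submodule.subset_span ⟨i, rfl⟩, fun g hg => ?_⟩
  rw [← hf, Submodule.mem_span_range_iff_exists_fun] at hg
  obtain ⟨c, rfl⟩ := hg
  exact ⟨biproduct.lift fun i => c i • 𝟙 Q, by simp [biproduct.lift_desc]⟩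

variable {B : Type u₂} [Category.{v₂} B] [Preadditive B] [Linear k B]
  [∀ X Y : B, Module.Finite k (X ⟶ Y)]

/-- `x : F X ⟶ n` is not annihilated by any nonzero morphism to `X`. -/
def IsFaithfulPair (F : A ⥤ B) {X : A} {n : B} (x : F.obj X ⟶ n) : Prop :=
  ∀ ⦃Y : A⦄ (g : Y ⟶ X), F.map g ≫ x = 0 → g = 0

/-- Divide `X` by all morphisms `Q ⟶ X` that `x` kills. Finitely many span them, right exactness
lets `x` descend to the cokernel, and projectivity of `Q` shows that nothing further is killed. -/
theorem exists_isFaithfulPair (F : A ⥤ B) [F.Additive] [F.Linear k] [PreservesFiniteColimits F]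
    {Q : A} [Projective Q] (hQ : IsSeparator Q) {X : A} {n : B} (x : F.obj X ⟶ n) :
    ∃ (Z : A) (q : X ⟶ Z) (z : F.obj Z ⟶ n), F.map q ≫ z = x ∧ IsFaithfulPair F z := by
  have := Abelian.hasFiniteBiproducts (C := A)
  let φ : (Q ⟶ X) →ₗ[k] (F.obj Q ⟶ n) :=
    { toFun := fun f => F.map f ≫ x
      map_add' := by simp
      map_smul' := by simp [Functor.map_smul] }
  obtain ⟨r, f, hf, hf'⟩ := exists_biproduct_desc k (LinearMap.ker φ)
  have hd : F.map (biproduct.desc f) ≫ x = 0 := by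
    rw [← Category.id_comp (biproduct.desc f), ← biproduct.total]
    simp only [Preadditive.sum_comp, Category.assoc, biproduct.ι_desc, Functor.map_sum,
      Functor.map_comp]
    refine Finset.sum_eq_zero fun i _ => ?_
    rw [show F.map (f i) ≫ x = 0 from hf i, comp_zero]
  have hc := CokernelCofork.mapIsColimit _ (cokernelIsCokernel (biproduct.desc f)) F
  obtain ⟨z, hz'⟩ : ∃ z : F.obj (cokernel (biproduct.desc f)) ⟶ n,
      F.map (cokernel.π (biproduct.desc f)) ≫ z = x :=
    ⟨_, (CokernelCofork.IsColimit.desc' hc x hd).2⟩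
  refine ⟨_, cokernel.π (biproduct.desc f), z, hz', fun Y g hg => ?_⟩
  refine (Preadditive.isSeparator_iff Q).1 hQ _ fun h => ?_
  let l : Q ⟶ X := Projective.factorThru (h ≫ g) (cokernel.π (biproduct.desc f))
  have hl : l ≫ cokernel.π (biproduct.desc f) = h ≫ g := Projective.factorThru_comp _ _
  have hl' : F.map l ≫ x = 0 := by
    rw [← hz', ← Category.assoc, ← F.map_comp, hl, F.map_comp, Category.assoc, hg, comp_zero]
  obtain ⟨l', hl'⟩ := hf' l hl'
  rw [← hl, ← hl', Category.assoc, cokernel.condition, comp_zero]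

/-- A right exact linear functor out of an abelian category with finite dimensional morphism
spaces and a projective separator has a right adjoint. -/
theorem isLeftAdjoint_of_isSeparator (F : A ⥤ B) [F.Additive] [F.Linear k]
    [PreservesFiniteColimits F] {Q : A} [Projective Q] (hQ : IsSeparator Q) :
    F.IsLeftAdjoint := by
  suffices ∀ n : B, HasTerminal (CostructuredArrow F n) from
    isLeftAdjoint_of_costructuredArrowTerminals F
  intro n
  -- The terminal object is a faithful pair with `Hom(Q, X)` of maximal dimension; a bound exists
  -- because `Hom(Q, X)` embeds into `Hom(F Q, n)`.
  let S : Set ℕ := {d | ∃ (X : A) (x : F.obj X ⟶ n), IsFaithfulPair F x ∧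
    Module.finrank k (Q ⟶ X) = d}
  have hS : S.Nonempty := by
    obtain ⟨Z, -, z, -, hz⟩ := exists_isFaithfulPair k F hQ (0 : F.obj 0 ⟶ n)
    exact ⟨_, Z, z, hz, rfl⟩
  have hb : BddAbove S := by
    refine ⟨Module.finrank k (F.obj Q ⟶ n), ?_⟩
    rintro _ ⟨X, x, hx, rfl⟩
    let φ : (Q ⟶ X) →ₗ[k] (F.obj Q ⟶ n) :=
      { toFun := fun f => F.map f ≫ x
        map_add' := by simp
        map_smul' := by simp [Functor.map_smul] }
    refine LinearMap.finrank_le_finrank_of_injective (f := φ) ?_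
    rw [← LinearMap.ker_eq_bot, LinearMap.ker_eq_bot']
    exact fun f hf => hx f hf
  obtain ⟨X, x, hx, hX⟩ := Nat.sSup_mem hS hb
  have key : ∀ (Y : A) (y : F.obj Y ⟶ n), ∃ f : Y ⟶ X, F.map f ≫ x = y := by
    intro Y y
    -- `Z` is a faithful quotient of `X ⊞ Y`. Faithfulness of `x` makes `X ⟶ Z` mono, maximality
    -- makes it an isomorphism, and `Y ⟶ Z ≅ X` is the required morphism.
    obtain ⟨Z, q, z, hq, hz⟩ := exists_isFaithfulPair k F hQ
      (F.map (biprod.fst : X ⊞ Y ⟶ X) ≫ x + F.map (biprod.snd : X ⊞ Y ⟶ Y) ≫ y)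
    have h1 : F.map (biprod.inl ≫ q) ≫ z = x := by
      rw [F.map_comp, Category.assoc, hq, Preadditive.comp_add, ← F.map_comp_assoc,
        ← F.map_comp_assoc]
      simp
    have h2 : F.map (biprod.inr ≫ q) ≫ z = y := by
      rw [F.map_comp, Category.assoc, hq, Preadditive.comp_add, ← F.map_comp_assoc,
        ← F.map_comp_assoc]
      simp
    have hm : Mono (biprod.inl ≫ q) := Preadditive.mono_of_cancel_zero _ fun {Y} g hg =>
      hx g (by rw [← h1, ← F.map_comp_assoc, hg, F.map_zero, zero_comp])
    let φ : (Q ⟶ X) →ₗ[k] (Q ⟶ Z) := Linear.rightComp k Q (biprod.inl ≫ q)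
    have hφ : Function.Injective φ := fun a b h => (cancel_mono (biprod.inl ≫ q)).1 h
    have hle : Module.finrank k (Q ⟶ Z) ≤ Module.finrank k (Q ⟶ X) := by
      rw [hX]; exact le_csSup hb ⟨Z, z, hz, rfl⟩
    have hs : Function.Surjective φ := (LinearMap.injective_iff_surjective_of_finrank_eq_finrank
      (le_antisymm (LinearMap.finrank_le_finrank_of_injective hφ) hle)).1 hφ
    have he : Epi (biprod.inl ≫ q) := Preadditive.epi_of_cancel_zero _ fun {Y} g hg => by
      refine (Preadditive.isSeparator_iff Q).1 hQ _ fun h => ?_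
      obtain ⟨h', rfl⟩ := hs h
      change (h' ≫ biprod.inl ≫ q) ≫ g = 0
      rw [Category.assoc, hg, comp_zero]
    have : IsIso (biprod.inl ≫ q) := isIso_of_mono_of_epi _
    refine ⟨(biprod.inr ≫ q) ≫ inv (biprod.inl ≫ q), ?_⟩
    rw [← h2, F.map_comp (biprod.inr ≫ q), Category.assoc]
    congr 1
    rw [← h1, ← F.map_comp_assoc, IsIso.inv_hom_id, F.map_id, Category.id_comp]
  choose f hf using key
  refine IsTerminal.hasTerminal (X := CostructuredArrow.mk x)
    (IsTerminal.ofUniqueHom (fun Y => CostructuredArrow.homMk (f Y.left Y.hom) (hf _ _)) ?_)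
  intro Y m
  ext
  -- Two morphisms to `X` over `n` differ by one that `x` kills.
  refine sub_eq_zero.1 (hx _ ?_)
  rw [F.map_sub, Preadditive.sub_comp]
  have h1 := CostructuredArrow.w m
  have h2 := hf Y.left Y.hom
  dsimp at h1 h2 ⊢
  rw [h1]
  exact sub_eq_zero.2 h2.symm

/-- A finite spanning family of `Hom(Q, X)` assembles to one morphism through which every `Q ⟶ X`
factors, so a morphism annihilated by it is zero. -/
theorem exists_epi_of_isSeparator (k : Type w) [Field k] {A : Type u₁} [Category.{v₁} A]
    [Abelian A] [Linear k A] [∀ X Y : A, Module.Finite k (X ⟶ Y)] [HasFiniteBiproducts A] {Q : A} (hQ : IsSeparator Q) (X : A) :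
    ∃ (n : ℕ) (f : ⨁ (fun _ : Fin n => Q) ⟶ X), Epi f := by
  obtain ⟨n, f, -, hf⟩ := exists_biproduct_desc k (⊤ : Submodule k (Q ⟶ X))
  refine ⟨n, biproduct.desc f, Preadditive.epi_of_cancel_zero _ fun {Y} g hg => ?_⟩
  refine (Preadditive.isSeparator_iff Q).1 hQ _ fun h => ?_
  obtain ⟨h', rfl⟩ := hf h trivial
  rw [Category.assoc, hg, comp_zero]

end Linear

/-! ### Left adjoints, by passing to opposite categories. -/

section Opposite

variable (k : Type w) [Field k] (A : Type u₁) [Category.{v₁} A] [Preadditive A] [Linear k A]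

/-- The linear structure on the opposite of a linear category. -/
abbrev linearOpposite : Linear k Aᵒᵖ where
  homModule X Y := (opEquiv X Y).module k
  smul_comp _ _ _ _ _ _ := Quiver.Hom.unop_inj (Linear.comp_smul _ _ _ _ _ _)
  comp_smul _ _ _ _ _ _ := Quiver.Hom.unop_inj (Linear.smul_comp _ _ _ _ _ _)

/-- A left exact linear functor out of an abelian category with finite dimensional morphism
spaces and an injective coseparator has a left adjoint. -/
theorem isRightAdjoint_of_isCoseparator (k : Type w) [Field k] {A : Type u₁} [Category.{v₁} A]
    [Abelian A] [Linear k A] [∀ X Y : A, Module.Finite k (X ⟶ Y)] {B : Type u₂} [Category.{v₂} B]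
    [Preadditive B] [Linear k B] [∀ X Y : B, Module.Finite k (X ⟶ Y)] (F : A ⥤ B) [F.Additive]
    [F.Linear k] [PreservesFiniteLimits F] {W : A} [Injective W] (hW : IsCoseparator W) :
    F.IsRightAdjoint := by
  let := linearOpposite k A
  let := linearOpposite k B
  have hA : ∀ X Y : Aᵒᵖ, Module.Finite k (X ⟶ Y) := fun X Y =>
    Module.Finite.equiv (Equiv.linearEquiv k (opEquiv X Y)).symm
  have hB : ∀ X Y : Bᵒᵖ, Module.Finite k (X ⟶ Y) := fun X Y =>
    Module.Finite.equiv (Equiv.linearEquiv k (opEquiv X Y)).symm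
  have : F.op.Linear k := ⟨fun f r => Quiver.Hom.unop_inj (F.map_smul r f.unop)⟩
  have : PreservesFiniteColimits F.op := preservesFiniteColimits_op F
  have := isLeftAdjoint_of_isSeparator k F.op ((isSeparator_op_iff W).2 hW)
  exact ⟨_, ⟨(Adjunction.ofIsLeftAdjoint F.op).unop⟩⟩

end Opposite

/-! ### Exact actions of rigid categories -/

/-- An exact action of a rigid category with a projective object covering the unit, such that
projectives act through projectives. -/
class IsExactAction (C : Type u₁) [Category.{v₁} C] [Preadditive C] [MonoidalCategory C]
    (M : Type u₂) [Category.{v₂} M] [Abelian M] [MonoidalLeftAction C M]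
    [PreadditiveAction C M] : Prop where
  exact_left : ∀ c : C, IsExactFunctor (actionLeft M c)
  exact_right : ∀ m : M, IsExactFunctor (actionRight C m)
  projective_action : ∀ (P : C) (X : M), Projective P → Projective (P ⊙ₗ X)
  exists_left_dual : ∀ X : C, ∃ Y : C, Nonempty (ExactPairing Y X)
  exists_right_dual : ∀ X : C, ∃ Y : C, Nonempty (ExactPairing X Y)
  exists_cover_unit : ∃ (P : C) (p : P ⟶ 𝟙_ C), Projective P ∧ Epi p

section Exactness

variable {C : Type u₁} [Category.{v₁} C] [Preadditive C] [MonoidalCategory C]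
    {M : Type u₂} [Category.{v₂} M] [Abelian M] [MonoidalLeftAction C M]
    [PreadditiveAction C M]

instance (c : C) : (actionLeft M c).Additive := ⟨PreadditiveAction.actionHomRight_add c _ _⟩

instance (m : M) : (actionRight C m).Additive := ⟨PreadditiveAction.add_actionHomLeft _ _ m⟩

variable [IsExactAction C M]

instance (c : C) : PreservesFiniteLimits (actionLeft M c) := (IsExactAction.exact_left c).1

instance (c : C) : PreservesFiniteColimits (actionLeft M c) := (IsExactAction.exact_left c).2

instance (m : M) : PreservesFiniteLimits (actionRight C m) := (IsExactAction.exact_right m).1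

instance (m : M) : PreservesFiniteColimits (actionRight C m) := (IsExactAction.exact_right m).2

instance {c c' : C} (f : c ⟶ c') (m : M) [Mono f] : Mono (f ⊵ₗ m) :=
  inferInstanceAs (Mono ((actionRight C m).map f))

instance {c c' : C} (f : c ⟶ c') (m : M) [Epi f] : Epi (f ⊵ₗ m) :=
  inferInstanceAs (Epi ((actionRight C m).map f))

/-- The epimorphism `P ⊙ₗ m ⟶ 𝟙_ C ⊙ₗ m` is natural in `m`, so a morphism can be recovered from its
image under `P ⊙ₗ -`. -/
theorem faithful_actionLeft {P : C} (p : P ⟶ 𝟙_ C) [Epi p] : (actionLeft M P).Faithful where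
  map_injective {m n f g} h := by
    have h' : P ⊴ₗ f = P ⊴ₗ g := h
    have h1 : p ⊵ₗ m ≫ 𝟙_ C ⊴ₗ f = p ⊵ₗ m ≫ 𝟙_ C ⊴ₗ g := by
      rw [← MonoidalLeftAction.action_exchange, ← MonoidalLeftAction.action_exchange, h']
    rw [cancel_epi] at h1
    simpa using h1

/-- Acting by `P` makes the third term projective, so the sequence splits and `F` preserves it. As
`F` commutes with the faithful exact functor `P ⊙ₗ -`, exactness is then reflected back. -/
theorem shortExact_map_of_linear (F : M ⥤ M) [F.Additive] [F.LeftLinear C] (S : ShortComplex M)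
    (hS : S.ShortExact) : (S.map F).ShortExact := by
  obtain ⟨P, p, hP, hp⟩ := IsExactAction.exists_cover_unit (C := C) (M := M)
  have := faithful_actionLeft (M := M) p
  have hproj : Projective (S.map (actionLeft M P)).X₃ :=
    IsExactAction.projective_action P S.X₃ hP
  have h1 : (S.map (actionLeft M P)).ShortExact := hS.map_of_exact _
  have h2 : ((S.map (actionLeft M P)).map F).ShortExact :=
    ((h1.splittingOfProjective).map F).shortExact
  have e : (S.map (actionLeft M P)).map F ≅ (S.map F).map (actionLeft M P) :=
    ShortComplex.isoMk (μₗIso F P S.X₁).symm (μₗIso F P S.X₂).symm (μₗIso F P S.X₃).symm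
      (δₗ_naturality_right F P S.f).symm (δₗ_naturality_right F P S.g).symm
  have h3 : ((S.map F).map (actionLeft M P)).ShortExact := ShortComplex.shortExact_of_iso e h2
  exact
    { exact := ((S.map F).exact_map_iff_of_faithful (actionLeft M P)).1 h3.exact
      mono_f := (actionLeft M P).mono_of_mono_map h3.mono_f
      epi_g := (actionLeft M P).epi_of_epi_map h3.epi_g }

theorem isExactFunctor_of_linear (F : M ⥤ M) [F.Additive] [F.LeftLinear C] :
    IsExactFunctor F :=
  ((Functor.exact_tfae F).out 0 3).1 (shortExact_map_of_linear (C := C) F)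

instance (F : Dual C M) : PreservesFiniteLimits F.functor :=
  (isExactFunctor_of_linear (C := C) F.functor).1

instance (F : Dual C M) : PreservesFiniteColimits F.functor :=
  (isExactFunctor_of_linear (C := C) F.functor).2

end Exactness

/-! ### Invertible lax and oplax structures -/

section Invertible

variable {C : Type u} [Category.{v} C] [MonoidalCategory C]
    {M : Type u₁} [Category.{v₁} M] [MonoidalLeftAction C M]
    {N : Type u₂} [Category.{v₂} N] [MonoidalLeftAction C N]

/-- An invertible lax structure is a module structure. -/
abbrev leftLinearOfLax (F : M ⥤ N) [F.LaxLeftLinear C]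
    (δ : ∀ (c : C) (m : M), F.obj (c ⊙ₗ m) ⟶ c ⊙ₗ F.obj m)
    (h₁ : ∀ c m, μₗ F c m ≫ δ c m = 𝟙 _) (h₂ : ∀ c m, δ c m ≫ μₗ F c m = 𝟙 _) :
    F.LeftLinear C :=
  have (c : C) (m : M) : IsIso (μₗ F c m) := ⟨δ _ _, h₁ _ _, h₂ _ _⟩
  { (inferInstance : F.LaxLeftLinear C) with
    δₗ := δ
    μₗ_comp_δₗ := h₁
    δₗ_comp_μₗ := h₂
    δₗ_naturality_left := fun {c c'} f m => by
      rw [← cancel_epi (μₗ F c m), reassoc_of% h₁, ← μₗ_naturality_left_assoc, h₁,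
        Category.comp_id]
    δₗ_naturality_right := fun c {m m'} f => by
      rw [← cancel_epi (μₗ F c m), reassoc_of% h₁, ← μₗ_naturality_right_assoc, h₁,
        Category.comp_id]
    δₗ_associativity := fun c c' m => by
      rw [← cancel_epi (μₗ F (c ⊗ c') m), reassoc_of% h₁, μₗ_associativity_assoc,
        reassoc_of% h₁, ← MonoidalLeftAction.actionHomRight_comp, h₁]
      simp
    δₗ_unitality_inv := fun m => by
      rw [← μₗ_unitality_inv_assoc, h₁, Category.comp_id] }

/-- An invertible oplax structure is a module structure. -/
abbrev leftLinearOfOplax (F : M ⥤ N) [F.OplaxLeftLinear C]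
    (μ : ∀ (c : C) (m : M), c ⊙ₗ F.obj m ⟶ F.obj (c ⊙ₗ m))
    (h₁ : ∀ c m, μ c m ≫ δₗ F c m = 𝟙 _) (h₂ : ∀ c m, δₗ F c m ≫ μ c m = 𝟙 _) :
    F.LeftLinear C :=
  have (c : C) (m : M) : IsIso (δₗ F c m) := ⟨μ _ _, h₂ _ _, h₁ _ _⟩
  { (inferInstance : F.OplaxLeftLinear C) with
    μₗ := μ
    μₗ_comp_δₗ := h₁
    δₗ_comp_μₗ := h₂
    μₗ_naturality_left := fun {c c'} f m => by
      rw [← cancel_mono (δₗ F c' m), Category.assoc, h₁, Category.assoc, δₗ_naturality_left,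
        reassoc_of% h₁, Category.comp_id]
    μₗ_naturality_right := fun c {m m'} f => by
      rw [← cancel_mono (δₗ F c m'), Category.assoc, h₁, Category.assoc, δₗ_naturality_right,
        reassoc_of% h₁, Category.comp_id]
    μₗ_associativity := fun c c' m => by
      rw [← cancel_mono (δₗ F c (c' ⊙ₗ m)), ← cancel_mono (c ⊴ₗ δₗ F c' m)]
      simp only [Category.assoc]
      rw [← δₗ_associativity, reassoc_of% h₁, reassoc_of% h₁,
        ← MonoidalLeftAction.actionHomRight_comp, h₁]
      simp
    μₗ_unitality := fun m => by
      rw [← δₗ_unitality_hom, reassoc_of% h₁] }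

end Invertible

/-! ### Limits and colimits of module functors -/

namespace Dual

/-! ### Module structures induced by jointly monic or jointly epic families. -/

section Joint

variable {C : Type u₁} [Category.{v₁} C] [MonoidalCategory C]
    {M : Type u₂} [Category.{v₂} M] [Preadditive M] [MonoidalLeftAction C M]

/-- A module structure on a functor that embeds into a product of module functors. -/
abbrev linearOfJointlyMono {J : Type w} (G : J → Dual C M) (K : M ⥤ M)
    (π : ∀ j, K ⟶ (G j).functor)
    (h : ∀ (n : M) {t : M} (f g : t ⟶ K.obj n),
      (∀ j, f ≫ (π j).app n = g ≫ (π j).app n) → f = g)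
    (h' : ∀ (c : C) (n : M) {t : M} (f g : t ⟶ c ⊙ₗ K.obj n),
      (∀ j, f ≫ c ⊴ₗ (π j).app n = g ≫ c ⊴ₗ (π j).app n) → f = g)
    (μ : ∀ (c : C) (n : M), c ⊙ₗ K.obj n ⟶ K.obj (c ⊙ₗ n))
    (hμ : ∀ j c n, μ c n ≫ (π j).app _ = c ⊴ₗ (π j).app n ≫ μₗ (G j).functor c n)
    (δ : ∀ (c : C) (n : M), K.obj (c ⊙ₗ n) ⟶ c ⊙ₗ K.obj n)
    (hδ : ∀ j c n, δ c n ≫ c ⊴ₗ (π j).app n = (π j).app _ ≫ δₗ (G j).functor c n) :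
    K.LeftLinear C :=
  letI : K.LaxLeftLinear C :=
    { μₗ := μ
      μₗ_naturality_left := fun {c c'} f m => h _ _ _ fun j => by
        rw [Category.assoc, hμ, Category.assoc, (π j).naturality, ← Category.assoc,
          ← Category.assoc, hμ, ← MonoidalLeftAction.action_exchange, Category.assoc,
          Category.assoc, μₗ_naturality_left]
      μₗ_naturality_right := fun c {m m'} f => h _ _ _ fun j => by
        rw [Category.assoc, hμ, Category.assoc, (π j).naturality, ← Category.assoc,
          ← Category.assoc, hμ, ← MonoidalLeftAction.actionHomRight_comp, (π j).naturality,
          MonoidalLeftAction.actionHomRight_comp, Category.assoc, Category.assoc,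
          μₗ_naturality_right]
      μₗ_associativity := fun c c' m => h _ _ _ fun j => by
        rw [Category.assoc, (π j).naturality, ← Category.assoc, hμ]
        simp only [Category.assoc, hμ, μₗ_associativity]
        rw [← MonoidalLeftAction.actionHomRight_comp_assoc, hμ]
        simp
      μₗ_unitality := fun m => h _ _ _ fun j => by
        rw [Category.assoc, (π j).naturality, ← Category.assoc, hμ, Category.assoc,
          ← μₗ_unitality]
        simp }
  leftLinearOfLax K δ
    (fun c n => h' _ _ _ _ fun j => by
      rw [Category.assoc, hδ, ← Category.assoc, show μₗ K c n ≫ _ = _ from hμ j c n]; simp)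
    (fun c n => h _ _ _ fun j => by
      rw [Category.assoc, show μₗ K c n ≫ _ = _ from hμ j c n, ← Category.assoc, hδ]; simp)

/-- A module structure on a functor that is a quotient of a coproduct of module functors. -/
abbrev linearOfJointlyEpi {J : Type w} (G : J → Dual C M) (K : M ⥤ M)
    (ι : ∀ j, (G j).functor ⟶ K)
    (h : ∀ (n : M) {t : M} (f g : K.obj n ⟶ t),
      (∀ j, (ι j).app n ≫ f = (ι j).app n ≫ g) → f = g)
    (h' : ∀ (c : C) (n : M) {t : M} (f g : c ⊙ₗ K.obj n ⟶ t),
      (∀ j, c ⊴ₗ (ι j).app n ≫ f = c ⊴ₗ (ι j).app n ≫ g) → f = g)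
    (μ : ∀ (c : C) (n : M), c ⊙ₗ K.obj n ⟶ K.obj (c ⊙ₗ n))
    (hμ : ∀ j c n, c ⊴ₗ (ι j).app n ≫ μ c n = μₗ (G j).functor c n ≫ (ι j).app _)
    (δ : ∀ (c : C) (n : M), K.obj (c ⊙ₗ n) ⟶ c ⊙ₗ K.obj n)
    (hδ : ∀ j c n, (ι j).app _ ≫ δ c n = δₗ (G j).functor c n ≫ c ⊴ₗ (ι j).app n) :
    K.LeftLinear C :=
  letI : K.OplaxLeftLinear C :=
    { δₗ := δ
      δₗ_naturality_left := fun {c c'} f m => h _ _ _ fun j => by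
        rw [← (ι j).naturality_assoc, hδ, δₗ_naturality_left_assoc,
          ← MonoidalLeftAction.action_exchange, ← Category.assoc, ← Category.assoc, hδ]
      δₗ_naturality_right := fun c {m m'} f => h _ _ _ fun j => by
        rw [← (ι j).naturality_assoc, hδ, δₗ_naturality_right_assoc,
          ← MonoidalLeftAction.actionHomRight_comp, (ι j).naturality, ← Category.assoc, hδ]
        simp
      δₗ_associativity := fun c c' m => h _ _ _ fun j => by
        rw [← (ι j).naturality_assoc, ← Category.assoc, hδ]
        simp only [Category.assoc, MonoidalLeftAction.tensor_actionHomRight,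
          Iso.inv_hom_id, Category.comp_id]
        rw [δₗ_associativity_assoc, ← Category.assoc ((ι j).app _) (δ _ _), hδ]
        simp only [Category.assoc]
        rw [← MonoidalLeftAction.actionHomRight_comp, ← MonoidalLeftAction.actionHomRight_comp,
          hδ]
      δₗ_unitality_inv := fun m => h _ _ _ fun j => by
        rw [← (ι j).naturality_assoc, hδ, ← Category.assoc, ← δₗ_unitality_inv]
        simp }
  leftLinearOfOplax K μ
    (fun c n => h' _ _ _ _ fun j => by
      rw [← Category.assoc, hμ, Category.assoc, show _ ≫ δₗ K c n = _ from hδ j c n]; simp)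
    (fun c n => h _ _ _ fun j => by
      rw [← Category.assoc, show _ ≫ δₗ K c n = _ from hδ j c n, Category.assoc, hμ]; simp)

end Joint

/-! ### Pointwise limits and colimits; the dual category is abelian. -/

section Limits

variable (C : Type u₁) [Category.{v₁} C] [Preadditive C] [MonoidalCategory C]
    (M : Type u₂) [Category.{v₂} M] [Abelian M] [MonoidalLeftAction C M]
    [PreadditiveAction C M]

/-- The functor forgetting module structures. -/
@[simps]
def forget : Dual C M ⥤ M ⥤ M where
  obj F := F.functor
  map α := α.nat

/-- Evaluation of module functors at an object. -/
@[simps!]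
def ev (m : M) : Dual C M ⥤ M := forget C M ⋙ (evaluation M M).obj m

instance (m : M) : (ev C M m).Additive where

variable {C M} [IsExactAction C M] {J : Type} [SmallCategory J] [FinCategory J]
  (D : J ⥤ Dual C M)

/-- The pointwise limit of a diagram of module functors. -/
noncomputable def limitFunctor : M ⥤ M := limit (D ⋙ forget C M)

/-- The projections of the pointwise limit. -/
noncomputable def limitπ (j : J) : limitFunctor D ⟶ (D.obj j).functor :=
  limit.π (D ⋙ forget C M) j

/-- Pointwise limits of module functors. -/
noncomputable def isLimitEval (n : M) :
    IsLimit (((evaluation M M).obj n).mapCone (limit.cone (D ⋙ forget C M))) :=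
  isLimitOfPreserves _ (limit.isLimit _)

/-- The action preserves pointwise limits of module functors. -/
noncomputable def isLimitActionEval (c : C) (n : M) :
    IsLimit ((actionLeft M c).mapCone
      (((evaluation M M).obj n).mapCone (limit.cone (D ⋙ forget C M)))) :=
  isLimitOfPreserves _ (isLimitEval D n)

theorem limit_hom_ext (n : M) {t : M} (f g : t ⟶ (limitFunctor D).obj n)
    (h : ∀ j, f ≫ (limitπ D j).app n = g ≫ (limitπ D j).app n) : f = g :=
  (isLimitEval D n).hom_ext h

theorem limit_action_hom_ext (c : C) (n : M) {t : M} (f g : t ⟶ c ⊙ₗ (limitFunctor D).obj n)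
    (h : ∀ j, f ≫ c ⊴ₗ (limitπ D j).app n = g ≫ c ⊴ₗ (limitπ D j).app n) : f = g :=
  (isLimitActionEval D c n).hom_ext h

theorem limitπ_comp_map {j j' : J} (f : j ⟶ j') (n : M) :
    (limitπ D j).app n ≫ (D.map f).nat.app n = (limitπ D j').app n :=
  congr_app (limit.w (D ⋙ forget C M) f) n

theorem exists_limit_μ (c : C) (n : M) :
    ∃ μ : c ⊙ₗ (limitFunctor D).obj n ⟶ (limitFunctor D).obj (c ⊙ₗ n),
      ∀ j, μ ≫ (limitπ D j).app _ = c ⊴ₗ (limitπ D j).app n ≫ μₗ (D.obj j).functor c n := by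
  have key {j j' : J} (f : j ⟶ j') : c ⊴ₗ (limitπ D j').app n ≫ μₗ (D.obj j').functor c n =
      (c ⊴ₗ (limitπ D j).app n ≫ μₗ (D.obj j).functor c n) ≫ (D.map f).nat.app _ := by
    rw [Category.assoc, (D.map f).comm, ← limitπ_comp_map D f]
    simp
  exact ⟨(isLimitEval D (c ⊙ₗ n)).lift ⟨_,
    { app := fun j => c ⊴ₗ (limitπ D j).app n ≫ μₗ (D.obj j).functor c n
      naturality := fun {j j'} f => (Category.id_comp _).trans (key f) }⟩,
    (isLimitEval D (c ⊙ₗ n)).fac _⟩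

/-- Left exactness of `c ⊙ₗ -` enters here: the target is itself a limit, which supplies the inverse
of the lax structure. -/
theorem exists_limit_δ (c : C) (n : M) :
    ∃ δ : (limitFunctor D).obj (c ⊙ₗ n) ⟶ c ⊙ₗ (limitFunctor D).obj n,
      ∀ j, δ ≫ c ⊴ₗ (limitπ D j).app n = (limitπ D j).app _ ≫ δₗ (D.obj j).functor c n := by
  have key {j j' : J} (f : j ⟶ j') : (limitπ D j').app _ ≫ δₗ (D.obj j').functor c n =
      ((limitπ D j).app _ ≫ δₗ (D.obj j).functor c n) ≫ c ⊴ₗ (D.map f).nat.app _ := by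
    rw [Category.assoc, ← comm_δ, ← limitπ_comp_map D f]
    simp
  exact ⟨(isLimitActionEval D c n).lift ⟨_,
    { app := fun j => (limitπ D j).app _ ≫ δₗ (D.obj j).functor c n
      naturality := fun {j j'} f => (Category.id_comp _).trans (key f) }⟩,
    (isLimitActionEval D c n).fac _⟩

noncomputable instance limitLinear : (limitFunctor D).LeftLinear C :=
  linearOfJointlyMono D.obj _ (limitπ D)
    (fun n _ f g => limit_hom_ext D n f g) (fun c n _ f g => limit_action_hom_ext D c n f g)
    (fun c n => (exists_limit_μ D c n).choose)
    (fun j c n => (exists_limit_μ D c n).choose_spec j)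
    (fun c n => (exists_limit_δ D c n).choose)
    (fun j c n => (exists_limit_δ D c n).choose_spec j)

theorem limitFunctor_μ (j : J) (c : C) (n : M) :
    μₗ (limitFunctor D) c n ≫ (limitπ D j).app _ =
      c ⊴ₗ (limitπ D j).app n ≫ μₗ (D.obj j).functor c n :=
  (exists_limit_μ D c n).choose_spec j

/-- The limit of a finite diagram of module functors. -/
noncomputable abbrev limitObj : Dual C M where
  functor := limitFunctor D
  additive := ⟨fun {m m' f g} => limit_hom_ext D _ _ _ fun j => by
    rw [(limitπ D j).naturality, Preadditive.add_comp, (limitπ D j).naturality,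
      (limitπ D j).naturality, Functor.map_add, Preadditive.comp_add]⟩
  linear := inferInstance

/-- The limit cone of a finite diagram of module functors. -/
noncomputable abbrev limitCone : Cone D where
  pt := limitObj D
  π :=
    { app := fun j => ⟨limitπ D j, fun c n => limitFunctor_μ D j c n⟩
      naturality := fun _ _ f => hom_ext fun n =>
        (Category.id_comp _).trans (limitπ_comp_map D f n).symm }

theorem exists_limit_lift (s : Cone D) : ∃ α : s.pt.functor ⟶ limitFunctor D,
    ∀ j n, α.app n ≫ (limitπ D j).app n = (s.π.app j).nat.app n :=
  ⟨limit.lift (D ⋙ forget C M) ((forget C M).mapCone s), fun j n =>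
    congr_app (limit.lift_π ((forget C M).mapCone s) j) n⟩

/-- The pointwise limit is a limit in the category of module functors. -/
noncomputable def limitConeIsLimit : IsLimit (limitCone D) where
  lift s := ⟨(exists_limit_lift D s).choose, fun c n => limit_hom_ext D _ _ _ fun j => by
      have h := (exists_limit_lift D s).choose_spec j
      have h2 : μₗ s.pt.functor c n ≫ (s.π.app j).nat.app (c ⊙ₗ n) =
        c ⊴ₗ (s.π.app j).nat.app n ≫ μₗ (D.obj j).functor c n := (s.π.app j).comm c n
      rw [Category.assoc, Category.assoc, h, h2, limitFunctor_μ,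
        ← MonoidalLeftAction.actionHomRight_comp_assoc, h]⟩
  fac s j := hom_ext fun n => (exists_limit_lift D s).choose_spec j n
  uniq s m hm := hom_ext fun n => limit_hom_ext D _ _ _ fun j => by
    have h := (exists_limit_lift D s).choose_spec j n
    exact (congr_app (congrArg Hom.nat (hm j)) n).trans h.symm

instance : HasFiniteLimits (Dual C M) :=
  ⟨fun _ _ _ => ⟨fun D => ⟨_, limitConeIsLimit D⟩⟩⟩

instance (m : M) : PreservesFiniteLimits (ev C M m) :=
  ⟨fun _ _ _ => ⟨fun {D} => preservesLimit_of_preserves_limit_cone (limitConeIsLimit D)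
    (isLimitEval D m)⟩⟩

/-- The pointwise colimit of a diagram of module functors. -/
noncomputable def colimitFunctor : M ⥤ M := colimit (D ⋙ forget C M)

/-- The coprojections of the pointwise colimit. -/
noncomputable def colimitι (j : J) : (D.obj j).functor ⟶ colimitFunctor D :=
  colimit.ι (D ⋙ forget C M) j

/-- Pointwise colimits of module functors. -/
noncomputable def isColimitEval (n : M) :
    IsColimit (((evaluation M M).obj n).mapCocone (colimit.cocone (D ⋙ forget C M))) :=
  isColimitOfPreserves _ (colimit.isColimit _)

/-- The action preserves pointwise colimits of module functors. -/
noncomputable def isColimitActionEval (c : C) (n : M) :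
    IsColimit ((actionLeft M c).mapCocone
      (((evaluation M M).obj n).mapCocone (colimit.cocone (D ⋙ forget C M)))) :=
  isColimitOfPreserves _ (isColimitEval D n)

theorem colimit_hom_ext (n : M) {t : M} (f g : (colimitFunctor D).obj n ⟶ t)
    (h : ∀ j, (colimitι D j).app n ≫ f = (colimitι D j).app n ≫ g) : f = g :=
  (isColimitEval D n).hom_ext h

theorem colimit_action_hom_ext (c : C) (n : M) {t : M}
    (f g : c ⊙ₗ (colimitFunctor D).obj n ⟶ t)
    (h : ∀ j, c ⊴ₗ (colimitι D j).app n ≫ f = c ⊴ₗ (colimitι D j).app n ≫ g) : f = g :=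
  (isColimitActionEval D c n).hom_ext h

theorem map_comp_colimitι {j j' : J} (f : j ⟶ j') (n : M) :
    (D.map f).nat.app n ≫ (colimitι D j').app n = (colimitι D j).app n :=
  congr_app (colimit.w (D ⋙ forget C M) f) n

/-- For colimits it is the lax structure that uses exactness of `c ⊙ₗ -`, since its source has to be
a colimit. -/
theorem exists_colimit_μ (c : C) (n : M) :
    ∃ μ : c ⊙ₗ (colimitFunctor D).obj n ⟶ (colimitFunctor D).obj (c ⊙ₗ n),
      ∀ j, c ⊴ₗ (colimitι D j).app n ≫ μ = μₗ (D.obj j).functor c n ≫ (colimitι D j).app _ := by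
  have key {j j' : J} (f : j ⟶ j') :
      c ⊴ₗ (D.map f).nat.app n ≫ μₗ (D.obj j').functor c n ≫ (colimitι D j').app _ =
      μₗ (D.obj j).functor c n ≫ (colimitι D j).app _ := by
    rw [← Category.assoc, ← (D.map f).comm, ← map_comp_colimitι D f]
    simp
  exact ⟨(isColimitActionEval D c n).desc ⟨_,
    { app := fun j => μₗ (D.obj j).functor c n ≫ (colimitι D j).app _
      naturality := fun {j j'} f => (key f).trans (Category.comp_id _).symm }⟩,
    (isColimitActionEval D c n).fac _⟩

theorem exists_colimit_δ (c : C) (n : M) :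
    ∃ δ : (colimitFunctor D).obj (c ⊙ₗ n) ⟶ c ⊙ₗ (colimitFunctor D).obj n,
      ∀ j, (colimitι D j).app _ ≫ δ = δₗ (D.obj j).functor c n ≫ c ⊴ₗ (colimitι D j).app n := by
  have key {j j' : J} (f : j ⟶ j') :
      (D.map f).nat.app _ ≫ δₗ (D.obj j').functor c n ≫ c ⊴ₗ (colimitι D j').app n =
      δₗ (D.obj j).functor c n ≫ c ⊴ₗ (colimitι D j).app n := by
    rw [← Category.assoc, comm_δ, ← map_comp_colimitι D f]
    simp
  exact ⟨(isColimitEval D (c ⊙ₗ n)).desc ⟨_,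
    { app := fun j => δₗ (D.obj j).functor c n ≫ c ⊴ₗ (colimitι D j).app n
      naturality := fun {j j'} f => (key f).trans (Category.comp_id _).symm }⟩,
    (isColimitEval D (c ⊙ₗ n)).fac _⟩

noncomputable instance colimitLinear : (colimitFunctor D).LeftLinear C :=
  linearOfJointlyEpi D.obj _ (colimitι D)
    (fun n _ f g => colimit_hom_ext D n f g) (fun c n _ f g => colimit_action_hom_ext D c n f g)
    (fun c n => (exists_colimit_μ D c n).choose)
    (fun j c n => (exists_colimit_μ D c n).choose_spec j)
    (fun c n => (exists_colimit_δ D c n).choose)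
    (fun j c n => (exists_colimit_δ D c n).choose_spec j)

theorem colimitFunctor_μ (j : J) (c : C) (n : M) :
    c ⊴ₗ (colimitι D j).app n ≫ μₗ (colimitFunctor D) c n =
      μₗ (D.obj j).functor c n ≫ (colimitι D j).app _ :=
  (exists_colimit_μ D c n).choose_spec j

/-- The colimit of a finite diagram of module functors. -/
noncomputable abbrev colimitObj : Dual C M where
  functor := colimitFunctor D
  additive := ⟨fun {m m' f g} => colimit_hom_ext D _ _ _ fun j => by
    rw [← (colimitι D j).naturality, Preadditive.comp_add, ← (colimitι D j).naturality,
      ← (colimitι D j).naturality, Functor.map_add, Preadditive.add_comp]⟩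
  linear := inferInstance

/-- The colimit cocone of a finite diagram of module functors. -/
noncomputable abbrev colimitCocone : Cocone D where
  pt := colimitObj D
  ι :=
    { app := fun j => ⟨colimitι D j, fun c n => (colimitFunctor_μ D j c n).symm⟩
      naturality := fun _ _ f => hom_ext fun n =>
        (map_comp_colimitι D f n).trans (Category.comp_id _).symm }

theorem exists_colimit_desc (s : Cocone D) : ∃ α : colimitFunctor D ⟶ s.pt.functor,
    ∀ j n, (colimitι D j).app n ≫ α.app n = (s.ι.app j).nat.app n :=
  ⟨colimit.desc (D ⋙ forget C M) ((forget C M).mapCocone s), fun j n =>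
    congr_app (colimit.ι_desc ((forget C M).mapCocone s) j) n⟩

/-- The pointwise colimit is a colimit in the category of module functors. -/
noncomputable def colimitCoconeIsColimit : IsColimit (colimitCocone D) where
  desc s := ⟨(exists_colimit_desc D s).choose, fun c n =>
    colimit_action_hom_ext D _ _ _ _ fun j => by
      have h := (exists_colimit_desc D s).choose_spec j
      have h2 : μₗ (D.obj j).functor c n ≫ (s.ι.app j).nat.app (c ⊙ₗ n) =
        c ⊴ₗ (s.ι.app j).nat.app n ≫ μₗ s.pt.functor c n := (s.ι.app j).comm c n
      rw [← MonoidalLeftAction.actionHomRight_comp_assoc, h, ← h2,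
        ← Category.assoc, colimitFunctor_μ, Category.assoc, h]⟩
  fac s j := hom_ext fun n => (exists_colimit_desc D s).choose_spec j n
  uniq s m hm := hom_ext fun n => colimit_hom_ext D _ _ _ fun j => by
    have h := (exists_colimit_desc D s).choose_spec j n
    exact (congr_app (congrArg Hom.nat (hm j)) n).trans h.symm

instance : HasFiniteColimits (Dual C M) :=
  ⟨fun _ _ _ => ⟨fun D => ⟨_, colimitCoconeIsColimit D⟩⟩⟩

instance (m : M) : PreservesFiniteColimits (ev C M m) :=
  ⟨fun _ _ _ => ⟨fun {D} => preservesColimit_of_preserves_colimit_cocone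
    (colimitCoconeIsColimit D) (isColimitEval D m)⟩⟩

theorem isIso_of_isIso_app {F G : Dual C M} (α : F ⟶ G) (h : ∀ m, IsIso (α.nat.app m)) :
    IsIso α := by
  have : IsIso α.nat := NatIso.isIso_of_isIso_app _
  exact (mkIso (asIso α.nat) α.comm).isIso_hom

/-- Module functors form an abelian category. -/
noncomputable instance : Abelian (Dual C M) :=
  have {F G : Dual C M} (α : F ⟶ G) : IsIso (Abelian.coimageImageComparison α) :=
    isIso_of_isIso_app _ fun m => by
      -- Evaluation is exact, so the component at `m` is the comparison morphism of `M`, which is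
      -- invertible.
      have e := Abelian.PreservesCoimageImageComparison.iso (ev C M m) α
      have : IsIso (Arrow.mk (Abelian.coimageImageComparison ((ev C M m).map α))).hom :=
        inferInstanceAs (IsIso (Abelian.coimageImageComparison ((ev C M m).map α)))
      exact (Arrow.isIso_iff_isIso_of_isIso e.hom).2 this
  Abelian.ofCoimageImageComparisonIsIso

end Limits

end Dual

/-! ### Duals and actions -/

section Duals

variable {C : Type u} [Category.{v} C] [MonoidalCategory C]
    {M : Type u₁} [Category.{v₁} M] [MonoidalLeftAction C M]
    {N : Type u₂} [Category.{v₂} N] [MonoidalLeftAction C N]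

section Pairing

variable (X Y : C) [ExactPairing X Y]

/-- The coevaluation of an exact pairing, acting on an object. -/
def coevAct (m : M) : m ⟶ X ⊙ₗ Y ⊙ₗ m := (λₗ[C] m).inv ≫ η_ X Y ⊵ₗ m ≫ (αₗ X Y m).hom

/-- The evaluation of an exact pairing, acting on an object. -/
def evAct (m : M) : Y ⊙ₗ X ⊙ₗ m ⟶ m := (αₗ Y X m).inv ≫ ε_ X Y ⊵ₗ m ≫ (λₗ[C] m).hom

theorem coevAct_naturality {m n : M} (f : m ⟶ n) :
    f ≫ coevAct X Y n = coevAct X Y m ≫ X ⊴ₗ Y ⊴ₗ f := by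
  have h := action_exchange (η_ X Y) f
  simp only [MonoidalLeftAction.unit_actionHomRight, MonoidalLeftAction.tensor_actionHomRight,
    Category.assoc] at h
  simp only [coevAct, Category.assoc]
  rw [← cancel_epi (λₗ[C] m).hom, ← cancel_mono (αₗ X Y n).inv]
  simpa using h

theorem coevAct_naturality_assoc {m n : M} (f : m ⟶ n) {t : M} (h : X ⊙ₗ Y ⊙ₗ n ⟶ t) :
    f ≫ coevAct X Y n ≫ h = coevAct X Y m ≫ X ⊴ₗ Y ⊴ₗ f ≫ h := by
  rw [← Category.assoc, coevAct_naturality, Category.assoc]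

theorem evAct_naturality {m n : M} (f : m ⟶ n) :
    Y ⊴ₗ X ⊴ₗ f ≫ evAct X Y n = evAct X Y m ≫ f := by
  have h := action_exchange (ε_ X Y) f
  simp only [MonoidalLeftAction.unit_actionHomRight, MonoidalLeftAction.tensor_actionHomRight,
    Category.assoc] at h
  simp only [evAct, Category.assoc]
  rw [← cancel_epi (αₗ Y X m).hom, ← cancel_mono (λₗ[C] n).inv]
  simpa using h

@[simp]
theorem coevAct_evAct (m : M) : Y ⊴ₗ coevAct X Y m ≫ evAct X Y (Y ⊙ₗ m) = 𝟙 _ := by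
  have h := congrArg (fun f => f ⊵ₗ m) (ExactPairing.coevaluation_evaluation X Y)
  simp only [MonoidalLeftAction.comp_actionHomLeft,
    MonoidalLeftAction.whiskerLeft_actionHomLeft, Category.assoc] at h
  rw [← cancel_epi (αₗ Y (𝟙_ C) m).inv, Iso.inv_hom_id_assoc] at h
  have hα : Y ⊴ₗ (αₗ X Y m).hom ≫ (αₗ Y X (Y ⊙ₗ m)).inv ≫ (αₗ (Y ⊗ X) Y m).inv =
      (αₗ Y (X ⊗ Y) m).inv ≫ (α_ Y X Y).inv ⊵ₗ m := by
    rw [← cancel_epi (αₗ Y (X ⊗ Y) m).hom, ← cancel_epi ((α_ Y X Y).hom ⊵ₗ m)]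
    simp
  simp only [coevAct, evAct, MonoidalLeftAction.actionHomLeft_action, Category.assoc,
    actionHomRight_comp]
  have hl : (λ_ Y).inv ⊵ₗ m ≫ (αₗ (𝟙_ C) Y m).hom ≫ (λₗ[C] (Y ⊙ₗ m)).hom = 𝟙 _ := by
    rw [← MonoidalLeftAction.leftUnitor_actionHom, MonoidalLeftAction.inv_hom_actionHomLeft]
  rw [reassoc_of% hα, reassoc_of% h, hl]
  simp

@[simp]
theorem coevAct_evAct_assoc (m : M) {t : M} (h : Y ⊙ₗ m ⟶ t) :
    Y ⊴ₗ coevAct X Y m ≫ evAct X Y (Y ⊙ₗ m) ≫ h = h := by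
  rw [← Category.assoc, coevAct_evAct, Category.id_comp]

@[simp]
theorem evAct_coevAct (m : M) : coevAct X Y (X ⊙ₗ m) ≫ X ⊴ₗ evAct X Y m = 𝟙 _ := by
  have h := congrArg (fun f => f ⊵ₗ m) (ExactPairing.evaluation_coevaluation X Y)
  simp only [MonoidalLeftAction.comp_actionHomLeft,
    MonoidalLeftAction.whiskerLeft_actionHomLeft] at h
  rw [← cancel_mono (αₗ X (𝟙_ C) m).hom] at h
  simp only [Category.assoc, Iso.inv_hom_id, Category.comp_id] at h
  have hα : (αₗ (X ⊗ Y) X m).hom ≫ (αₗ X Y (X ⊙ₗ m)).hom ≫ X ⊴ₗ (αₗ Y X m).inv =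
      (α_ X Y X).hom ⊵ₗ m ≫ (αₗ X (Y ⊗ X) m).hom := by
    rw [← cancel_mono (X ⊴ₗ (αₗ Y X m).hom)]
    simp
  have hρ : (ρ_ X).inv ⊵ₗ m ≫ (αₗ X (𝟙_ C) m).hom ≫ X ⊴ₗ (λₗ[C] m).hom = 𝟙 _ := by
    rw [← MonoidalLeftAction.rightUnitor_actionHom, MonoidalLeftAction.inv_hom_actionHomLeft]
  simp only [coevAct, evAct, MonoidalLeftAction.actionHomLeft_action, Category.assoc,
    actionHomRight_comp]
  rw [reassoc_of% hα, reassoc_of% h, hρ]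
  simp

@[simp]
theorem evAct_coevAct_assoc (m : M) {t : M} (h : X ⊙ₗ m ⟶ t) :
    coevAct X Y (X ⊙ₗ m) ≫ X ⊴ₗ evAct X Y m ≫ h = h := by
  rw [← Category.assoc, evAct_coevAct, Category.id_comp]

theorem coevAct_lax (F : M ⥤ N) [F.LaxLeftLinear C] (m : M) :
    coevAct X Y (F.obj m) ≫ X ⊴ₗ μₗ F Y m ≫ μₗ F X (Y ⊙ₗ m) = F.map (coevAct X Y m) := by
  simp only [coevAct, Category.assoc, F.map_comp]
  rw [← μₗ_associativity, μₗ_naturality_left_assoc, μₗ_unitality_inv_assoc]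

theorem evAct_lax (F : M ⥤ N) [F.LaxLeftLinear C] (m : M) :
    Y ⊴ₗ μₗ F X m ≫ μₗ F Y (X ⊙ₗ m) ≫ F.map (evAct X Y m) = evAct X Y (F.obj m) := by
  simp only [evAct, F.map_comp]
  rw [μₗ_associativity_inv_assoc, ← μₗ_naturality_left_assoc, ← μₗ_unitality]

theorem coevAct_oplax (F : M ⥤ N) [F.OplaxLeftLinear C] (m : M) :
    F.map (coevAct X Y m) ≫ δₗ F X (Y ⊙ₗ m) ≫ X ⊴ₗ δₗ F Y m = coevAct X Y (F.obj m) := by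
  simp only [coevAct, Category.assoc, F.map_comp]
  rw [← δₗ_associativity, δₗ_naturality_left_assoc, ← δₗ_unitality_inv_assoc]

theorem evAct_oplax (F : M ⥤ N) [F.OplaxLeftLinear C] (m : M) :
    δₗ F Y (X ⊙ₗ m) ≫ Y ⊴ₗ δₗ F X m ≫ evAct X Y (F.obj m) = F.map (evAct X Y m) := by
  simp only [evAct, F.map_comp]
  rw [δₗ_associativity_inv_assoc, ← δₗ_naturality_left_assoc, δₗ_unitality_hom]

variable (M) in
/-- The adjunction between the actions of dual objects. -/
def actionAdjunction : actionLeft M Y ⊣ actionLeft M X :=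
  Adjunction.mkOfUnitCounit
    { unit := { app := fun m => coevAct X Y m
                naturality := fun _ _ f => coevAct_naturality X Y f }
      counit := { app := fun m => evAct X Y m
                  naturality := fun _ _ f => evAct_naturality X Y f }
      left_triangle := by
        ext m
        exact (congrArg (_ ≫ ·) (Category.id_comp _)).trans (coevAct_evAct X Y m)
      right_triangle := by
        ext m
        exact (congrArg (_ ≫ ·) (Category.id_comp _)).trans (evAct_coevAct X Y m) }

end Pairing

/-- A lax module functor over a category with right duals is a module functor. -/
noncomputable abbrev leftLinearOfRightDuals (h : ∀ X : C, ∃ Y : C, Nonempty (ExactPairing X Y))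
    (F : M ⥤ N) [F.LaxLeftLinear C] : F.LeftLinear C :=
  letI (c : C) : ExactPairing c (h c).choose := (h c).choose_spec.some
  leftLinearOfLax F
    -- With `c*` the right dual of `c`, the inverse is `F (c m) ⟶ c c* F (c m) ⟶ c F (c* c m) ⟶ c F
    -- m`.
    (fun c m => coevAct c (h c).choose _ ≫ c ⊴ₗ (μₗ F _ _ ≫ F.map (evAct c (h c).choose m)))
    (fun c m => by
      rw [coevAct_naturality_assoc, ← actionHomRight_comp, evAct_lax, evAct_coevAct])
    (fun c m => by
      rw [Category.assoc, actionHomRight_comp, Category.assoc, μₗ_naturality_right,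
        ← Category.assoc (c ⊴ₗ _), ← Category.assoc, coevAct_lax, ← F.map_comp, evAct_coevAct,
        F.map_id])

/-- An oplax module functor over a category with left duals is a module functor. -/
noncomputable abbrev leftLinearOfLeftDuals (h : ∀ X : C, ∃ Y : C, Nonempty (ExactPairing Y X))
    (F : M ⥤ N) [F.OplaxLeftLinear C] : F.LeftLinear C :=
  letI (c : C) : ExactPairing (h c).choose c := (h c).choose_spec.some
  leftLinearOfOplax F
    -- With `*c` the left dual of `c`, the inverse is `c F m ⟶ c F (*c c m) ⟶ c *c F (c m) ⟶ F (c
    -- m)`.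
    (fun c m => c ⊴ₗ (F.map (coevAct (h c).choose c m) ≫ δₗ F _ _) ≫ evAct (h c).choose c _)
    (fun c m => by
      rw [Category.assoc, ← evAct_naturality, ← actionHomRight_comp_assoc, Category.assoc,
        coevAct_oplax, coevAct_evAct])
    (fun c m => by
      rw [actionHomRight_comp, Category.assoc, ← δₗ_naturality_right_assoc,
        evAct_oplax, ← F.map_comp, coevAct_evAct, F.map_id])

end Duals

/-! ### Adjoints of module functors -/

section Adjoint

variable {C : Type u} [Category.{v} C] [MonoidalCategory C]
    {M : Type u₁} [Category.{v₁} M] [MonoidalLeftAction C M]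
    {N : Type u₂} [Category.{v₂} N] [MonoidalLeftAction C N]
    {F : M ⥤ N} {G : N ⥤ M} (adj : F ⊣ G)

/-- The unit of an adjunction at an object. -/
def unitAt (m : M) : m ⟶ G.obj (F.obj m) := adj.unit.app m

/-- The counit of an adjunction at an object. -/
def counitAt (n : N) : F.obj (G.obj n) ⟶ n := adj.counit.app n

theorem unitAt_naturality {m m' : M} (f : m ⟶ m') :
    unitAt adj m ≫ G.map (F.map f) = f ≫ unitAt adj m' :=
  adj.unit_naturality f

theorem unitAt_naturality_assoc {m m' : M} (f : m ⟶ m') {t : M} (h : G.obj (F.obj m') ⟶ t) :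
    unitAt adj m ≫ G.map (F.map f) ≫ h = f ≫ unitAt adj m' ≫ h := by
  rw [← Category.assoc, unitAt_naturality, Category.assoc]

theorem counitAt_naturality {n n' : N} (f : n ⟶ n') :
    F.map (G.map f) ≫ counitAt adj n' = counitAt adj n ≫ f :=
  adj.counit_naturality f

@[simp]
theorem unitAt_counitAt (m : M) : F.map (unitAt adj m) ≫ counitAt adj (F.obj m) = 𝟙 _ :=
  adj.left_triangle_components m

@[simp]
theorem unitAt_counitAt_assoc (m : M) {t : N} (h : F.obj m ⟶ t) :
    F.map (unitAt adj m) ≫ counitAt adj (F.obj m) ≫ h = h := by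
  rw [← Category.assoc, unitAt_counitAt, Category.id_comp]

@[simp]
theorem counitAt_unitAt (n : N) : unitAt adj (G.obj n) ≫ G.map (counitAt adj n) = 𝟙 _ :=
  adj.right_triangle_components n

theorem adj_hom_ext {m : M} {n : N} {f g : m ⟶ G.obj n}
    (h : F.map f ≫ counitAt adj n = F.map g ≫ counitAt adj n) : f = g := by
  have key (f : m ⟶ G.obj n) : f = unitAt adj m ≫ G.map (F.map f ≫ counitAt adj n) := by
    rw [G.map_comp, unitAt_naturality_assoc, counitAt_unitAt, Category.comp_id]
  rw [key f, h, ← key]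

theorem adj_hom_ext' {m : M} {n : N} {f g : F.obj m ⟶ n}
    (h : unitAt adj m ≫ G.map f = unitAt adj m ≫ G.map g) : f = g := by
  have key (f : F.obj m ⟶ n) : f = F.map (unitAt adj m ≫ G.map f) ≫ counitAt adj n := by
    rw [F.map_comp, Category.assoc, counitAt_naturality, unitAt_counitAt_assoc]
  rw [key f, h, ← key]

/-- The lax structure of a right adjoint of an oplax module functor. -/
def rightAdjointμ [F.OplaxLeftLinear C] (c : C) (n : N) : c ⊙ₗ G.obj n ⟶ G.obj (c ⊙ₗ n) :=
  unitAt adj _ ≫ G.map (δₗ F c (G.obj n) ≫ c ⊴ₗ counitAt adj n)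

theorem map_rightAdjointμ [F.OplaxLeftLinear C] (c : C) (n : N) :
    F.map (rightAdjointμ adj c n) ≫ counitAt adj _ =
      δₗ F c (G.obj n) ≫ c ⊴ₗ counitAt adj n := by
  rw [rightAdjointμ, F.map_comp, Category.assoc, counitAt_naturality, unitAt_counitAt_assoc]

theorem map_rightAdjointμ_assoc [F.OplaxLeftLinear C] (c : C) (n : N) {t : N} (h : c ⊙ₗ n ⟶ t) :
    F.map (rightAdjointμ adj c n) ≫ counitAt adj _ ≫ h =
      δₗ F c (G.obj n) ≫ c ⊴ₗ counitAt adj n ≫ h := by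
  rw [← Category.assoc, map_rightAdjointμ, Category.assoc]

/-- A right adjoint of an oplax module functor is a lax module functor. -/
abbrev rightAdjointLax [F.OplaxLeftLinear C] : G.LaxLeftLinear C where
  μₗ := rightAdjointμ adj
  μₗ_naturality_left {c c'} f n := adj_hom_ext adj (by
    rw [F.map_comp, Category.assoc, map_rightAdjointμ, δₗ_naturality_left_assoc, F.map_comp,
      Category.assoc, counitAt_naturality, map_rightAdjointμ_assoc, action_exchange])
  μₗ_naturality_right c {n n'} f := adj_hom_ext adj (by
    rw [F.map_comp, Category.assoc, map_rightAdjointμ, δₗ_naturality_right_assoc, F.map_comp,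
      Category.assoc, counitAt_naturality, map_rightAdjointμ_assoc, ← actionHomRight_comp,
      ← actionHomRight_comp, counitAt_naturality])
  μₗ_associativity c c' n := adj_hom_ext adj (by
    simp only [F.map_comp, Category.assoc]
    rw [counitAt_naturality, map_rightAdjointμ_assoc, map_rightAdjointμ,
      δₗ_naturality_right_assoc, ← actionHomRight_comp, map_rightAdjointμ,
      actionHomRight_comp, ← δₗ_associativity_assoc]
    simp)
  μₗ_unitality n := adj_hom_ext adj (by
    rw [F.map_comp, Category.assoc, counitAt_naturality, map_rightAdjointμ_assoc,
      ← δₗ_unitality_hom]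
    simp)

/-- The oplax structure of a left adjoint of a lax module functor. -/
def leftAdjointδ [G.LaxLeftLinear C] (c : C) (m : M) : F.obj (c ⊙ₗ m) ⟶ c ⊙ₗ F.obj m :=
  F.map (c ⊴ₗ unitAt adj m ≫ μₗ G c (F.obj m)) ≫ counitAt adj _

theorem leftAdjointδ_map [G.LaxLeftLinear C] (c : C) (m : M) :
    unitAt adj _ ≫ G.map (leftAdjointδ adj c m) =
      c ⊴ₗ unitAt adj m ≫ μₗ G c (F.obj m) := by
  rw [leftAdjointδ, G.map_comp, unitAt_naturality_assoc, counitAt_unitAt, Category.comp_id]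

theorem leftAdjointδ_map_assoc [G.LaxLeftLinear C] (c : C) (m : M) {t : M}
    (h : G.obj (c ⊙ₗ F.obj m) ⟶ t) :
    unitAt adj _ ≫ G.map (leftAdjointδ adj c m) ≫ h =
      c ⊴ₗ unitAt adj m ≫ μₗ G c (F.obj m) ≫ h := by
  rw [← Category.assoc, leftAdjointδ_map, Category.assoc]

/-- A left adjoint of a lax module functor is an oplax module functor. -/
abbrev leftAdjointOplax [G.LaxLeftLinear C] : F.OplaxLeftLinear C where
  δₗ := leftAdjointδ adj
  δₗ_naturality_left {c c'} f m := adj_hom_ext' adj (by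
    rw [G.map_comp, unitAt_naturality_assoc, leftAdjointδ_map, G.map_comp,
      leftAdjointδ_map_assoc, ← μₗ_naturality_left, MonoidalLeftAction.action_exchange_assoc])
  δₗ_naturality_right c {m m'} f := adj_hom_ext' adj (by
    rw [G.map_comp, unitAt_naturality_assoc, leftAdjointδ_map, G.map_comp,
      leftAdjointδ_map_assoc, ← μₗ_naturality_right, ← actionHomRight_comp_assoc,
      ← actionHomRight_comp_assoc, unitAt_naturality])
  δₗ_associativity c c' m := adj_hom_ext' adj (by
    simp only [G.map_comp]
    rw [unitAt_naturality_assoc, leftAdjointδ_map_assoc, leftAdjointδ_map_assoc,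
      ← μₗ_naturality_right, ← actionHomRight_comp_assoc, leftAdjointδ_map,
      actionHomRight_comp_assoc, μₗ_associativity]
    simp)
  δₗ_unitality_inv m := adj_hom_ext' adj (by
    rw [G.map_comp, unitAt_naturality_assoc, leftAdjointδ_map, ← μₗ_unitality_inv]
    simp)

variable [F.LeftLinear C] [G.LeftLinear C]

/-- Linearity of unit and of counit are equivalent through the triangle identities; a right
adjoint's structure is built to satisfy one, a left adjoint's the other. -/
theorem counit_linear_of_unit_linear (h : ∀ (c : C) (m : M),
      unitAt adj _ ≫ G.map (δₗ F c m) = c ⊴ₗ unitAt adj m ≫ μₗ G c (F.obj m)) (c : C) (n : N) :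
    F.map (μₗ G c n) ≫ counitAt adj _ = δₗ F c (G.obj n) ≫ c ⊴ₗ counitAt adj n :=
  adj_hom_ext' adj (by
    rw [G.map_comp, unitAt_naturality_assoc, counitAt_unitAt, G.map_comp, reassoc_of% h,
      ← μₗ_naturality_right, ← actionHomRight_comp_assoc, counitAt_unitAt]
    simp)

theorem unit_linear_of_counit_linear (h : ∀ (c : C) (n : N),
      F.map (μₗ G c n) ≫ counitAt adj _ = δₗ F c (G.obj n) ≫ c ⊴ₗ counitAt adj n)
    (c : C) (m : M) :
    unitAt adj _ ≫ G.map (δₗ F c m) = c ⊴ₗ unitAt adj m ≫ μₗ G c (F.obj m) :=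
  adj_hom_ext adj (by
    rw [F.map_comp, Category.assoc, counitAt_naturality, unitAt_counitAt_assoc, F.map_comp,
      Category.assoc, h, δₗ_naturality_right_assoc, ← actionHomRight_comp, unitAt_counitAt]
    simp)

end Adjoint

/-! ### Internal Homs -/

section InternalHom

variable (C : Type u₁) [Category.{v₁} C] [Preadditive C] [MonoidalCategory C]
    {M : Type u₂} [Category.{v₂} M] [Abelian M] [MonoidalLeftAction C M]
    [PreadditiveAction C M]

variable (M) in
/-- All the functors `c ↦ c ⊙ₗ m` have right adjoints. -/
class HasInternalHom : Prop where
  isLeftAdjoint : ∀ m : M, (actionRight C m).IsLeftAdjoint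

instance [HasInternalHom C M] (m : M) : (actionRight C m).IsLeftAdjoint :=
  HasInternalHom.isLeftAdjoint m

/-- The functor `c ↦ c ⊙ₗ m` is a module functor. -/
instance actionRightOplax (m : M) : (actionRight C m).OplaxLeftLinear C where
  δₗ c d := (αₗ c d m).hom
  δₗ_naturality_left f d := by
    change (f ▷ d) ⊵ₗ m ≫ _ = _ ≫ f ⊵ₗ (d ⊙ₗ m)
    simp
  δₗ_naturality_right c d d' f := by
    change (c ◁ f) ⊵ₗ m ≫ _ = _ ≫ c ⊴ₗ f ⊵ₗ m
    simp
  δₗ_associativity c c' d := by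
    change (αₗ (c ⊗ c') d m).hom ≫ (αₗ c c' (d ⊙ₗ m)).hom =
      (α_ c c' d).hom ⊵ₗ m ≫ (αₗ c (c' ⊗ d) m).hom ≫ c ⊴ₗ (αₗ c' d m).hom
    simp
  δₗ_unitality_inv d := by
    change (λₗ[C] (d ⊙ₗ m)).inv = (λ_ d).inv ⊵ₗ m ≫ (αₗ (𝟙_ C) d m).hom
    rw [← cancel_mono (λₗ[C] (d ⊙ₗ m)).hom, Iso.inv_hom_id, Category.assoc,
      ← MonoidalLeftAction.leftUnitor_actionHom, MonoidalLeftAction.inv_hom_actionHomLeft]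

variable [HasInternalHom C M]

/-- The internal Hom of a module category, as a functor of its target. -/
noncomputable def ihom (y : M) : M ⥤ C := (actionRight C y).rightAdjoint

/-- The adjunction defining the internal Hom. -/
noncomputable def ihomAdj (y : M) : actionRight C y ⊣ ihom C y :=
  Adjunction.ofIsLeftAdjoint (actionRight C y)

instance (y : M) : (ihom C y).Additive := (ihomAdj C y).right_adjoint_additive

noncomputable instance (y : M) : (ihom C y).LaxLeftLinear C := rightAdjointLax (ihomAdj C y)

/-- The evaluation of the internal Hom. -/
noncomputable def ihomEv (y n : M) : (ihom C y).obj n ⊙ₗ y ⟶ n := counitAt (ihomAdj C y) n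

/-- The coevaluation of the internal Hom. -/
noncomputable def ihomCoev (y : M) (c : C) : c ⟶ (ihom C y).obj (c ⊙ₗ y) :=
  unitAt (ihomAdj C y) c

theorem ihomEv_naturality (y : M) {n n' : M} (f : n ⟶ n') :
    (ihom C y).map f ⊵ₗ y ≫ ihomEv C y n' = ihomEv C y n ≫ f :=
  counitAt_naturality (ihomAdj C y) f

@[simp]
theorem ihomCoev_ihomEv (y : M) (c : C) : ihomCoev C y c ⊵ₗ y ≫ ihomEv C y (c ⊙ₗ y) = 𝟙 _ :=
  unitAt_counitAt (ihomAdj C y) c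

@[simp]
theorem ihomCoev_ihomEv_assoc (y : M) (c : C) {t : M} (h : c ⊙ₗ y ⟶ t) :
    ihomCoev C y c ⊵ₗ y ≫ ihomEv C y (c ⊙ₗ y) ≫ h = h := by
  rw [← Category.assoc, ihomCoev_ihomEv, Category.id_comp]

@[simp]
theorem ihomEv_ihomCoev (y n : M) : ihomCoev C y _ ≫ (ihom C y).map (ihomEv C y n) = 𝟙 _ :=
  counitAt_unitAt (ihomAdj C y) n

variable {C} in
theorem ihom_hom_ext {y n : M} {c : C} {f g : c ⟶ (ihom C y).obj n}
    (h : f ⊵ₗ y ≫ ihomEv C y n = g ⊵ₗ y ≫ ihomEv C y n) : f = g :=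
  adj_hom_ext (ihomAdj C y) h

/-- The lax module structure of the internal Hom. -/
noncomputable def ihomμ (y : M) (c : C) (n : M) :
    c ⊗ (ihom C y).obj n ⟶ (ihom C y).obj (c ⊙ₗ n) := μₗ (ihom C y) c n

theorem ihomμ_ihomEv (y : M) (c : C) (n : M) :
    ihomμ C y c n ⊵ₗ y ≫ ihomEv C y (c ⊙ₗ n) =
      (αₗ c ((ihom C y).obj n) y).hom ≫ c ⊴ₗ ihomEv C y n :=
  map_rightAdjointμ (ihomAdj C y) c n

/-- The morphism `𝟙 ⟶ [y, n]` naming a morphism `y ⟶ n`. -/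
noncomputable def ihomName {y n : M} (f : y ⟶ n) : 𝟙_ C ⟶ (ihom C y).obj n :=
  ihomCoev C y (𝟙_ C) ≫ (ihom C y).map ((λₗ[C] y).hom ≫ f)

theorem ihomName_ihomEv {y n : M} (f : y ⟶ n) :
    ihomName C f ⊵ₗ y ≫ ihomEv C y n = (λₗ[C] y).hom ≫ f := by
  rw [ihomName, MonoidalLeftAction.comp_actionHomLeft, Category.assoc, ihomEv_naturality,
    ihomCoev_ihomEv_assoc]

theorem ihomName_map {y n n' : M} (f : y ⟶ n) (g : n ⟶ n') :
    ihomName C f ≫ (ihom C y).map g = ihomName C (f ≫ g) := by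
  simp [ihomName]

/-- Both sides agree after evaluation. For `f = 𝟙` this expresses the coevaluation through the name
of the identity, which is what `freeUnit_freeμ` needs. -/
theorem whiskerLeft_ihomName_ihomμ {y n : M} (f : y ⟶ n) (c : C) :
    c ◁ ihomName C f ≫ ihomμ C y c n =
      (ρ_ c).hom ≫ ihomCoev C y c ≫ (ihom C y).map (c ⊴ₗ f) := by
  apply ihom_hom_ext
  simp only [MonoidalLeftAction.comp_actionHomLeft, Category.assoc, ihomμ_ihomEv,
    MonoidalLeftAction.whiskerLeft_actionHomLeft, Iso.inv_hom_id_assoc, ihomEv_naturality,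
    ihomCoev_ihomEv_assoc]
  rw [← actionHomRight_comp, ihomName_ihomEv, MonoidalLeftAction.rightUnitor_actionHom]
  simp

variable [IsExactAction C M]

/-- As a right adjoint the internal Hom is only lax; right duals in `C` make its structure
invertible. -/
noncomputable instance (y : M) : (ihom C y).LeftLinear C :=
  leftLinearOfRightDuals (IsExactAction.exists_right_dual M) (ihom C y)

end InternalHom

/-! ### The free module functors `[y, -] ⊙ₗ z` -/

section Free

variable {C : Type u₁} [Category.{v₁} C] [Preadditive C] [MonoidalCategory C]
    {M : Type u₂} [Category.{v₂} M] [Abelian M] [MonoidalLeftAction C M]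
    [PreadditiveAction C M] [HasInternalHom C M] [IsExactAction C M]


/-- The lax module structure of `[y, -] ⊙ₗ z`. -/
noncomputable def freeμ (y z : M) (c : C) (n : M) :
    c ⊙ₗ (ihom C y).obj n ⊙ₗ z ⟶ (ihom C y).obj (c ⊙ₗ n) ⊙ₗ z :=
  (αₗ c ((ihom C y).obj n) z).inv ≫ ihomμ C y c n ⊵ₗ z

/-- The oplax module structure of `[y, -] ⊙ₗ z`. -/
noncomputable def freeδ (y z : M) (c : C) (n : M) :
    (ihom C y).obj (c ⊙ₗ n) ⊙ₗ z ⟶ c ⊙ₗ (ihom C y).obj n ⊙ₗ z :=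
  (δₗ (ihom C y) c n) ⊵ₗ z ≫ (αₗ c ((ihom C y).obj n) z).hom

theorem freeμ_naturality_left (y z : M) {c c' : C} (f : c ⟶ c') (n : M) :
    f ⊵ₗ ((ihom C y).obj n ⊙ₗ z) ≫ freeμ y z c' n =
      freeμ y z c n ≫ (ihom C y).map (f ⊵ₗ n) ⊵ₗ z := by
  have h := congrArg (· ⊵ₗ z) (μₗ_naturality_left (ihom C y) f n)
  simp only [MonoidalLeftAction.comp_actionHomLeft] at h
  rw [freeμ, freeμ, Category.assoc, ihomμ, ihomμ, ← h]
  change _ = _ ≫ (f ▷ (ihom C y).obj n) ⊵ₗ z ≫ _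
  simp

theorem freeμ_naturality_right (y z : M) (c : C) {n n' : M} (f : n ⟶ n') :
    c ⊴ₗ (ihom C y).map f ⊵ₗ z ≫ freeμ y z c n' =
      freeμ y z c n ≫ (ihom C y).map (c ⊴ₗ f) ⊵ₗ z := by
  have h := congrArg (· ⊵ₗ z) (μₗ_naturality_right (ihom C y) c f)
  simp only [MonoidalLeftAction.comp_actionHomLeft] at h
  rw [freeμ, freeμ, Category.assoc, ihomμ, ihomμ, ← h]
  change _ = _ ≫ (c ◁ (ihom C y).map f) ⊵ₗ z ≫ _
  simp

theorem freeμ_associativity (y z : M) (c c' : C) (n : M) :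
    freeμ y z (c ⊗ c') n ≫ (ihom C y).map (αₗ c c' n).hom ⊵ₗ z =
      (αₗ c c' ((ihom C y).obj n ⊙ₗ z)).hom ≫ c ⊴ₗ freeμ y z c' n ≫
        freeμ y z c (c' ⊙ₗ n) := by
  have h := congrArg (· ⊵ₗ z) (μₗ_associativity (ihom C y) c c' n)
  simp only [MonoidalLeftAction.comp_actionHomLeft] at h
  rw [freeμ, Category.assoc, ihomμ, h]
  change _ ≫ (α_ c c' ((ihom C y).obj n)).hom ⊵ₗ z ≫ (c ◁ ihomμ C y c' n) ⊵ₗ z ≫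
    ihomμ C y c (c' ⊙ₗ n) ⊵ₗ z = _
  rw [freeμ, freeμ, actionHomRight_comp,
    ← cancel_epi (αₗ (c ⊗ c') ((ihom C y).obj n) z).hom, Iso.hom_inv_id_assoc,
    ← MonoidalLeftAction.associator_actionHom_assoc, Category.assoc,
    MonoidalLeftAction.actionHomRight_hom_inv_assoc,
    MonoidalLeftAction.whiskerLeft_actionHomLeft]
  simp

theorem freeμ_unitality (y z : M) (n : M) :
    (λₗ[C] ((ihom C y).obj n ⊙ₗ z)).hom =
      freeμ y z (𝟙_ C) n ≫ (ihom C y).map (λₗ[C] n).hom ⊵ₗ z := by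
  have h := congrArg (· ⊵ₗ z) (μₗ_unitality (ihom C y) (C := C) n)
  simp only [MonoidalLeftAction.comp_actionHomLeft] at h
  rw [freeμ, Category.assoc, ihomμ, ← h]
  change _ = _ ≫ (λ_ ((ihom C y).obj n)).hom ⊵ₗ z
  simp

theorem freeμ_freeδ (y z : M) (c : C) (n : M) : freeμ y z c n ≫ freeδ y z c n = 𝟙 _ := by
  have h := congrArg (· ⊵ₗ z) (μₗ_comp_δₗ (ihom C y) c n)
  simp only [MonoidalLeftAction.comp_actionHomLeft] at h
  rw [freeμ, freeδ, Category.assoc, ihomμ, reassoc_of% h]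
  change _ ≫ 𝟙 ((c ⊗ (ihom C y).obj n)) ⊵ₗ z ≫ _ = _
  simp

theorem freeδ_freeμ (y z : M) (c : C) (n : M) : freeδ y z c n ≫ freeμ y z c n = 𝟙 _ := by
  have h := congrArg (· ⊵ₗ z) (δₗ_comp_μₗ (ihom C y) c n)
  simp only [MonoidalLeftAction.comp_actionHomLeft] at h
  rw [freeμ, freeδ, Category.assoc, Iso.hom_inv_id_assoc, ihomμ, h]
  simp

variable (C) in
/-- The functor `[y, -] ⊙ₗ z`. -/
@[simps]
noncomputable def freeFunctor (y z : M) : M ⥤ M where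
  obj n := (ihom C y).obj n ⊙ₗ z
  map f := (ihom C y).map f ⊵ₗ z

instance (y z : M) : (freeFunctor C y z).Additive where
  map_add {_ _ f g} := by
    simp only [freeFunctor_map, Functor.map_add]
    exact PreadditiveAction.add_actionHomLeft _ _ _

noncomputable instance freeLax (y z : M) : (freeFunctor C y z).LaxLeftLinear C where
  μₗ c n := freeμ y z c n
  μₗ_naturality_left f n := freeμ_naturality_left y z f n
  μₗ_naturality_right c _ _ f := freeμ_naturality_right y z c f
  μₗ_associativity c c' n := freeμ_associativity y z c c' n
  μₗ_unitality n := freeμ_unitality y z n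

noncomputable instance freeLinear (y z : M) : (freeFunctor C y z).LeftLinear C :=
  leftLinearOfLax _ (fun c n => freeδ y z c n) (freeμ_freeδ y z) (freeδ_freeμ y z)

namespace Dual

variable (C) in
/-- The object `[y, -] ⊙ₗ z` of the dual category. -/
noncomputable def free (y z : M) : Dual C M := ⟨freeFunctor C y z, inferInstance, inferInstance⟩

variable (C) in
/-- The universal element `z ⟶ [y, y] ⊙ₗ z`. -/
noncomputable def freeUnit (y z : M) : z ⟶ (ihom C y).obj y ⊙ₗ z :=
  (λₗ[C] z).inv ≫ ihomName C (𝟙 y) ⊵ₗ z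

theorem freeUnit_freeμ (y z : M) (c : C) :
    c ⊴ₗ freeUnit C y z ≫ freeμ y z c y = ihomCoev C y c ⊵ₗ z := by
  have h := congrArg (· ⊵ₗ z) (whiskerLeft_ihomName_ihomμ C (𝟙 y) c)
  simp only [MonoidalLeftAction.comp_actionHomLeft, MonoidalLeftAction.whiskerLeft_actionHomLeft,
    Category.assoc, MonoidalLeftAction.actionHomRight_id, CategoryTheory.Functor.map_id,
    Category.comp_id] at h
  rw [← cancel_epi ((ρ_ c).hom ⊵ₗ z), ← h, freeUnit, freeμ, actionHomRight_comp, Category.assoc,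
    MonoidalLeftAction.rightUnitor_actionHom]
  simp

variable (G : Dual C M)

/-- The components of the morphism `[y, -] ⊙ₗ z ⟶ G` classified by `g : z ⟶ G y`. -/
noncomputable def descApp {y z : M} (g : z ⟶ G.functor.obj y) (n : M) :
    (ihom C y).obj n ⊙ₗ z ⟶ G.functor.obj n :=
  (ihom C y).obj n ⊴ₗ g ≫ μₗ G.functor ((ihom C y).obj n) y ≫ G.functor.map (ihomEv C y n)

variable {G}

theorem descApp_naturality {y z : M} (g : z ⟶ G.functor.obj y) {n n' : M} (f : n ⟶ n') :
    (ihom C y).map f ⊵ₗ z ≫ descApp G g n' = descApp G g n ≫ G.functor.map f := by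
  simp only [descApp, Category.assoc]
  rw [← G.functor.map_comp, ← ihomEv_naturality, G.functor.map_comp,
    ← μₗ_naturality_left_assoc, action_exchange_assoc]

theorem freeμ_descApp {y z : M} (g : z ⟶ G.functor.obj y) (c : C) (n : M) :
    freeμ y z c n ≫ descApp G g (c ⊙ₗ n) = c ⊴ₗ descApp G g n ≫ μₗ G.functor c n := by
  simp only [descApp, freeμ, Category.assoc, actionHomRight_comp]
  rw [← action_exchange_assoc, μₗ_naturality_left_assoc, ← G.functor.map_comp, ihomμ_ihomEv,
    G.functor.map_comp, μₗ_associativity_assoc, μₗ_naturality_right]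
  simp

/-- The morphism `[y, -] ⊙ₗ z ⟶ G` classified by `g : z ⟶ G y`. -/
noncomputable def desc {y z : M} (g : z ⟶ G.functor.obj y) : free C y z ⟶ G where
  nat :=
    { app n := descApp G g n
      naturality _ _ f := descApp_naturality g f }
  comm c n := freeμ_descApp g c n

theorem freeUnit_descApp {y z : M} (g : z ⟶ G.functor.obj y) :
    freeUnit C y z ≫ descApp G g y = g := by
  rw [freeUnit, descApp, Category.assoc, ← action_exchange_assoc, μₗ_naturality_left_assoc,
    ← G.functor.map_comp, ihomName_ihomEv, Category.comp_id, ← μₗ_unitality]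
  simp

/-- The components of a morphism out of `[y, -] ⊙ₗ z`. -/
def freeAt {y z : M} (α : free C y z ⟶ G) (n : M) :
    (ihom C y).obj n ⊙ₗ z ⟶ G.functor.obj n := α.nat.app n

/-- A Yoneda argument: linearity of `α` for `[y, n]` acting on `y`, naturality along the evaluation
`[y, n] ⊙ₗ y ⟶ n`, and a triangle identity reduce each component to the value on the universal
element. -/
theorem freeAt_eq {y z : M} (α : free C y z ⟶ G) (n : M) :
    freeAt α n = descApp G (freeUnit C y z ≫ freeAt α y) n := by
  have h : freeμ y z ((ihom C y).obj n) y ≫ freeAt α ((ihom C y).obj n ⊙ₗ y) =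
      (ihom C y).obj n ⊴ₗ freeAt α y ≫ μₗ G.functor ((ihom C y).obj n) y :=
    α.comm ((ihom C y).obj n) y
  have h2 : (ihom C y).map (ihomEv C y n) ⊵ₗ z ≫ freeAt α n =
      freeAt α ((ihom C y).obj n ⊙ₗ y) ≫ G.functor.map (ihomEv C y n) :=
    α.nat.naturality (ihomEv C y n)
  rw [descApp, actionHomRight_comp, Category.assoc, ← reassoc_of% h, ← h2,
    reassoc_of% (freeUnit_freeμ (C := C) y z ((ihom C y).obj n)),
    ← MonoidalLeftAction.comp_actionHomLeft_assoc, ihomEv_ihomCoev]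
  simp

theorem free_hom_ext {y z : M} {α β : free C y z ⟶ G}
    (h : freeUnit C y z ≫ freeAt α y = freeUnit C y z ≫ freeAt β y) : α = β := by
  ext n
  change freeAt α n = freeAt β n
  rw [freeAt_eq α, freeAt_eq β, h]

end Dual

end Free

/-! ### Faithful functors and chain conditions -/

section FaithfulFunctors

variable {A : Type u₁} [Category.{v₁} A] [Abelian A] {B : Type u₂} [Category.{v₂} B] [Abelian B]
  (Φ : A ⥤ B) [Φ.Faithful] [Φ.PreservesMonomorphisms] [Φ.PreservesZeroMorphisms] (X : A)

/-- A faithful functor that preserves monomorphisms embeds posets of subobjects. -/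
noncomputable def subobjectEmbedding : Subobject X ↪o Subobject (Φ.obj X) :=
  OrderEmbedding.ofMapLEIff (fun K => Subobject.mk (Φ.map K.arrow)) fun K L => by
    refine ⟨fun h => ?_, fun h => ?_⟩
    -- `K ≤ L` means that `K ⟶ X ⟶ X / L` vanishes, and a faithful functor reflects this vanishing.
    · refine Subobject.le_of_comm (Abelian.monoLift L.arrow K.arrow ?_)
        (Abelian.monoLift_comp _ _ _)
      refine Φ.map_injective ?_
      rw [Φ.map_comp, ← Subobject.ofMkLEMk_comp h, Category.assoc, ← Φ.map_comp,
        cokernel.condition]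
      simp
    · exact Subobject.mk_le_mk_of_comm (Φ.map (Subobject.ofLE K L h))
        (by rw [← Φ.map_comp, Subobject.ofLE_arrow])

theorem isArtinianObject_of_faithful [IsArtinianObject (Φ.obj X)] : IsArtinianObject X :=
  ⟨(subobjectEmbedding Φ X).strictMono.wellFoundedLT⟩

theorem isNoetherianObject_of_faithful [IsNoetherianObject (Φ.obj X)] : IsNoetherianObject X :=
  ⟨(subobjectEmbedding Φ X).strictMono.wellFoundedGT⟩

end FaithfulFunctors

/-! ### Projective and injective objects of an exact module category -/

section ProjectiveInjective

variable {C : Type u₁} [Category.{v₁} C] [Preadditive C] [MonoidalCategory C]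
    {M : Type u₂} [Category.{v₂} M] [Abelian M] [MonoidalLeftAction C M]
    [PreadditiveAction C M] [IsExactAction C M]

/-- Acting by `c` is left adjoint to acting by a left dual of `c`, which is exact and so preserves
epimorphisms. -/
theorem projective_action_right (c : C) (z : M) [hz : Projective z] : Projective (c ⊙ₗ z) := by
  obtain ⟨d, ⟨_⟩⟩ := IsExactAction.exists_left_dual (M := M) c
  exact (actionAdjunction M d c).map_projective z hz

/-- A monomorphism splits after acting with a projective object. -/
theorem exists_retraction_action (P : C) [hP : Projective P] {a b : M} (i : a ⟶ b) [Mono i] :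
    ∃ r : P ⊙ₗ b ⟶ P ⊙ₗ a, P ⊴ₗ i ≫ r = 𝟙 _ := by
  let S : ShortComplex M := ShortComplex.mk i (cokernel.π i) (cokernel.condition i)
  have hS : S.ShortExact := { exact := ShortComplex.exact_cokernel i }
  have hS' : (S.map (actionLeft M P)).ShortExact := hS.map_of_exact (actionLeft M P)
  have : Projective (S.map (actionLeft M P)).X₃ := IsExactAction.projective_action P _ hP
  exact ⟨_, (hS'.splittingOfProjective).f_r⟩

/-- Take `X ⊙ₗ x` with `X` a left dual of `P`. Morphisms into it from `a` are morphisms `P ⊙ₗ a ⟶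
x`, and `P ⊙ₗ -` splits monomorphisms, whence injectivity. The embedding is the transpose of the
epimorphism `P ⊙ₗ x ⟶ x`. -/
theorem exists_mono_injective (C : Type u₁) [Category.{v₁} C] [Preadditive C]
    [MonoidalCategory C] {M : Type u₂} [Category.{v₂} M] [Abelian M] [MonoidalLeftAction C M]
    [PreadditiveAction C M] [IsExactAction C M] (x : M) : ∃ (J : M) (j : x ⟶ J), Injective J ∧ Mono j := by
  obtain ⟨P, p, hP, hp⟩ := IsExactAction.exists_cover_unit (C := C) (M := M)
  obtain ⟨X, ⟨_⟩⟩ := IsExactAction.exists_left_dual (M := M) P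
  let q : P ⊙ₗ x ⟶ x := p ⊵ₗ x ≫ (λₗ[C] x).hom
  have hq : Epi q := epi_comp _ _
  refine ⟨X ⊙ₗ x, coevAct X P x ≫ X ⊴ₗ q, ⟨fun {a b} g i _ => ?_⟩,
    Preadditive.mono_of_cancel_zero _ fun {y} g hg => ?_⟩
  · obtain ⟨r, hr⟩ := exists_retraction_action P i
    refine ⟨coevAct X P b ≫ X ⊴ₗ (r ≫ P ⊴ₗ g ≫ evAct X P x), ?_⟩
    rw [coevAct_naturality_assoc, ← actionHomRight_comp, reassoc_of% hr, actionHomRight_comp,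
      ← coevAct_naturality_assoc, evAct_coevAct, Category.comp_id]
  · have h := congrArg (fun t => P ⊴ₗ t ≫ evAct X P x) hg
    simp only [actionHomRight_comp, Category.assoc, evAct_naturality, coevAct_evAct_assoc,
      Dual.actionHomRight_zero, zero_comp] at h
    have h2 : P ⊴ₗ g ≫ q = (p ⊵ₗ y ≫ (λₗ[C] y).hom) ≫ g := by
      rw [Category.assoc, MonoidalLeftAction.actionUnitIso_hom_naturality, ← action_exchange_assoc]
    have : Epi (p ⊵ₗ y ≫ (λₗ[C] y).hom) := epi_comp _ _
    rw [h2] at h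
    exact zero_of_epi_comp _ h

end ProjectiveInjective

/-! ### Finiteness of the dual category -/

namespace Dual

section Separators

variable {C : Type u₁} [Category.{v₁} C] [Preadditive C] [MonoidalCategory C]
    {M : Type u₂} [Category.{v₂} M] [Abelian M] [MonoidalLeftAction C M]
    [PreadditiveAction C M] [HasInternalHom C M] [IsExactAction C M]

/-- Lifting a morphism out of the free functor amounts to lifting its classifying `z ⟶ G y`, and
evaluation at `y` preserves epimorphisms. -/
theorem projective_free (y z : M) [Projective z] : Projective (free C y z) where
  factors {F G} f e _ := by
    have : Epi (e.nat.app y) := inferInstanceAs (Epi ((ev C M y).map e))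
    refine ⟨desc (Projective.factorThru (freeUnit C y z ≫ freeAt f y) (e.nat.app y)),
      free_hom_ext ?_⟩
    change freeUnit C y z ≫ descApp F _ y ≫ e.nat.app y = _
    rw [← Category.assoc, freeUnit_descApp, Projective.factorThru_comp]

/-- Every `n` is a quotient of a finite power of `Q`, and module functors preserve finite sums and
epimorphisms. -/
theorem eq_zero_of_separator (k : Type w) [Field k] [Linear k M]
    [∀ X Y : M, Module.Finite k (X ⟶ Y)] {Q : M} (hQ : IsSeparator Q) {F G : Dual C M}
    (α : F ⟶ G) (h : α.nat.app Q = 0) : α = 0 := by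
  have := Abelian.hasFiniteBiproducts (C := M)
  ext n
  obtain ⟨r, f, hf⟩ := exists_epi_of_isSeparator k hQ n
  have h2 : α.nat.app (⨁ fun _ : Fin r => Q) = 0 := by
    have h3 : 𝟙 (F.functor.obj (⨁ fun _ : Fin r => Q)) = ∑ j : Fin r,
        F.functor.map (biproduct.π (fun _ => Q) j) ≫ F.functor.map (biproduct.ι (fun _ => Q) j) := by
      rw [← F.functor.map_id, ← biproduct.total, F.functor.map_sum]
      simp
    rw [← Category.id_comp (α.nat.app _), h3, Preadditive.sum_comp]
    refine Finset.sum_eq_zero fun j _ => ?_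
    rw [Category.assoc, α.nat.naturality, h]
    simp
  have : Epi (F.functor.map f) := inferInstance
  rw [← cancel_epi (F.functor.map f), α.nat.naturality, h2]
  exact zero_comp.trans comp_zero.symm

theorem faithful_ev (k : Type w) [Field k] [Linear k M]
    [∀ X Y : M, Module.Finite k (X ⟶ Y)] {Q : M} (hQ : IsSeparator Q) : (ev C M Q).Faithful where
  map_injective {F G α β} h := by
    rw [← sub_eq_zero]
    refine eq_zero_of_separator k hQ _ ?_
    have : (ev C M Q).map (α - β) = 0 := by rw [Functor.map_sub, h, sub_self]
    exact this

/-- Each `g : Q ⟶ F Q` is the value on the universal element of a morphism from the free functor, so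
if all composites with `α` vanish then `α` vanishes at `Q`. -/
theorem isSeparator_free (k : Type w) [Field k] [Linear k M]
    [∀ X Y : M, Module.Finite k (X ⟶ Y)] {Q : M} (hQ : IsSeparator Q) :
    IsSeparator (free C Q Q) := by
  rw [Preadditive.isSeparator_iff]
  intro F G α h
  refine eq_zero_of_separator k hQ α ?_
  refine (Preadditive.isSeparator_iff Q).1 hQ _ fun g => ?_
  have h1 : descApp F g Q ≫ α.nat.app Q = 0 :=
    congrArg (fun β : free C Q Q ⟶ G => β.nat.app Q) (h (desc g))
  rw [← freeUnit_descApp g, Category.assoc, h1, comp_zero]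

theorem finite_hom {k : Type w} [Field k] [Linear k C] [Linear k M] [LinearAction C M k]
    [∀ X Y : M, Module.Finite k (X ⟶ Y)] {Q : M} (hQ : IsSeparator Q) (F G : Dual C M) :
    Module.Finite k (F ⟶ G) :=
  Module.Finite.of_injective
    ({ toFun := fun α => α.nat.app Q
       map_add' := fun _ _ => rfl
       map_smul' := fun _ _ => rfl } : (F ⟶ G) →ₗ[k] (F.functor.obj Q ⟶ G.functor.obj Q))
    fun _ _ h => (faithful_ev k hQ).map_injective h

/-- Projective objects of the dual category act through projective objects. -/
theorem projective_app (k : Type w) [Field k] [Linear k C] [Linear k M] [LinearAction C M k]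
    [∀ X Y : M, Module.Finite k (X ⟶ Y)] {Q : M} [Projective Q] (hQ : IsSeparator Q)
    (Φ : Dual C M) [Projective Φ] (X : M) : Projective (Φ.functor.obj X) := by
  have := Abelian.hasFiniteBiproducts (C := M)
  have := Abelian.hasFiniteBiproducts (C := Dual C M)
  have hf (F G : Dual C M) : Module.Finite k (F ⟶ G) := finite_hom hQ F G
  obtain ⟨n, f, _⟩ := exists_epi_of_isSeparator k (isSeparator_free (C := C) k hQ) Φ
  -- `Φ` is a retract of a power of `[Q, -] ⊙ₗ Q`, so its value at `X` is a retract of a power of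
  -- the projective object `[Q, X] ⊙ₗ Q`.
  have h : Projective ((ev C M X).obj (⨁ fun _ : Fin n => free C Q Q)) := by
    have h1 : Projective (⨁ fun _ : Fin n => (ev C M X).obj (free C Q Q)) :=
      have (_ : Fin n) : Projective ((ev C M X).obj (free C Q Q)) :=
        projective_action_right ((ihom C Q).obj X) Q
      projective_biproduct _
    exact Projective.of_iso ((ev C M X).mapBiproduct _).symm h1
  exact (Retract.mk ((ev C M X).map (Projective.factorThru (𝟙 Φ) f)) ((ev C M X).map f)
    (by rw [← Functor.map_comp, Projective.factorThru_comp, CategoryTheory.Functor.map_id])).projective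

end Separators

end Dual

/-! ### Existence of internal Homs -/

section HasInternalHom

theorem hasInternalHom_of_isSeparator (k : Type w) [Field k]
    {C : Type u₁} [Category.{v₁} C] [Abelian C] [MonoidalCategory C] [Linear k C]
    (M : Type u₂) [Category.{v₂} M] [Abelian M] [MonoidalLeftAction C M] [Linear k M]
    [PreadditiveAction C M] [LinearAction C M k] [IsExactAction C M]
    [∀ X Y : C, Module.Finite k (X ⟶ Y)] [∀ X Y : M, Module.Finite k (X ⟶ Y)]
    {P : C} [Projective P] (hP : IsSeparator P) : HasInternalHom C M where
  isLeftAdjoint m :=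
    have : (actionRight C m).Linear k := ⟨fun f r => LinearAction.smul_actionHomLeft r f m⟩
    isLeftAdjoint_of_isSeparator k _ hP

end HasInternalHom

/-! ### Rigidity of the dual category -/

namespace Dual

section Rigid

variable {C : Type u₁} [Category.{v₁} C] [Preadditive C] [MonoidalCategory C]
    {M : Type u₂} [Category.{v₂} M] [Abelian M] [MonoidalLeftAction C M]
    [PreadditiveAction C M]

/-- Adjoint module functors are dual to each other. -/
abbrev exactPairingOfAdjunction {F G : Dual C M} (adj : F.functor ⊣ G.functor)
    (h₁ : ∀ (c : C) (m : M), unitAt adj _ ≫ G.functor.map (δₗ F.functor c m) =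
      c ⊴ₗ unitAt adj m ≫ μₗ G.functor c (F.functor.obj m))
    (h₂ : ∀ (c : C) (n : M), F.functor.map (μₗ G.functor c n) ≫ counitAt adj _ =
      δₗ F.functor c (G.functor.obj n) ≫ c ⊴ₗ counitAt adj n) : ExactPairing G F where
  -- Since `(G ⊗ F) m` is `G (F m)`, the unit of `F ⊣ G` is a morphism from the tensor unit to `G ⊗
  -- F`.
  coevaluation' := ⟨adj.unit, fun c m => by
    change 𝟙 _ ≫ unitAt adj _ = c ⊴ₗ unitAt adj m ≫ μₗ G.functor c (F.functor.obj m) ≫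
      G.functor.map (μₗ F.functor c m)
    rw [← Category.assoc, ← h₁, Category.assoc, ← G.functor.map_comp, δₗ_comp_μₗ]
    simp⟩
  evaluation' := ⟨adj.counit, fun c n => by
    change (μₗ F.functor c (G.functor.obj n) ≫ F.functor.map (μₗ G.functor c n)) ≫
      counitAt adj _ = c ⊴ₗ counitAt adj n ≫ 𝟙 _
    rw [Category.assoc, h₂, μₗ_comp_δₗ_assoc, Category.comp_id]⟩
  coevaluation_evaluation' := by
    ext m
    change F.functor.map (unitAt adj m) ≫ 𝟙 _ ≫ counitAt adj (F.functor.obj m) = 𝟙 _ ≫ 𝟙 _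
    simp
  evaluation_coevaluation' := by
    ext m
    change unitAt adj (G.functor.obj m) ≫ 𝟙 _ ≫ G.functor.map (counitAt adj m) = 𝟙 _ ≫ 𝟙 _
    simp

variable [IsExactAction C M]

/-- The right adjoint of a module functor is lax, and right duals in `C` make that structure
invertible; unit and counit are then module morphisms. -/
theorem exists_right_adjoint (F : Dual C M) [F.functor.IsLeftAdjoint] :
    ∃ G : Dual C M, Nonempty (ExactPairing G F) := by
  let adj := Adjunction.ofIsLeftAdjoint F.functor
  let : F.functor.rightAdjoint.LaxLeftLinear C := rightAdjointLax adj
  let i : F.functor.rightAdjoint.LeftLinear C :=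
    leftLinearOfRightDuals (IsExactAction.exists_right_dual M) _
  have h := map_rightAdjointμ (C := C) adj
  exact ⟨⟨F.functor.rightAdjoint, adj.right_adjoint_additive, i⟩,
    ⟨exactPairingOfAdjunction adj (unit_linear_of_counit_linear adj h) h⟩⟩

theorem exists_left_adjoint (F : Dual C M) [F.functor.IsRightAdjoint] :
    ∃ G : Dual C M, Nonempty (ExactPairing F G) := by
  let adj := Adjunction.ofIsRightAdjoint F.functor
  let : F.functor.leftAdjoint.OplaxLeftLinear C := leftAdjointOplax adj
  let i : F.functor.leftAdjoint.LeftLinear C :=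
    leftLinearOfLeftDuals (IsExactAction.exists_left_dual M) _
  have h := leftAdjointδ_map (C := C) adj
  exact ⟨⟨F.functor.leftAdjoint, adj.left_adjoint_additive, i⟩,
    ⟨exactPairingOfAdjunction adj h (counit_linear_of_unit_linear adj h)⟩⟩

instance : MonoidalPreadditive (Dual C M) where
  whiskerLeft_zero {F _ _} := by ext m; exact F.functor.map_zero _ _
  zero_whiskerRight {F _ _} := by ext m; rfl
  whiskerLeft_add {F _ _} f g := by ext m; exact F.functor.map_add
  add_whiskerRight {F _ _} f g := by ext m; rfl

instance {k : Type w} [Field k] [Linear k C] [Linear k M] [LinearAction C M k] :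
    MonoidalLinear k (Dual C M) where
  whiskerLeft_smul F _ _ r f := by ext m; exact map_smul (C := C) F.functor r (f.nat.app m)
  smul_whiskerRight r _ _ f F := by ext m; rfl

end Rigid

end Dual

/-! ### The finite category of module functors -/

section FiniteDual

/-- The finiteness conditions on an exact module category over a finite rigid category that
are used to study the dual category. -/
class IsFiniteExactAction (k : Type w) [Field k]
    (C : Type u₁) [Category.{v₁} C] [Abelian C] [MonoidalCategory C] [Linear k C]
    (M : Type u₂) [Category.{v₂} M] [Abelian M] [MonoidalLeftAction C M] [Linear k M]
    [PreadditiveAction C M] [LinearAction C M k] : Prop extends IsExactAction C M where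
  finite_hom : ∀ X Y : C, Module.Finite k (X ⟶ Y)
  finite_hom' : ∀ X Y : M, Module.Finite k (X ⟶ Y)
  exists_separator : ∃ P : C, Projective P ∧ IsSeparator P
  exists_separator' : ∃ Q : M, Projective Q ∧ IsSeparator Q
  exists_coseparator : ∃ W : M, Injective W ∧ IsCoseparator W
  artinian : ∀ X : M, IsArtinianObject X
  noetherian : ∀ X : M, IsNoetherianObject X

variable (k : Type w) [Field k]
    (C : Type u₁) [Category.{v₁} C] [Abelian C] [MonoidalCategory C] [Linear k C]
    (M : Type u₂) [Category.{v₂} M] [Abelian M] [MonoidalLeftAction C M] [Linear k M]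
    [PreadditiveAction C M] [LinearAction C M k] [IsFiniteExactAction k C M]

include k in
theorem IsFiniteExactAction.hasInternalHom : HasInternalHom C M := by
  obtain ⟨P, _, hP⟩ := IsFiniteExactAction.exists_separator (k := k) (C := C) (M := M)
  have := IsFiniteExactAction.finite_hom (k := k) (C := C) M
  have := IsFiniteExactAction.finite_hom' (k := k) C (M := M)
  exact hasInternalHom_of_isSeparator k M hP

/-- Evaluation at a separator of `M` is faithful and exact, so chain conditions and finite
dimensionality descend from `M`. -/
theorem isLocallyFinite_dual : IsLocallyFinite (Dual C M) k := by
  have := IsFiniteExactAction.hasInternalHom k C M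
  have := IsFiniteExactAction.finite_hom' (k := k) C (M := M)
  obtain ⟨Q, _, hQ⟩ := IsFiniteExactAction.exists_separator' (k := k) (C := C) (M := M)
  have := IsFiniteExactAction.artinian k C (M := M)
  have := IsFiniteExactAction.noetherian k C (M := M)
  have := Dual.faithful_ev (C := C) k hQ
  exact ⟨isAbelian_of_abelian _, Dual.finite_hom hQ, fun F =>
    ⟨isArtinianObject_of_faithful (Dual.ev C M Q) F,
      isNoetherianObject_of_faithful (Dual.ev C M Q) F⟩⟩

include k in
theorem exists_separator_dual : ∃ P : Dual C M, Projective P ∧ IsSeparator P := by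
  have := IsFiniteExactAction.hasInternalHom k C M
  have := IsFiniteExactAction.finite_hom' (k := k) C (M := M)
  obtain ⟨Q, _, hQ⟩ := IsFiniteExactAction.exists_separator' (k := k) (C := C) (M := M)
  exact ⟨_, Dual.projective_free Q Q, Dual.isSeparator_free k hQ⟩

theorem isFiniteCategory_dual : IsFiniteCategory (Dual C M) k := by
  have h := isLocallyFinite_dual k C M
  obtain ⟨P, _, hP⟩ := exists_separator_dual k C M
  have := h.finiteDimensional_hom
  have hA (F : Dual C M) := (h.finiteLength F).1
  have := Abelian.hasFiniteBiproducts (C := Dual C M)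
  refine ⟨h, hasFinitelyManySimples_of_isSeparator hP, fun X _ => ?_⟩
  obtain ⟨n, f, _⟩ := exists_epi_of_isSeparator k hP X
  have : Projective (⨁ fun _ : Fin n => P) := projective_biproduct _
  exact exists_isProjectiveCover k f

include k in
theorem exists_left_dual_dual (F : Dual C M) : ∃ G : Dual C M, Nonempty (ExactPairing G F) := by
  have := IsFiniteExactAction.finite_hom' (k := k) C (M := M)
  obtain ⟨Q, _, hQ⟩ := IsFiniteExactAction.exists_separator' (k := k) (C := C) (M := M)
  have : F.functor.Linear k := ⟨fun f r => Dual.map_smul (C := C) F.functor r f⟩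
  have := isLeftAdjoint_of_isSeparator k F.functor hQ
  exact F.exists_right_adjoint

include k in
theorem exists_right_dual_dual (F : Dual C M) : ∃ G : Dual C M, Nonempty (ExactPairing F G) := by
  have := IsFiniteExactAction.finite_hom' (k := k) C (M := M)
  obtain ⟨W, _, hW⟩ := IsFiniteExactAction.exists_coseparator (k := k) (C := C) (M := M)
  have : F.functor.Linear k := ⟨fun f r => Dual.map_smul (C := C) F.functor r f⟩
  have := isRightAdjoint_of_isCoseparator k F.functor hW
  exact F.exists_left_adjoint

/-- This closes the loop: results for `C` now hold for the dual category, in particular the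
existence of internal Homs with values in it. -/
instance isFiniteExactAction_dual : IsFiniteExactAction k (Dual C M) M where
  exact_left F := ⟨inferInstanceAs (PreservesFiniteLimits F.functor),
    inferInstanceAs (PreservesFiniteColimits F.functor)⟩
  exact_right m := ⟨inferInstanceAs (PreservesFiniteLimits (Dual.ev C M m)),
    inferInstanceAs (PreservesFiniteColimits (Dual.ev C M m))⟩
  projective_action P X _ := by
    have := IsFiniteExactAction.hasInternalHom k C M
    have := IsFiniteExactAction.finite_hom' (k := k) C (M := M)
    obtain ⟨Q, _, hQ⟩ := IsFiniteExactAction.exists_separator' (k := k) (C := C) (M := M)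
    exact Dual.projective_app k hQ P X
  exists_left_dual := exists_left_dual_dual k C M
  exists_right_dual := exists_right_dual_dual k C M
  exists_cover_unit := by
    have := (isLocallyFinite_dual k C M).finiteDimensional_hom
    have := Abelian.hasFiniteBiproducts (C := Dual C M)
    obtain ⟨P, _, hP⟩ := exists_separator_dual k C M
    obtain ⟨n, f, _⟩ := exists_epi_of_isSeparator k hP (𝟙_ (Dual C M))
    exact ⟨_, f, projective_biproduct _, inferInstance⟩
  finite_hom := (isLocallyFinite_dual k C M).finiteDimensional_hom
  finite_hom' := IsFiniteExactAction.finite_hom' C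
  exists_separator := exists_separator_dual k C M
  exists_separator' := IsFiniteExactAction.exists_separator' k C
  exists_coseparator := IsFiniteExactAction.exists_coseparator k C
  artinian := IsFiniteExactAction.artinian k C
  noetherian := IsFiniteExactAction.noetherian k C

end FiniteDual

/-! ### The unit object of a rigid abelian category -/

section Generic

variable {A : Type u₁} [Category.{v₁} A] [Abelian A] {B : Type u₂} [Category.{v₂} B] [Abelian B]

theorem epi_map_of_isZero_cokernel (F : A ⥤ B) [F.Additive] [PreservesFiniteColimits F] {X Y : A}
    (u : X ⟶ Y) (h : IsZero (F.obj (cokernel u))) : Epi (F.map u) :=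
  Preadditive.epi_of_isZero_cokernel _ (h.of_iso (PreservesCokernel.iso F u).symm)

theorem isZero_of_bicone {n : ℕ} {e : Fin n → A} {b : Bicone e} (hb : b.IsBilimit) (F : A ⥤ B)
    [F.Additive] (h : ∀ i, IsZero (F.obj (e i))) : IsZero (F.obj b.pt) := by
  rw [IsZero.iff_id_eq_zero, ← CategoryTheory.Functor.map_id, ← IsBilimit.total hb,
    Functor.map_sum]
  refine Finset.sum_eq_zero fun i _ => ?_
  rw [F.map_comp, (h i).eq_zero_of_tgt (F.map (b.π i)), zero_comp]

/-- An object all of whose subobjects split off is a finite direct sum of simple objects. -/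
theorem exists_simple_decomposition (T : A) [IsArtinianObject T]
    (hT : ∀ {U : A} (u : U ⟶ T) [Mono u], ∃ r : T ⟶ U, u ≫ r = 𝟙 U) :
    ∃ (n : ℕ) (e : Fin n → A) (b : Bicone e), Nonempty b.IsBilimit ∧ Nonempty (b.pt ≅ T) ∧
      ∀ i, Simple (e i) := by
  -- Induction runs over the Artinian poset of subobjects of `T`, with `U` any representative. Fans
  -- replace bicones because a fan can be extended by one factor.
  suffices H : ∀ (K : Subobject T) (U : A) (u : U ⟶ T) [Mono u], Subobject.mk u = K →
      ∃ (n : ℕ) (e : Fin n → A) (f : Fan e), Nonempty (IsLimit f) ∧ Nonempty (f.pt ≅ U) ∧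
        ∀ i, Simple (e i) by
    obtain ⟨n, e, f, ⟨hf⟩, ⟨i⟩, he⟩ := H _ T (𝟙 T) rfl
    exact ⟨n, e, Bicone.ofLimitCone hf, ⟨biconeIsBilimitOfLimitConeOfIsLimit hf⟩, ⟨i⟩, he⟩
  intro K
  induction K using WellFoundedLT.induction with | _ K ih
  rintro U u _ rfl
  by_cases hU : IsZero U
  · refine ⟨0, Fin.elim0, Fan.mk 0 (fun i => i.elim0), ⟨?_⟩, ⟨(isZero_zero A).iso hU⟩,
      fun i => i.elim0⟩
    exact { lift := fun _ => 0
            fac := fun _ j => j.as.elim0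
            uniq := fun _ _ _ => (isZero_zero A).eq_of_tgt _ _ }
  · have : IsArtinianObject U := isArtinianObject_of_mono u
    obtain ⟨S, hS⟩ := exists_simple_subobject hU
    obtain ⟨r, hr⟩ := hT (S.arrow ≫ u)
    let s : ShortComplex A := ShortComplex.mk S.arrow (cokernel.π S.arrow) (cokernel.condition _)
    have hs : s.Exact := ShortComplex.exact_cokernel _
    have : Epi s.g := inferInstanceAs (Epi (cokernel.π S.arrow))
    -- A retraction of `S ⟶ T` restricts to `U`, so `S` splits off `U` with a strictly smaller
    -- complement.
    let σ : s.Splitting := ShortComplex.Splitting.ofExactOfRetraction s hs (u ≫ r)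
      (by rw [← Category.assoc]; exact hr) inferInstance
    have hσ : IsSplitMono σ.s := ⟨⟨⟨s.g, σ.s_g⟩⟩⟩
    have hmono : Mono (σ.s ≫ u) := mono_comp _ _
    obtain ⟨n, e, f, ⟨hf⟩, ⟨i⟩, he⟩ := ih (Subobject.mk (σ.s ≫ u)) (by
      refine lt_of_le_of_ne (Subobject.mk_le_mk_of_comm σ.s rfl) fun h => ?_
      have h1 : σ.s ≫ (Subobject.isoOfMkEqMk _ _ h).inv = 𝟙 _ := by
        rw [← cancel_mono (σ.s ≫ u)]
        simp
      have h2 : Epi σ.s := by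
        have : σ.s = (Subobject.isoOfMkEqMk _ _ h).hom := by
          rw [← cancel_mono (Subobject.isoOfMkEqMk _ _ h).inv, h1, Iso.hom_inv_id]
        rw [this]; infer_instance
      have h3 : σ.r = 0 := by
        rw [← cancel_epi σ.s, σ.s_r, comp_zero]
      have h4 : 𝟙 (S : A) = 0 := by
        have := σ.f_r
        rw [h3, comp_zero] at this
        exact this.symm
      exact id_nonzero _ h4) _ (σ.s ≫ u) rfl
    let c := BinaryBiproduct.bicone (S : A) f.pt
    refine ⟨n + 1, Fin.cons (S : A) e, extendFan (f := Fin.cons (S : A) e) f c.toCone,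
      ⟨extendFanIsLimit _ hf (BinaryBiproduct.isLimit _ _)⟩,
      ⟨biprod.mapIso (Iso.refl _) i ≪≫ σ.isoBinaryBiproduct.symm⟩, Fin.cases hS he⟩

end Generic

section Rigid

variable {A : Type u₁} [Category.{v₁} A] [Abelian A] [MonoidalCategory A] [MonoidalPreadditive A]

variable (A) in
/-- All objects have left and right duals. -/
class HasDuals : Prop where
  exists_left_dual : ∀ X : A, ∃ Y : A, Nonempty (ExactPairing Y X)
  exists_right_dual : ∀ X : A, ∃ Y : A, Nonempty (ExactPairing X Y)

variable [HasDuals A]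

instance (X : A) : PreservesFiniteColimits (tensorLeft X) := by
  obtain ⟨Y, ⟨_⟩⟩ := HasDuals.exists_left_dual X
  have := (tensorLeftAdjunction Y X).leftAdjoint_preservesColimits.{0, 0}
  exact PreservesColimitsOfSize.preservesFiniteColimits _

instance (X : A) : PreservesFiniteLimits (tensorLeft X) := by
  obtain ⟨Y, ⟨_⟩⟩ := HasDuals.exists_right_dual X
  have := (tensorLeftAdjunction X Y).rightAdjoint_preservesLimits.{0, 0}
  exact PreservesLimitsOfSize.preservesFiniteLimits _

instance (X : A) : PreservesFiniteColimits (tensorRight X) := by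
  obtain ⟨Y, ⟨_⟩⟩ := HasDuals.exists_right_dual X
  have := (tensorRightAdjunction X Y).leftAdjoint_preservesColimits.{0, 0}
  exact PreservesColimitsOfSize.preservesFiniteColimits _

instance (X : A) : PreservesFiniteLimits (tensorRight X) := by
  obtain ⟨Y, ⟨_⟩⟩ := HasDuals.exists_left_dual X
  have := (tensorRightAdjunction Y X).rightAdjoint_preservesLimits.{0, 0}
  exact PreservesLimitsOfSize.preservesFiniteLimits _

instance (X : A) {Y Z : A} (f : Y ⟶ Z) [Mono f] : Mono (X ◁ f) :=
  inferInstanceAs (Mono ((tensorLeft X).map f))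

instance (X : A) {Y Z : A} (f : Y ⟶ Z) [Epi f] : Epi (X ◁ f) :=
  inferInstanceAs (Epi ((tensorLeft X).map f))

instance (X : A) {Y Z : A} (f : Y ⟶ Z) [Mono f] : Mono (f ▷ X) :=
  inferInstanceAs (Mono ((tensorRight X).map f))

instance (X : A) {Y Z : A} (f : Y ⟶ Z) [Epi f] : Epi (f ▷ X) :=
  inferInstanceAs (Epi ((tensorRight X).map f))

variable {U : A} (u : U ⟶ 𝟙_ A)

/-- The left and right unitors agree on the unit object, so both composites reduce to `u ≫ v` up to
unitors. -/
theorem whiskerRight_comp_whiskerLeft_unit {V : A} {v : 𝟙_ A ⟶ V} (h : u ≫ v = 0) :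
    u ▷ 𝟙_ A ≫ 𝟙_ A ◁ v = 0 ∧ 𝟙_ A ◁ u ≫ v ▷ 𝟙_ A = 0 := by
  constructor
  · rw [MonoidalCategory.whiskerRight_id, MonoidalCategory.id_whiskerLeft,
      unitors_equal, Category.assoc, Category.assoc, Iso.inv_hom_id_assoc, reassoc_of% h]
    simp
  · rw [MonoidalCategory.whiskerRight_id, MonoidalCategory.id_whiskerLeft,
      ← unitors_equal, Category.assoc, Category.assoc, Iso.inv_hom_id_assoc, reassoc_of% h]
    simp

/-- By the exchange law, the zero morphism `u ▷ 𝟙_ A ≫ 𝟙_ A ◁ cokernel.π u` is an epimorphism onto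
this object followed by a monomorphism out of it. -/
theorem isZero_tensor_cokernel [Mono u] : IsZero (U ⊗ cokernel u) := by
  have h := (whiskerRight_comp_whiskerLeft_unit u (cokernel.condition u)).1
  rw [← whisker_exchange] at h
  have h2 : Epi (U ◁ cokernel.π u) := inferInstance
  have h1 := zero_of_epi_comp _ h
  exact IsZero.of_mono_eq_zero _ h1

theorem isZero_cokernel_tensor [Mono u] : IsZero (cokernel u ⊗ U) := by
  have h := (whiskerRight_comp_whiskerLeft_unit u (cokernel.condition u)).2
  rw [whisker_exchange] at h
  have h2 : Epi (cokernel.π u ▷ U) := inferInstance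
  have h1 := zero_of_epi_comp _ h
  exact IsZero.of_mono_eq_zero _ h1

/-- The unit object of a rigid abelian category is semisimple. -/
theorem exists_retraction_of_mono_unit [Mono u] : ∃ r : 𝟙_ A ⟶ U, u ≫ r = 𝟙 U := by
  obtain ⟨D, ⟨_⟩⟩ := HasDuals.exists_left_dual U
  have hVU := isZero_cokernel_tensor u
  have hUV := isZero_tensor_cokernel u
  -- Write `V` for the cokernel. A morphism `U ⊗ (D ⊗ V) ⟶ V` is forced through `U ⊗ V = 0` after an
  -- epimorphism, hence is zero; by adjunction so is the identity of `D ⊗ V`.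
  have hDV : IsZero (D ⊗ cokernel u) := by
    have h0 : ∀ f : U ⊗ (D ⊗ cokernel u) ⟶ cokernel u, f = 0 := fun f => by
      have : Epi (u ▷ (U ⊗ (D ⊗ cokernel u))) := by
        refine epi_map_of_isZero_cokernel (tensorRight (U ⊗ (D ⊗ cokernel u))) u ?_
        refine IsZero.of_iso ?_ (α_ _ _ _).symm
        exact (tensorRight (D ⊗ cokernel u)).map_isZero hVU
      have h := whisker_exchange u f
      rw [hUV.eq_zero_of_tgt (U ◁ f), zero_comp] at h
      have h2 := zero_of_epi_comp _ h.symm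
      rw [MonoidalCategory.id_whiskerLeft] at h2
      simpa using h2
    rw [IsZero.iff_id_eq_zero]
    exact ((tensorLeftAdjunction D U).homEquiv _ _).symm.injective ((h0 _).trans (h0 _).symm)
  -- `t` is the dual of `u`. Once `u ≫ t : U ⟶ D` is known to be an isomorphism, its inverse after
  -- `t` is the retraction.
  let t : 𝟙_ A ⟶ D := η_ D U ≫ D ◁ u ≫ (ρ_ D).hom
  have ht : U ◁ t ≫ ε_ D U = (ρ_ U).hom ≫ u := by
    have h : U ◁ (D ◁ u ≫ (ρ_ D).hom) ≫ ε_ D U =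
        (α_ U D U).inv ≫ ε_ D U ▷ U ≫ (λ_ U).hom ≫ u := by
      rw [← leftUnitor_naturality, ← whisker_exchange_assoc, unitors_equal,
        rightUnitor_naturality]
      simp
    rw [MonoidalCategory.whiskerLeft_comp, Category.assoc, h,
      ExactPairing.coevaluation_evaluation_assoc, Iso.inv_hom_id_assoc]
  have hm : Mono (U ◁ t) := mono_of_mono_fac ht
  have he : Epi t := Preadditive.epi_of_cancel_zero _ fun {Q} f hf => by
    have h1 : η_ D U ≫ f ▷ U = 0 := by
      have h3 : (η_ D U ≫ f ▷ U) ≫ Q ◁ u ≫ (ρ_ Q).hom = 0 := by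
        rw [Category.assoc, ← whisker_exchange_assoc, rightUnitor_naturality]
        simpa [t] using hf
      exact zero_of_comp_mono _ h3
    have h2 : (η_ D U ≫ f ▷ U) ▷ D ≫ (α_ _ _ _).hom ≫ Q ◁ ε_ D U =
        (λ_ D).hom ≫ f ≫ (ρ_ Q).inv := by
      rw [comp_whiskerRight, Category.assoc, associator_naturality_left_assoc, ← whisker_exchange,
        ExactPairing.evaluation_coevaluation_assoc]
      simp
    rw [h1, MonoidalPreadditive.zero_whiskerRight, zero_comp] at h2
    simpa using h2.symm
  -- Let `N` be the kernel. `U ⊗ N ⟶ U ⊗ U` is zero because `U ◁ u ≫ U ◁ t` is mono, and `u ▷ N` is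
  -- epi because `V ⊗ N` embeds in `V ⊗ U = 0`; exchange gives `N ⟶ U` zero.
  have hmw : Mono (u ≫ t) := by
    refine Preadditive.mono_of_kernel_zero ?_
    have h1 : U ◁ kernel.ι (u ≫ t) = 0 := by
      have h3 : U ◁ kernel.ι (u ≫ t) ≫ U ◁ u ≫ U ◁ t = 0 := by
        rw [← MonoidalCategory.whiskerLeft_comp, ← MonoidalCategory.whiskerLeft_comp,
          kernel.condition, MonoidalPreadditive.whiskerLeft_zero]
      exact zero_of_comp_mono _ h3
    have : Epi (u ▷ kernel (u ≫ t)) :=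
      epi_map_of_isZero_cokernel (tensorRight (kernel (u ≫ t))) u
        (IsZero.of_mono (cokernel u ◁ kernel.ι (u ≫ t)) hVU)
    have h := whisker_exchange u (kernel.ι (u ≫ t))
    rw [h1, zero_comp] at h
    have h2 := zero_of_epi_comp _ h.symm
    rw [MonoidalCategory.id_whiskerLeft] at h2
    simpa using h2
  -- The cokernel `W` is a quotient of `D`, so `W ⊗ V = 0` and `W ⊗ U ⟶ W` is epi; it is also a
  -- quotient of `V`, so `W ⊗ U = 0`.
  have hew : Epi (u ≫ t) := by
    let q := cokernel.π (u ≫ t)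
    let q' : cokernel u ⟶ cokernel (u ≫ t) :=
      cokernel.desc u (t ≫ q) ((Category.assoc _ _ _).symm.trans (cokernel.condition _))
    have hq' : Epi q' := epi_of_epi_fac (cokernel.π_desc u _ _)
    have : Epi (cokernel (u ≫ t) ◁ u) :=
      epi_map_of_isZero_cokernel (tensorLeft (cokernel (u ≫ t))) u
        (IsZero.of_epi (q ▷ cokernel u) hDV)
    have h1 : IsZero (cokernel (u ≫ t) ⊗ U) := IsZero.of_epi (q' ▷ U) hVU
    have h2 : IsZero (cokernel (u ≫ t)) :=
      (IsZero.of_epi (cokernel (u ≫ t) ◁ u) h1).of_iso (ρ_ _).symm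
    exact Preadditive.epi_of_isZero_cokernel _ h2
  have : IsIso (u ≫ t) := isIso_of_mono_of_epi _
  exact ⟨t ≫ inv (u ≫ t), by rw [← Category.assoc, IsIso.hom_inv_id]⟩

theorem exists_simple_decomposition_unit [IsArtinianObject (𝟙_ A)] :
    ∃ (n : ℕ) (e : Fin n → A) (b : Bicone e), Nonempty b.IsBilimit ∧ Nonempty (b.pt ≅ 𝟙_ A) ∧
      ∀ i, Simple (e i) :=
  exists_simple_decomposition _ fun u _ => exists_retraction_of_mono_unit u

end Rigid

/-! ### Faithfulness of the action of an indecomposable category -/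

section Faithful

variable {C : Type u₁} [Category.{v₁} C] [Abelian C] [MonoidalCategory C] [MonoidalPreadditive C]

/-- If this morphism to a simple object were zero, a zigzag identity tensored with `e` would make
the identity of `X ⊗ e` zero. -/
theorem epi_evaluation_whiskerRight {X Y e : C} [ExactPairing X Y] [Simple e]
    (h : ¬ IsZero (X ⊗ e)) : Epi (ε_ X Y ▷ e ≫ (λ_ e).hom) := by
  refine epi_of_nonzero_to_simple fun h0 => h ?_
  have h1 : ε_ X Y ▷ e = 0 := zero_of_comp_mono _ h0
  have h2 := congrArg (· ▷ e) (ExactPairing.evaluation_coevaluation X Y)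
  simp only [comp_whiskerRight, whisker_assoc, h1, MonoidalPreadditive.whiskerLeft_zero,
    zero_comp, comp_zero] at h2
  rw [IsZero.iff_id_eq_zero, ← cancel_epi ((λ_ X).hom ▷ e), ← cancel_mono ((ρ_ X).inv ▷ e)]
  simpa using h2.symm

variable {M : Type u₂} [Category.{v₂} M] [Abelian M] [MonoidalLeftAction C M]
    [PreadditiveAction C M] [IsExactAction C M]

/-- With `Y` the right dual of `X`, `e` is a quotient of `(Y ⊗ X) ⊗ e`, so this object is a quotient
of `Y ⊙ₗ X ⊙ₗ (e ⊗ Z) ⊙ₗ y`, which vanishes. -/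
theorem isZero_simple_action {X e : C} [Simple e] {y : M} (hX : ∀ Z : C, IsZero (X ⊙ₗ Z ⊙ₗ y))
    (h : ¬ IsZero (X ⊗ e)) (Z : C) : IsZero (e ⊙ₗ Z ⊙ₗ y) := by
  obtain ⟨Y, ⟨_⟩⟩ := IsExactAction.exists_right_dual M X
  have := epi_evaluation_whiskerRight (Y := Y) h
  refine IsZero.of_epi ((ε_ X Y ▷ e ≫ (λ_ e).hom) ⊵ₗ (Z ⊙ₗ y)) ?_
  have h1 : IsZero (X ⊙ₗ e ⊙ₗ Z ⊙ₗ y) :=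
    (hX (e ⊗ Z)).of_iso ((actionLeft M X).mapIso (αₗ e Z y).symm)
  exact ((actionLeft M Y).map_isZero h1).of_iso (αₗ (Y ⊗ X) e (Z ⊙ₗ y) ≪≫ αₗ Y X _)

/-- An indecomposable multi-tensor category acts faithfully. -/
theorem exists_action_ne_zero (hC : HasIndecomposableSemisimpleUnit C) {X : C} {y : M}
    (hX : ¬ IsZero X) (hy : ¬ IsZero y) : ∃ Z : C, ¬ IsZero (X ⊙ₗ Z ⊙ₗ y) := by
  by_contra! h
  obtain ⟨n, e, b, ⟨hb⟩, ⟨i⟩, he, hW⟩ := hC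
  -- Vanishing spreads from `X` to a summand `e j` with `X ⊗ e j` nonzero, then through nonzero `e j
  -- ⊗ W ⊗ e l` to every summand of the unit, and so to `y`.
  obtain ⟨j, hj⟩ : ∃ j, ¬ IsZero (X ⊗ e j) := by
    by_contra! h0
    exact hX ((isZero_of_bicone hb (tensorLeft X) h0).of_iso
      ((ρ_ X).symm ≪≫ (tensorLeft X).mapIso i.symm))
  have := he j
  have hj' := isZero_simple_action h hj
  have hl (l : Fin n) : IsZero (e l ⊙ₗ y) := by
    obtain ⟨W, hW⟩ := hW j l
    have := he l
    have h1 : ∀ Z : C, IsZero ((e j ⊗ W) ⊙ₗ Z ⊙ₗ y) := fun Z =>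
      (hj' (W ⊗ Z)).of_iso (αₗ (e j) W (Z ⊙ₗ y) ≪≫ (actionLeft M (e j)).mapIso (αₗ W Z y).symm)
    have h2 := isZero_simple_action h1 (e := e l) (fun h0 => hW (h0.of_iso (α_ _ _ _).symm)) (𝟙_ C)
    exact h2.of_iso ((actionLeft M (e l)).mapIso (λₗ[C] y).symm)
  exact hy ((isZero_of_bicone hb (actionRight C y) hl).of_iso
    ((λₗ[C] y).symm ≪≫ (actionRight C y).mapIso i.symm))

end Faithful

/-! ### The unit object of the dual category -/

namespace Dual

section Unit

variable {C : Type u₁} [Category.{v₁} C] [Abelian C] [MonoidalCategory C]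
    {M : Type u₂} [Category.{v₂} M] [Abelian M] [MonoidalLeftAction C M]
    [PreadditiveAction C M] [IsExactAction C M]

theorem isZero_of_isZero_obj {F : Dual C M} (h : ∀ m, IsZero (F.functor.obj m)) : IsZero F := by
  rw [IsZero.iff_id_eq_zero]
  ext m
  exact (h m).eq_of_src _ _

theorem isZero_obj {F : Dual C M} (h : IsZero F) (m : M) : IsZero (F.functor.obj m) :=
  (ev C M m).map_isZero h

/-- The structure isomorphism of a module functor. -/
@[simps]
def actionIso (F : Dual C M) (c : C) (m : M) :
    c ⊙ₗ F.functor.obj m ≅ F.functor.obj (c ⊙ₗ m) where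
  hom := μₗ F.functor c m
  inv := δₗ F.functor c m

theorem not_isZero_ihom [HasInternalHom C M] {w : M} (hw : ¬ IsZero w) :
    ¬ IsZero ((ihom C w).obj w) := fun h => hw <| by
  have h1 := ihomName_ihomEv C (𝟙 w)
  have h2 : IsZero ((ihom C w).obj w ⊙ₗ w) := (actionRight C w).map_isZero h
  rw [Category.comp_id, h2.eq_zero_of_src (ihomEv C w w), comp_zero] at h1
  rw [IsZero.iff_id_eq_zero, ← cancel_epi (λₗ[C] w).hom, ← h1, zero_comp, zero_comp]

/-- The decomposition needs only rigidity and an Artinian unit. To connect `e i` and `e j`, insert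
the free functor on `e j w` and `Z ⊙ₗ z`: at `w` the result is `[e j w, e j w] ⊙ₗ Z ⊙ₗ e i z` up to
isomorphism, which is nonzero for a suitable `Z`. -/
theorem hasIndecomposableSemisimpleUnit [MonoidalPreadditive C] [HasInternalHom C M]
    [HasDuals (Dual C M)]
    [IsArtinianObject (𝟙_ (Dual C M))] (hC : HasIndecomposableSemisimpleUnit C) :
    HasIndecomposableSemisimpleUnit (Dual C M) := by
  obtain ⟨n, e, b, hb, hi, he⟩ := exists_simple_decomposition_unit (A := Dual C M)
  have hz (i : Fin n) : ∃ z : M, ¬ IsZero ((e i).functor.obj z) := by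
    by_contra! h
    have := he i
    exact Simple.not_isZero (e i) (isZero_of_isZero_obj h)
  refine ⟨n, e, b, hb, hi, he, fun i j => ?_⟩
  obtain ⟨z, hz₁⟩ := hz i
  obtain ⟨w, hw⟩ := hz j
  obtain ⟨Z, hZ⟩ := exists_action_ne_zero hC (not_isZero_ihom (C := C) hw) hz₁
  refine ⟨free C ((e j).functor.obj w) (Z ⊙ₗ z), fun h => hZ ?_⟩
  exact (isZero_obj h w).of_iso ((actionLeft M _).mapIso (actionIso (e i) Z z) ≪≫
    actionIso (e i) _ (Z ⊙ₗ z))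

/-- If the module category is indecomposable, the unit of the dual category is simple. -/
theorem simple_unit [HasDuals (Dual C M)] (hM : IsIndecomposableModule C M) :
    Simple (𝟙_ (Dual C M)) where
  mono_isIso_iff_nonzero {U} f _ := by
    obtain ⟨⟨m₀, hm₀⟩, hM⟩ := hM
    refine ⟨fun _ hf => hm₀ ?_, fun hf => ?_⟩
    · have h1 : IsZero (𝟙_ (Dual C M)) := by
        rw [IsZero.iff_id_eq_zero, ← IsIso.inv_hom_id f]
        exact (congrArg (inv f ≫ ·) hf).trans comp_zero
      exact isZero_obj h1 m₀
    · obtain ⟨r, hr⟩ := exists_retraction_of_mono_unit f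
      obtain ⟨s, hs⟩ : ∃ s : cokernel f ⟶ 𝟙_ (Dual C M), cokernel.π f ≫ s = 𝟙 _ - r ≫ f :=
        ⟨cokernel.desc f (𝟙 _ - r ≫ f) (by simp [reassoc_of% hr]), cokernel.π_desc _ _ _⟩
      have hs' : s ≫ cokernel.π f = 𝟙 _ := by
        rw [← cancel_epi (cokernel.π f), reassoc_of% hs]
        simp
      let V := cokernel f
      let fa (X : M) : U.functor.obj X ⟶ X := f.nat.app X
      let ra (X : M) : X ⟶ U.functor.obj X := r.nat.app X
      let va (X : M) : X ⟶ V.functor.obj X := (cokernel.π f).nat.app X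
      let sa (X : M) : V.functor.obj X ⟶ X := s.nat.app X
      have hfa {X Y : M} (g : X ⟶ Y) : U.functor.map g ≫ fa Y = fa X ≫ g := f.nat.naturality g
      have hsa {X Y : M} (g : X ⟶ Y) : V.functor.map g ≫ sa Y = sa X ≫ g := s.nat.naturality g
      have hfr (X : M) : fa X ≫ ra X = 𝟙 _ := congrArg (fun t : U ⟶ U => t.nat.app X) hr
      have hsv (X : M) : sa X ≫ va X = 𝟙 _ := congrArg (fun t : V ⟶ V => t.nat.app X) hs'
      have htot (X : M) : ra X ≫ fa X + va X ≫ sa X = 𝟙 _ :=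
        congrArg (fun t : 𝟙_ (Dual C M) ⟶ 𝟙_ _ => t.nat.app X)
          (show r ≫ f + cokernel.π f ≫ s = 𝟙 _ by rw [hs]; abel)
      have hfv (X : M) : fa X ≫ va X = 0 :=
        congrArg (fun t : U ⟶ V => t.nat.app X) (cokernel.condition f)
      have hsr (X : M) : sa X ≫ ra X = 0 := by
        have h := congrArg (sa X ≫ · ≫ ra X) (htot X)
        simp only [Preadditive.add_comp, Preadditive.comp_add, Category.assoc, hfr,
          reassoc_of% (hsv X)] at h
        simpa using h
      -- The unit is `U ⊕ V`. The objects killed by `V` and those killed by `U` decompose `M`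
      -- through `Z ≅ U Z ⊕ V Z`, because `V ⊗ U` and `U ⊗ V` vanish.
      have key := hM (fun X => IsZero (V.functor.obj X)) (fun X => IsZero (U.functor.obj X))
        ⟨fun i h => h.of_iso (V.functor.mapIso i.symm)⟩
        ⟨fun i h => h.of_iso (U.functor.mapIso i.symm)⟩
        (fun c X h => ((actionLeft M c).map_isZero h).of_iso (actionIso V c X).symm)
        (fun c X h => ((actionLeft M c).map_isZero h).of_iso (actionIso U c X).symm)
        (fun X Y hX hY => ⟨fun g => by
          rw [← Category.id_comp g, ← htot X, Preadditive.add_comp, Category.assoc, ← hfa,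
            IsZero.eq_zero_of_tgt hY (U.functor.map g), IsZero.eq_zero_of_tgt hX (va X)]
          simp, fun g => by
          rw [← Category.id_comp g, ← htot Y, Preadditive.add_comp, Category.assoc, Category.assoc,
            ← hsa, IsZero.eq_zero_of_tgt hY (ra Y), IsZero.eq_zero_of_tgt hX (V.functor.map g)]
          simp⟩)
        (fun Z => ⟨U.functor.obj Z, V.functor.obj Z,
          { pt := Z
            fst := ra Z
            snd := va Z
            inl := fa Z
            inr := sa Z
            inl_fst := hfr Z
            inl_snd := hfv Z
            inr_fst := hsr Z
            inr_snd := hsv Z }, isZero_obj (isZero_cokernel_tensor f) Z,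
          isZero_obj (isZero_tensor_cokernel f) Z, ⟨isBinaryBilimitOfTotal _ (htot Z)⟩,
          ⟨Iso.refl _⟩⟩)
      rcases key with h | h
      · refine absurd ?_ hf
        exact (isZero_of_isZero_obj fun Z =>
          h _ (isZero_obj (isZero_cokernel_tensor f) Z)).eq_zero_of_src f
      · have : Epi f := Preadditive.epi_of_isZero_cokernel _ (isZero_of_isZero_obj fun Z =>
          h _ (isZero_obj (isZero_tensor_cokernel f) Z))
        exact isIso_of_mono_of_epi f

end Unit

end Dual

/-! ### Morphisms into the double dual -/

section DoubleDual

variable {C : Type u₁} [Category.{v₁} C] [Abelian C] [MonoidalCategory C]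
    {M : Type u₂} [Category.{v₂} M] [Abelian M] [MonoidalLeftAction C M]
    [PreadditiveAction C M] [HasInternalHom C M] [IsExactAction C M]

namespace Dual

/-- Functoriality of `[y, -] ⊙ₗ z` in `z`. -/
noncomputable def freeMap (y : M) {z z' : M} (h : z ⟶ z') : free C y z ⟶ free C y z' where
  nat :=
    { app p := (ihom C y).obj p ⊴ₗ h
      naturality _ _ f := (action_exchange ((ihom C y).map f) h).symm }
  comm c p := by
    change freeμ y z c p ≫ (ihom C y).obj (c ⊙ₗ p) ⊴ₗ h =
      c ⊴ₗ (ihom C y).obj p ⊴ₗ h ≫ freeμ y z' c p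
    rw [freeμ, freeμ, Category.assoc, ← action_exchange,
      MonoidalLeftAction.tensor_actionHomRight]
    simp

variable (C) in
/-- The evaluation of the internal Hom as a morphism of module functors. -/
noncomputable def freeEv (y : M) : free C y y ⟶ 𝟙_ (Dual C M) where
  nat :=
    { app p := ihomEv C y p
      naturality _ _ f := ihomEv_naturality C y f }
  comm c p := by
    change freeμ y y c p ≫ ihomEv C y (c ⊙ₗ p) = c ⊴ₗ ihomEv C y p ≫ 𝟙 _
    rw [freeμ, Category.assoc, ihomμ_ihomEv, Iso.inv_hom_id_assoc, Category.comp_id]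

/-- Module functors commute with the functors `[y, -] ⊙ₗ z`. -/
noncomputable def freeComp (F : Dual C M) (y z : M) :
    free C y (F.functor.obj z) ⟶ F ⊗ free C y z where
  nat :=
    { app p := μₗ F.functor ((ihom C y).obj p) z
      naturality _ _ f := μₗ_naturality_left F.functor ((ihom C y).map f) z }
  comm c p := by
    change freeμ y (F.functor.obj z) c p ≫ μₗ F.functor ((ihom C y).obj (c ⊙ₗ p)) z =
      c ⊴ₗ μₗ F.functor ((ihom C y).obj p) z ≫
        μₗ F.functor c ((ihom C y).obj p ⊙ₗ z) ≫ F.functor.map (freeμ y z c p)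
    rw [freeμ, freeμ, Category.assoc, μₗ_naturality_left, F.functor.map_comp,
      ← cancel_epi (αₗ c ((ihom C y).obj p) (F.functor.obj z)).hom, Iso.hom_inv_id_assoc,
      ← μₗ_associativity_assoc, ← F.functor.map_comp_assoc, Iso.hom_inv_id]
    simp

variable (G : Dual (Dual C M) M)

/-- The structure morphism of an object of the double dual at `[y, -] ⊙ₗ z`. -/
noncomputable def freeStr (y z p : M) :
    (ihom C y).obj (G.functor.obj p) ⊙ₗ z ⟶ G.functor.obj ((ihom C y).obj p ⊙ₗ z) :=
  μₗ G.functor (free C y z) p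

theorem freeStr_naturality (y : M) {z z' : M} (h : z ⟶ z') (p : M) :
    (ihom C y).obj (G.functor.obj p) ⊴ₗ h ≫ freeStr G y z' p =
      freeStr G y z p ≫ G.functor.map ((ihom C y).obj p ⊴ₗ h) :=
  μₗ_naturality_left G.functor (freeMap y h) p

theorem freeStr_naturality_assoc (y : M) {z z' : M} (h : z ⟶ z') (p : M) {t : M}
    (h' : G.functor.obj ((ihom C y).obj p ⊙ₗ z') ⟶ t) :
    (ihom C y).obj (G.functor.obj p) ⊴ₗ h ≫ freeStr G y z' p ≫ h' =
      freeStr G y z p ≫ G.functor.map ((ihom C y).obj p ⊴ₗ h) ≫ h' := by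
  rw [← Category.assoc, freeStr_naturality, Category.assoc]

/-- The structure of `G` is natural along the module morphism `freeEv` to the unit, where that
structure is the identity. -/
theorem freeStr_ihomEv (y p : M) :
    freeStr G y y p ≫ G.functor.map (ihomEv C y p) = ihomEv C y (G.functor.obj p) := by
  have h1 := μₗ_naturality_left G.functor (freeEv C y) p
  have h2 := μₗ_unitality (C := Dual C M) G.functor p
  have h3 : 𝟙 (G.functor.obj p) = μₗ G.functor (𝟙_ (Dual C M)) p ≫ G.functor.map (𝟙 p) := h2
  have h4 : μₗ G.functor (𝟙_ (Dual C M)) p = 𝟙 (G.functor.obj p) :=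
    (Category.comp_id _).symm.trans
      ((congrArg (μₗ G.functor (𝟙_ (Dual C M)) p ≫ ·) (G.functor.map_id p).symm).trans h3.symm)
  refine h1.symm.trans ?_
  rw [h4]
  exact Category.comp_id _

/-- Naturality along `freeComp` combined with associativity of the structure of `G`; the
associativity constraint of the evaluation action is the identity. -/
theorem freeStr_freeComp (F : Dual C M) (y z p : M) :
    μₗ F.functor ((ihom C y).obj (G.functor.obj p)) z ≫ F.functor.map (freeStr G y z p) ≫
        (show F.functor.obj (G.functor.obj ((ihom C y).obj p ⊙ₗ z)) ⟶
            G.functor.obj (F.functor.obj ((ihom C y).obj p ⊙ₗ z)) from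
          μₗ G.functor F ((ihom C y).obj p ⊙ₗ z)) =
      freeStr G y (F.functor.obj z) p ≫
        G.functor.map (μₗ F.functor ((ihom C y).obj p) z) := by
  have h1 := μₗ_naturality_left G.functor (freeComp F y z) p
  have h2 := μₗ_associativity G.functor F (free C y z) p
  have h3 : μₗ G.functor (F ⊗ free C y z) p ≫ G.functor.map (𝟙 _) =
    𝟙 _ ≫ F.functor.map (freeStr G y z p) ≫ μₗ G.functor F ((ihom C y).obj p ⊙ₗ z) := h2
  rw [CategoryTheory.Functor.map_id] at h3
  have h4 := (Category.comp_id _).symm.trans (h3.trans (Category.id_comp _))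
  refine Eq.trans ?_ h1
  exact congrArg (μₗ F.functor ((ihom C y).obj (G.functor.obj p)) z ≫ ·) h4.symm

/-- The morphism `w ⟶ [y, n] ⊙ₗ w` defined by a morphism `y ⟶ n`. -/
noncomputable def nameAct {y n : M} (g : y ⟶ n) (w : M) : w ⟶ (ihom C y).obj n ⊙ₗ w :=
  (λₗ[C] w).inv ≫ ihomName C g ⊵ₗ w

theorem nameAct_naturality {y n : M} (g : y ⟶ n) {w w' : M} (h : w ⟶ w') :
    nameAct (C := C) g w ≫ (ihom C y).obj n ⊴ₗ h = h ≫ nameAct g w' := by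
  rw [nameAct, nameAct, Category.assoc, ← action_exchange,
    MonoidalLeftAction.unit_actionHomRight]
  simp

theorem nameAct_naturality_assoc {y n : M} (g : y ⟶ n) {w w' : M} (h : w ⟶ w') {t : M}
    (h' : (ihom C y).obj n ⊙ₗ w' ⟶ t) :
    nameAct (C := C) g w ≫ (ihom C y).obj n ⊴ₗ h ≫ h' = h ≫ nameAct g w' ≫ h' := by
  rw [← Category.assoc, nameAct_naturality, Category.assoc]

theorem nameAct_map {y n n' : M} (g : y ⟶ n) (f : n ⟶ n') (w : M) :
    nameAct (C := C) g w ≫ (ihom C y).map f ⊵ₗ w = nameAct (g ≫ f) w := by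
  rw [nameAct, nameAct, Category.assoc, ← MonoidalLeftAction.comp_actionHomLeft, ihomName_map]

theorem nameAct_ihomEv {y n : M} (g : y ⟶ n) : nameAct (C := C) g y ≫ ihomEv C y n = g := by
  rw [nameAct, Category.assoc, ihomName_ihomEv, Iso.inv_hom_id_assoc]

theorem map_nameAct (F : Dual C M) {y n : M} (g : y ⟶ n) (w : M) :
    nameAct g (F.functor.obj w) ≫ μₗ F.functor ((ihom C y).obj n) w =
      F.functor.map (nameAct g w) := by
  rw [nameAct, nameAct, Category.assoc, μₗ_naturality_left, F.functor.map_comp,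
    μₗ_unitality_inv_assoc]

/-! ### Morphisms out of `x ⊙ₗ -` for a left dual `x` of `[y, m]`. -/

section Canonical

variable (x : C) (y m : M) [ExactPairing x ((ihom C y).obj m)]

/-- The universal element `y ⟶ x ⊙ₗ m` for a left dual `x` of `[y, m]`. -/
noncomputable def canUnit : y ⟶ x ⊙ₗ m :=
  coevAct x ((ihom C y).obj m) y ≫ x ⊴ₗ ihomEv C y m

theorem ihomName_canUnit :
    ihomName C (canUnit x y m) = η_ x ((ihom C y).obj m) ≫ ihomμ C y x m := by
  apply ihom_hom_ext
  rw [ihomName_ihomEv, MonoidalLeftAction.comp_actionHomLeft, Category.assoc, ihomμ_ihomEv,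
    canUnit, coevAct]
  simp

theorem nameAct_canUnit (w : M) : nameAct (canUnit x y m) w =
    coevAct x ((ihom C y).obj m) w ≫ freeμ y w x m := by
  rw [nameAct, ihomName_canUnit, MonoidalLeftAction.comp_actionHomLeft, coevAct, freeμ]
  simp

variable {y m} (g : y ⟶ G.functor.obj m)

/-- The components of the morphism `x ⊙ₗ - ⟶ G` classified by `g : y ⟶ G m`. -/
noncomputable def canDescApp (n : M) : x ⊙ₗ n ⟶ G.functor.obj n :=
  nameAct g (x ⊙ₗ n) ≫ freeStr G y (x ⊙ₗ n) m ≫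
    G.functor.map (evAct x ((ihom C y).obj m) n)

theorem canDescApp_naturality {n n' : M} (f : n ⟶ n') :
    x ⊴ₗ f ≫ canDescApp G x g n' = canDescApp G x g n ≫ G.functor.map f := by
  rw [canDescApp, canDescApp, ← nameAct_naturality_assoc, freeStr_naturality_assoc,
    ← G.functor.map_comp, evAct_naturality, G.functor.map_comp]
  simp

/-- `F` moves past each of the three factors: names by `map_nameAct`, the structure of `G` at free
functors by `freeStr_freeComp`, and the evaluation of the pairing by `evAct_lax`. -/
theorem canDescApp_linear (F : Dual C M) (n : M) :
    δₗ F.functor x n ≫ canDescApp G x g (F.functor.obj n) =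
      F.functor.map (canDescApp G x g n) ≫
        (show F.functor.obj (G.functor.obj n) ⟶ G.functor.obj (F.functor.obj n) from
          μₗ G.functor F n) := by
  have h1 : F.functor.map (G.functor.map (evAct x ((ihom C y).obj m) n)) ≫
      (show F.functor.obj (G.functor.obj n) ⟶ G.functor.obj (F.functor.obj n) from
          μₗ G.functor F n) =
      (show F.functor.obj (G.functor.obj _) ⟶ G.functor.obj (F.functor.obj _) from
          μₗ G.functor F _) ≫ G.functor.map (F.functor.map (evAct x ((ihom C y).obj m) n)) :=
    μₗ_naturality_right G.functor F (evAct x ((ihom C y).obj m) n)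
  have h2 : (ihom C y).obj m ⊴ₗ δₗ F.functor x n ≫
        evAct x ((ihom C y).obj m) (F.functor.obj n) =
      μₗ F.functor ((ihom C y).obj m) (x ⊙ₗ n) ≫
        F.functor.map (evAct x ((ihom C y).obj m) n) := by
    rw [← evAct_lax, ← actionHomRight_comp_assoc, δₗ_comp_μₗ,
      MonoidalLeftAction.actionHomRight_id, Category.id_comp]
  rw [canDescApp, canDescApp, F.functor.map_comp, F.functor.map_comp, Category.assoc,
    Category.assoc, h1, ← map_nameAct, Category.assoc,
    reassoc_of% (freeStr_freeComp G F y (x ⊙ₗ n) m),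
    ← nameAct_naturality_assoc, freeStr_naturality_assoc, ← G.functor.map_comp,
    ← G.functor.map_comp, h2]

/-- The morphism `x ⊙ₗ - ⟶ G` classified by `g : y ⟶ G m`. -/
noncomputable def canDesc : (can C M).obj x ⟶ G where
  nat :=
    { app n := canDescApp G x g n
      naturality _ _ f := canDescApp_naturality G x g f }
  comm F n := canDescApp_linear G x g F n

/-- The universal element turns the evaluation of the pairing into that of the internal Hom, where
`freeStr_ihomEv` applies; what remains is evaluating the name of `g`. -/
theorem canUnit_canDescApp : canUnit x y m ≫ canDescApp G x g m = g := by
  have h : (ihom C y).obj m ⊴ₗ canUnit x y m ≫ evAct x ((ihom C y).obj m) m = ihomEv C y m := by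
    rw [canUnit, actionHomRight_comp, Category.assoc, evAct_naturality, coevAct_evAct_assoc]
  rw [canDescApp, ← nameAct_naturality_assoc, freeStr_naturality_assoc, ← G.functor.map_comp, h,
    freeStr_ihomEv, nameAct_ihomEv]

/-- The components of a morphism `x ⊙ₗ - ⟶ G`. -/
def canAt {x : C} {G : Dual (Dual C M) M} (β : (can C M).obj x ⟶ G) (n : M) :
    x ⊙ₗ n ⟶ G.functor.obj n := β.nat.app n

theorem canAt_naturality {x : C} {G : Dual (Dual C M) M} (β : (can C M).obj x ⟶ G) {n n' : M}
    (f : n ⟶ n') : x ⊴ₗ f ≫ canAt β n' = canAt β n ≫ G.functor.map f :=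
  β.nat.naturality f

/-- Uniqueness half of the universal property: linearity of `β` at the free functor `[y, -] ⊙ₗ (x ⊙ₗ
n)` determines its component at `n` from that at `m`. -/
theorem canAt_eq (y m : M) [ExactPairing x ((ihom C y).obj m)] (β : (can C M).obj x ⟶ G) (n : M) :
    canAt β n = canDescApp G x (canUnit x y m ≫ canAt β m) n := by
  have h : freeδ y (x ⊙ₗ n) x m ≫ canAt β ((ihom C y).obj m ⊙ₗ x ⊙ₗ n) =
      (ihom C y).map (canAt β m) ⊵ₗ (x ⊙ₗ n) ≫ freeStr G y (x ⊙ₗ n) m :=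
    β.comm (free C y (x ⊙ₗ n)) m
  rw [canDescApp, ← nameAct_map, Category.assoc, ← reassoc_of% h, nameAct_canUnit, Category.assoc,
    reassoc_of% (freeμ_freeδ y (x ⊙ₗ n) x m), ← canAt_naturality, evAct_coevAct_assoc]

end Canonical

/-- `f` is the transpose of `g` under `Hom(y, X ⊙ₗ m) ≅ Hom(𝟙, [y, X ⊙ₗ m]) ≅ Hom(𝟙, X ⊗ [y, m]) ≅
Hom(x, X)`, the middle step using that the internal Hom is a module functor. -/
theorem exists_canUnit_comp (x : C) (y m : M) [ExactPairing x ((ihom C y).obj m)] {X : C}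
    (g : y ⟶ X ⊙ₗ m) : ∃ f : x ⟶ X, canUnit x y m ≫ f ⊵ₗ m = g := by
  let δ : (ihom C y).obj (X ⊙ₗ m) ⟶ X ⊗ (ihom C y).obj m := δₗ (ihom C y) X m
  have hδ : δ ≫ ihomμ C y X m = 𝟙 _ := δₗ_comp_μₗ (ihom C y) X m
  let t : 𝟙_ C ⟶ X ⊗ (ihom C y).obj m := ihomName C g ≫ δ
  let f := (λ_ x).inv ≫ (tensorRightHomEquiv (𝟙_ C) x ((ihom C y).obj m) X).symm t
  have hf : η_ x ((ihom C y).obj m) ≫ f ▷ (ihom C y).obj m = t := by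
    have h := (tensorRightHomEquiv (𝟙_ C) x ((ihom C y).obj m) X).apply_symm_apply t
    refine Eq.trans ?_ h
    simp [f, tensorRightHomEquiv, unitors_equal]
  refine ⟨f, ?_⟩
  have h1 : ihomμ C y x m ≫ (ihom C y).map (f ⊵ₗ m) =
      f ▷ (ihom C y).obj m ≫ ihomμ C y X m := (μₗ_naturality_left (ihom C y) f m).symm
  have h2 : ihomName C (canUnit x y m ≫ f ⊵ₗ m) = ihomName C g := by
    rw [← ihomName_map, ihomName_canUnit, Category.assoc, h1, reassoc_of% hf, Category.assoc, hδ,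
      Category.comp_id]
  rw [← cancel_epi (λₗ[C] y).hom, ← ihomName_ihomEv, h2, ihomName_ihomEv]

end Dual

end DoubleDual

/-! ### The canonical functor is an equivalence -/

section Equivalence

/-- A faithful right exact functor is an equivalence if it is full on morphisms out of a class of
objects that, together with their images, cover both categories. -/
theorem isEquivalence_of_covers {A : Type u₁} [Category.{v₁} A] [Abelian A]
    {B : Type u₂} [Category.{v₂} B] [Abelian B] (K : A ⥤ B) [K.Additive] [K.Faithful]
    [PreservesFiniteColimits K] (S : Set A)
    (hfull : ∀ x ∈ S, ∀ (Y : A) (γ : K.obj x ⟶ K.obj Y), ∃ f : x ⟶ Y, K.map f = γ)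
    (hA : ∀ X : A, ∃ x ∈ S, ∃ p : x ⟶ X, Epi p)
    (hB : ∀ Y : B, ∃ x ∈ S, ∃ p : K.obj x ⟶ Y, Epi p) : K.IsEquivalence where
  faithful := inferInstance
  full := ⟨fun {X Y} γ => by
    obtain ⟨x, hx, p, _⟩ := hA X
    obtain ⟨f, hf⟩ := hfull x hx Y (K.map p ≫ γ)
    have hk : kernel.ι p ≫ f = 0 := K.map_injective (by
      rw [K.map_comp, hf, ← K.map_comp_assoc, kernel.condition]
      simp)
    refine ⟨Abelian.epiDesc p f hk, ?_⟩
    rw [← cancel_epi (K.map p), ← hf, ← K.map_comp, Abelian.comp_epiDesc]⟩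
  essSurj := ⟨fun Y => by
    obtain ⟨x, hx, p, _⟩ := hB Y
    obtain ⟨x', hx', q, _⟩ := hB (kernel p)
    -- `Y` is the cokernel of a morphism `K x' ⟶ K x`. It lifts to `f`, and right exactness
    -- identifies `Y` with the image of the cokernel of `f`.
    obtain ⟨f, hf⟩ := hfull x' hx' x (q ≫ kernel.ι p)
    have h1 : cokernel (K.map f) ≅ cokernel (kernel.ι p) :=
      cokernelIsoOfEq hf ≪≫ cokernelEpiComp q (kernel.ι p)
    have h2 : cokernel (kernel.ι p) ≅ Y :=
      IsColimit.coconePointUniqueUpToIso (cokernelIsCokernel (kernel.ι p))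
        (Abelian.epiIsCokernelOfKernel (KernelFork.ofι (kernel.ι p) (kernel.condition p))
          (kernelIsKernel p))
    exact ⟨cokernel f, ⟨PreservesCokernel.iso K f ≪≫ h1 ≪≫ h2⟩⟩⟩

variable (k : Type w) [Field k]
    (C : Type u₁) [Category.{v₁} C] [Abelian C] [MonoidalCategory C] [Linear k C]
    (M : Type u₂) [Category.{v₂} M] [Abelian M] [MonoidalLeftAction C M] [Linear k M]
    [PreadditiveAction C M] [LinearAction C M k] [IsFiniteExactAction k C M]

include k in
-- Followed by evaluation at the separator, `can` becomes the exact functor `c ↦ c ⊙ₗ Q`; that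
-- evaluation is faithful and exact, so it reflects finite colimits.
theorem preservesFiniteColimits_can : PreservesFiniteColimits (can C M) := by
  have := IsFiniteExactAction.finite_hom' (k := k) C (M := M)
  obtain ⟨Q, _, hQ⟩ := IsFiniteExactAction.exists_separator' (k := k) (C := C) (M := M)
  have := IsFiniteExactAction.hasInternalHom k (Dual C M) M
  have := Dual.faithful_ev (C := Dual C M) k hQ
  have := reflectsIsomorphisms_of_reflectsMonomorphisms_of_reflectsEpimorphisms
    (Dual.ev (Dual C M) M Q)
  have : HasFiniteColimits (Dual (Dual C M) M) := inferInstance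
  refine ⟨fun J _ _ => ?_⟩
  have : HasColimitsOfShape J (Dual (Dual C M) M) := HasFiniteColimits.out J
  have : PreservesColimitsOfShape J (can C M ⋙ Dual.ev (Dual C M) M Q) :=
    inferInstanceAs (PreservesColimitsOfShape J (actionRight C Q))
  have := reflectsColimitsOfShape_of_reflectsIsomorphisms (J := J) (G := Dual.ev (Dual C M) M Q)
  exact preservesColimitsOfShape_of_reflects_of_preserves (can C M) (Dual.ev (Dual C M) M Q)

include k in
-- If `f` and `g` act equally, the image of `f - g` kills every `Z ⊙ₗ y`, which
-- `exists_action_ne_zero` forbids unless it is zero.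
theorem faithful_can [MonoidalPreadditive C] (hC : HasIndecomposableSemisimpleUnit C)
    (hM : ∃ y : M, ¬ IsZero y) : (can C M).Faithful where
  map_injective {X Y f g} h := by
    obtain ⟨y, hy⟩ := hM
    rw [← sub_eq_zero]
    by_contra h0
    have hI : ¬ IsZero (image (f - g)) := fun hz => h0 (by
      rw [← image.fac (f - g), hz.eq_zero_of_src (image.ι (f - g)), comp_zero])
    obtain ⟨Z, hZ⟩ := exists_action_ne_zero hC hI hy
    have h1 : (f - g) ⊵ₗ (Z ⊙ₗ y) = 0 := by
      have h2 : f ⊵ₗ (Z ⊙ₗ y) = g ⊵ₗ (Z ⊙ₗ y) :=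
        congrArg (fun t : (can C M).obj X ⟶ (can C M).obj Y => t.nat.app (Z ⊙ₗ y)) h
      exact ((actionRight C (Z ⊙ₗ y)).map_sub).trans (sub_eq_zero.2 h2)
    rw [← image.fac (f - g), MonoidalLeftAction.comp_actionHomLeft] at h1
    have h3 : image.ι (f - g) ⊵ₗ (Z ⊙ₗ y) = 0 := zero_of_epi_comp _ h1
    exact hZ (IsZero.of_mono_eq_zero _ h3)

include k in
/-- The canonical functor to the double dual is an equivalence. -/
theorem isEquivalence_can [MonoidalPreadditive C] (hC : HasIndecomposableSemisimpleUnit C)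
    (hM : ∃ y : M, ¬ IsZero y) : (can C M).IsEquivalence := by
  have := IsFiniteExactAction.hasInternalHom k C M
  have := IsFiniteExactAction.hasInternalHom k (Dual C M) M
  have := IsFiniteExactAction.finite_hom' (k := k) C (M := M)
  have := preservesFiniteColimits_can k C M
  have := faithful_can k C M hC hM
  obtain ⟨m, _, hm⟩ := IsFiniteExactAction.exists_separator' (k := k) (C := C) (M := M)
  have hx (y : M) : ∃ x : C, Nonempty (ExactPairing x ((ihom C y).obj m)) :=
    IsExactAction.exists_left_dual (M := M) _
  refine isEquivalence_of_covers (can C M)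
    {x | ∃ y : M, Nonempty (ExactPairing x ((ihom C y).obj m))} ?_ (fun X => ?_) (fun G => ?_)
  · rintro x ⟨y, ⟨_⟩⟩ Y γ
    obtain ⟨f, hf⟩ := Dual.exists_canUnit_comp x y m (Dual.canUnit x y m ≫ Dual.canAt γ m)
    refine ⟨f, ?_⟩
    ext n
    change Dual.canAt ((can C M).map f) n = Dual.canAt γ n
    -- Both morphisms are determined by their values on the universal element, where `f` was chosen
    -- to agree with `γ`.
    rw [Dual.canAt_eq _ x y m, Dual.canAt_eq _ x y m γ]
    exact congrArg (fun t => Dual.canDescApp ((can C M).obj Y) x t n) hf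
  -- For `y = X ⊙ₗ m` the identity gives `f` with `f ⊵ₗ m` split epic; as `m` is a separator and
  -- `can` is faithful, `f` is epic.
  · obtain ⟨x, ⟨_⟩⟩ := hx (X ⊙ₗ m)
    obtain ⟨f, hf⟩ := Dual.exists_canUnit_comp x (X ⊙ₗ m) m (𝟙 _)
    refine ⟨x, ⟨X ⊙ₗ m, ⟨inferInstance⟩⟩, f, Preadditive.epi_of_cancel_zero _ fun {Z} g hg => ?_⟩
    refine (can C M).map_injective (((Dual.eq_zero_of_separator k hm _ ?_)).trans
      ((can C M).map_zero _ _).symm)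
    have h1 : f ⊵ₗ m ≫ g ⊵ₗ m = 0 := by
      rw [← MonoidalLeftAction.comp_actionHomLeft, hg]
      exact (actionRight C m).map_zero _ _
    have h2 := congrArg (Dual.canUnit x (X ⊙ₗ m) m ≫ ·) h1
    simp only [reassoc_of% hf, comp_zero] at h2
    exact h2
  -- The identity of `G m` classifies a morphism whose component at the separator `m` is split epic,
  -- so the morphism is epic.
  · obtain ⟨x, ⟨_⟩⟩ := hx (G.functor.obj m)
    refine ⟨x, ⟨G.functor.obj m, ⟨inferInstance⟩⟩, Dual.canDesc G x (𝟙 (G.functor.obj m)),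
      Preadditive.epi_of_cancel_zero _ fun {Z} g hg => Dual.eq_zero_of_separator k hm _ ?_⟩
    have h1 : Dual.canDescApp G x (𝟙 (G.functor.obj m)) m ≫ g.nat.app m = 0 :=
      congrArg (fun t : (can C M).obj x ⟶ Z => t.nat.app m) hg
    have h2 := congrArg (Dual.canUnit x (G.functor.obj m) m ≫ ·) h1
    simp only [reassoc_of% (Dual.canUnit_canDescApp G x (𝟙 (G.functor.obj m))), comp_zero] at h2
    exact h2

end Equivalence

/-! ### Exact module categories over finite multi-tensor categories -/

section Assembly

variable {k : Type w} [Field k] {C : Type u₁} [Category.{v₁} C] [Abelian C] [Linear k C]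
    [MonoidalCategory C] {M : Type u₂} [Category.{v₂} M] [Abelian M] [Linear k M]
    [MonoidalLeftAction C M] [PreadditiveAction C M] [LinearAction C M k]

theorem IsFiniteCategory.exists_separator (hC : IsFiniteCategory C k) :
    ∃ P : C, Projective P ∧ IsSeparator P :=
  exists_projective_separator hC.finitelyManySimples (fun X => (hC.finiteLength X).2)
    fun S hS => by
      obtain ⟨P, p, hp⟩ := hC.projectiveCover S hS
      exact ⟨P, p, hp.projective, hp.epi⟩

theorem isExactAction_of_isExactModuleCategory (hC : IsFiniteMultiTensorCategory C k)
    (hM : IsExactModuleCategory C M k) : IsExactAction C M where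
  exact_left := hM.exact_left
  exact_right := hM.exact_right
  projective_action := hM.projective_action
  exists_left_dual X := by
    obtain ⟨h⟩ := hC.hasLeftDual X
    exact ⟨h.leftDual, ⟨h.exact⟩⟩
  exists_right_dual X := by
    obtain ⟨h⟩ := hC.hasRightDual X
    exact ⟨h.rightDual, ⟨h.exact⟩⟩
  exists_cover_unit := by
    have := hC.finiteDimensional_hom
    have := Abelian.hasFiniteBiproducts (C := C)
    obtain ⟨P, _, hP⟩ := hC.toIsFiniteCategory.exists_separator
    obtain ⟨n, f, _⟩ := exists_epi_of_isSeparator k hP (𝟙_ C)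
    exact ⟨_, f, projective_biproduct _, inferInstance⟩

theorem isFiniteExactAction_of_isExactModuleCategory (hC : IsFiniteMultiTensorCategory C k)
    (hM : IsExactModuleCategory C M k) : IsFiniteExactAction k C M :=
  have hE := isExactAction_of_isExactModuleCategory hC hM
  { hE with
    finite_hom := hC.finiteDimensional_hom
    finite_hom' := hM.finiteDimensional_hom
    exists_separator := hC.toIsFiniteCategory.exists_separator
    exists_separator' := by
      obtain ⟨P, p, hP, _⟩ := hE.exists_cover_unit
      -- Each simple `S` is covered by `P ⊙ₗ S`, which is projective by exactness of the module
      -- category.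
      exact exists_projective_separator hM.finitelyManySimples (fun X => (hM.finiteLength X).2)
        fun S _ => ⟨P ⊙ₗ S, p ⊵ₗ S ≫ (λₗ[C] S).hom, hM.projective_action P S hP, epi_comp _ _⟩
    exists_coseparator :=
      exists_injective_coseparator hM.finitelyManySimples (fun X => (hM.finiteLength X).1)
        fun S _ => exists_mono_injective C S
    artinian := fun X => (hM.finiteLength X).1
    noetherian := fun X => (hM.finiteLength X).2 }

theorem isFiniteMultiTensorCategory_dual (hC : IsFiniteMultiTensorCategory C k)
    (hM : IsExactModuleCategory C M k) : IsFiniteMultiTensorCategory (Dual C M) k :=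
  have := isFiniteExactAction_of_isExactModuleCategory hC hM
  have := IsFiniteExactAction.hasInternalHom k C M
  have := hC.monoidalPreadditive
  have hD := isFiniteCategory_dual k C M
  have : HasDuals (Dual C M) := ⟨exists_left_dual_dual k C M, exists_right_dual_dual k C M⟩
  have := (hD.finiteLength (𝟙_ (Dual C M))).1
  { hD with
    monoidalPreadditive := inferInstance
    monoidalLinear := inferInstance
    hasLeftDual := fun F => by
      obtain ⟨G, ⟨h⟩⟩ := exists_left_dual_dual k C M F
      exact ⟨⟨G⟩⟩
    hasRightDual := fun F => by
      obtain ⟨G, ⟨h⟩⟩ := exists_right_dual_dual k C M F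
      exact ⟨⟨G⟩⟩
    unit := Dual.hasIndecomposableSemisimpleUnit hC.unit }

theorem isFiniteTensorCategory_dual (hC : IsFiniteMultiTensorCategory C k)
    (hM : IsExactModuleCategory C M k) (hI : IsIndecomposableModule C M) :
    IsFiniteTensorCategory (Dual C M) k :=
  have := isFiniteExactAction_of_isExactModuleCategory hC hM
  have : HasDuals (Dual C M) := ⟨exists_left_dual_dual k C M, exists_right_dual_dual k C M⟩
  { isFiniteMultiTensorCategory_dual hC hM with
    simple_unit := Dual.simple_unit hI }

theorem isExactModuleCategory_dual (hC : IsFiniteMultiTensorCategory C k)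
    (hM : IsExactModuleCategory C M k) : IsExactModuleCategory (Dual C M) M k :=
  have := isFiniteExactAction_of_isExactModuleCategory hC hM
  have h : IsExactAction (Dual C M) M := (isFiniteExactAction_dual k C M).toIsExactAction
  { hM.toIsLocallyFinite with
    finitelyManySimples := hM.finitelyManySimples
    exact_left := h.exact_left
    exact_right := h.exact_right
    projective_action := h.projective_action }

theorem isEquivalence_can_of_isExactModuleCategory (hC : IsFiniteMultiTensorCategory C k)
    (hM : IsExactModuleCategory C M k) (hM₀ : ∃ X : M, ¬ IsZero X) : (can C M).IsEquivalence :=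
  have := isFiniteExactAction_of_isExactModuleCategory hC hM
  have := hC.monoidalPreadditive
  isEquivalence_can k C M hC.unit hM₀

end Assembly

end FinTens

theorem mainTheorem6 {k : Type*} [Field k] [IsAlgClosed k]
    {C : Type*} [Category C] [Preadditive C] [Linear k C] [MonoidalCategory C]
    (hC : FinTens.IsFiniteMultiTensorCategory C k)
    {M : Type*} [Category M] [Preadditive M] [Linear k M] [MonoidalLeftAction C M]
    [FinTens.PreadditiveAction C M] [FinTens.LinearAction C M k]
    (hM : FinTens.IsExactModuleCategory C M k) (hM₀ : ∃ X : M, ¬ IsZero X) :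
    (FinTens.can C M).IsEquivalence ∧
    FinTens.IsFiniteMultiTensorCategory (FinTens.Dual C M) k ∧
    (FinTens.IsIndecomposableModule C M →
      FinTens.IsFiniteTensorCategory (FinTens.Dual C M) k) ∧
    FinTens.IsExactModuleCategory (FinTens.Dual C M) M k := by
  -- These abelian structures have the given preadditive structures definitionally, so the
  -- hypotheses apply unchanged.
  let _ : Abelian C := hC.isAbelian.toAbelian
  let _ : Abelian M := hM.isAbelian.toAbelian
  exact ⟨FinTens.isEquivalence_can_of_isExactModuleCategory hC hM hM₀,
    FinTens.isFiniteMultiTensorCategory_dual hC hM,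
    FinTens.isFiniteTensorCategory_dual hC hM,
    FinTens.isExactModuleCategory_dual hC hM⟩
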